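/- Let $\xi_0,\xi_1,\dots$ be i.i.d. complex random variables that are nondegenerate (not almost surely constant) and satisfy $\mathbb P(\xi_0=0)=0$ and $\mathbb E\log(1+|\xi_0|)<\infty$. Let $$E_n(z)=\sum_{k=0}^n \xi_k\sqrt{\tbinom nk}\,z^k ,$$ let $0\le N_n\le n$ be integers, and put $D_n=n-N_n$. Let $\mu_n^E$ and $\mu^E_{D_n}$ be the sums of $\delta_z$ over the zeros $z$, counted with multiplicity, of $E_n$ and of the $N_n$-th derivative $E_n^{(N_n)}$, respectively. For $h>0$ and a Borel measure $\nu$ on $\mathbb C$ let $(\mathcal S_h\nu)(B)=\nu(B/h)$. Let $\mathbb D_r$ be the open disk of radius $r$ about $0$. Random measures $\nu_n$ converge to $\nu$ in probability (in distribution) if $\int\phi\,d\nu_n\to\int\phi\,d\nu$ in probability (in distribution) for every smooth compactly supported $\phi:\mathbb C\to\mathbb R$. Let $$\log p^E(t)=-\tfrac12 t\log t-\tfrac12(1-t)\log(1-t)\quad(0\le t\le 1),\qquad \log p^E(t)=-\infty\quad (t>1),$$ with $0\log 0=0$. The Legendre--Fenchel transform of a function $g:[0,\infty)\to(-\infty,\infty]$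 is $s\mapsto\sup_{t\ge0}(st-g(t))$, and a prime denotes the left derivative. 1. (a) If $N_n/n\to0$, let $I$ be the Legendre--Fenchel transform of $-\log p^E$. Then $\frac1{D_n}\mu^E_{D_n}$ and $\frac1n\mu^E_n$ both converge in probability to the same rotationally invariant probability measure $\mu$, given by $\mu(\mathbb D_r)=I'(\log r)$ for $r>0$. (b) If $N_n/n\to a\in(0,1)$, let $\log u_a(t)=\log p^E(t+a)+(t+a)\log(t+a)-t\log t+(1-a)\log(1-a)$ for $0\le t\le 1-a$ and $\log u_a(t)=-\infty$ for $t>1-a$, and let $I_a$ be the Legendre--Fenchel transform of $-\log u_a$. Then $\frac1{D_n}\mu^E_{D_n}$ converges in probability to a rotationally invariant probability measure $\mu_a$ with $\mu_a(\mathbb D_r)=\frac1{1-a}I_a'(\log r)$ for $r>0$. 2. Suppose $N_n/n\to1$. (a) If $D_n\ge1$ for all large $n$, then $\frac1{D_n}\mu^E_{D_n}\to\delta_0$ in probability. (b) If $D_n\to\infty$, then, with $R_n=n/D_n$, $\frac1{D_n}\mathcal S_{\sqrt{R_n}}(\mu^E_{D_n})$ converges in probability to the rotationally invariant probability measure $\mu$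 with $\mu(\mathbb D_r)=\frac{r(\sqrt{4+r^2}-r)}2$ for $r\in(0,\infty)$. (c) If $D_n=m$ is constant for all large $n$, then $\mathcal S_{\sqrt n}(\mu^E_{D_n})$ converges in distribution to the random measure of zeros (with multiplicity) of $f^E_m(z)=\sum_{k=0}^m\frac{\xi_k}{k!\sqrt{(m-k)!}}z^k$. -/

import Mathlib

open MeasureTheory ProbabilityTheory Filter Topology Set
open scoped ENNReal

namespace RandomZeros

noncomputable section

/-- The random elliptic polynomial `∑_{k ≤ n} ξ_k √(n choose k) z^k`. -/
def ellipticPoly {Ω : Type*} (ξ : ℕ → Ω → ℂ) (n : ℕ) (ω : Ω) : Polynomial ℂ :=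
  ∑ k ∈ Finset.range (n + 1),
    Polynomial.C (ξ k ω * (Real.sqrt (n.choose k : ℝ) : ℂ)) * Polynomial.X ^ k

/-- The random polynomial `∑_{k ≤ m} ξ_k / (k! √((m-k)!)) z^k`. -/
def limitPoly {Ω : Type*} (ξ : ℕ → Ω → ℂ) (m : ℕ) (ω : Ω) : Polynomial ℂ :=
  ∑ k ∈ Finset.range (m + 1),
    Polynomial.C (ξ k ω / ((k.factorial : ℂ) * (Real.sqrt ((m - k).factorial : ℝ) : ℂ))) *
      Polynomial.X ^ k

/-- The measure `∑_{z : p(z) = 0} δ_z`, zeros counted with multiplicity. -/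
def zeroMeasure (p : Polynomial ℂ) : Measure ℂ :=
  (p.roots.map Measure.dirac).sum

/-- The measure of zeros of the `N`-th derivative of the `n`-th elliptic polynomial. -/
def derivZeros {Ω : Type*} (ξ : ℕ → Ω → ℂ) (n N : ℕ) (ω : Ω) : Measure ℂ :=
  zeroMeasure (Polynomial.derivative^[N] (ellipticPoly ξ n ω))

/-- The scaling operator `(S_h ν)(B) = ν(B / h)`. -/
def scale (h : ℝ) (ν : Measure ℂ) : Measure ℂ :=
  ν.map (fun z : ℂ => (h : ℂ) * z)

/-- Convergence in probability of random measures to a deterministic measure, tested against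
smooth compactly supported functions. -/
def ConvInProb {Ω : Type*} [MeasurableSpace Ω] (P : Measure Ω)
    (ν : ℕ → Ω → Measure ℂ) (μ : Measure ℂ) : Prop :=
  ∀ φ : ℂ → ℝ, ContDiff ℝ ((⊤ : ℕ∞) : WithTop ℕ∞) φ → HasCompactSupport φ →
    TendstoInMeasure P (fun n ω => ∫ z, φ z ∂(ν n ω)) atTop (fun _ => ∫ z, φ z ∂μ)

/-- Convergence in distribution of random measures to a random measure, tested against
smooth compactly supported functions. -/
def ConvInDistr {Ω : Type*} [MeasurableSpace Ω] (P : Measure Ω) [IsProbabilityMeasure P]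
    (ν : ℕ → Ω → Measure ℂ) (μ : Ω → Measure ℂ) : Prop :=
  ∀ φ : ℂ → ℝ, ContDiff ℝ ((⊤ : ℕ∞) : WithTop ℕ∞) φ → HasCompactSupport φ →
    TendstoInDistribution (fun n ω => ∫ z, φ z ∂(ν n ω)) atTop
      (fun ω => ∫ z, φ z ∂(μ ω)) (fun _ => P) P

/-- Invariance under all rotations about the origin. -/
def RotInvariant (μ : Measure ℂ) : Prop :=
  ∀ c : ℂ, ‖c‖ = 1 → μ.map (fun z : ℂ => c * z) = μ

/-- The Legendre-Fenchel transform `s ↦ sup_{t ≥ 0} (s t - g t)` of an extended real function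
on `[0, ∞)`. -/
def legendreFenchel (g : ℝ → EReal) (s : ℝ) : EReal :=
  ⨆ t ∈ Ici (0 : ℝ), (((s * t : ℝ) : EReal) - g t)

/-- `d` is the left derivative at `s` of the extended real function `F`, which is required to be
finite on a left neighbourhood of `s`. -/
def HasLeftDerivAt (F : ℝ → EReal) (d s : ℝ) : Prop :=
  (∀ᶠ x in 𝓝[≤] s, F x ≠ ⊤ ∧ F x ≠ ⊥) ∧
    HasDerivWithinAt (fun x => (F x).toReal) d (Iic s) s

/-- `log p^E`, equal to `-∞` off `[0, 1]`. -/
def logPE (t : ℝ) : EReal :=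
  open Classical in
  if t ∈ Icc (0 : ℝ) 1 then
    ((-(1 / 2) * t * Real.log t - (1 / 2) * (1 - t) * Real.log (1 - t) : ℝ) : EReal)
  else ⊥

/-- `log u_a` for the elliptic polynomials, equal to `-∞` off `[0, 1 - a]`. -/
def logUE (a t : ℝ) : EReal :=
  open Classical in
  if t ∈ Icc (0 : ℝ) (1 - a) then
    logPE (t + a) +
      (((t + a) * Real.log (t + a) - t * Real.log t + (1 - a) * Real.log (1 - a) : ℝ) : EReal)
  else ⊥

end

end RandomZeros

namespace RandomZeros

noncomputable section

/-! ### The logarithmic kernel -/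

/-! The zero counting measure of p is (2π)⁻¹ times the distributional Laplacian of log |p|, so zeros
are controlled through log |p(z)|. By `convInProb_of_tendstoInMeasure_log` it suffices that, for
almost every z, D⁻¹ log |p(z)| minus a nonrandom constant converges in probability. Fubini and
subsequences reduce this to the deterministic `tendsto_sum_roots`, where an L² bound on a normalised
logarithmic kernel, uniform in the position of the zero, supplies the compactness.

The rescaled N-th derivative is ∑_{k ≤ D} ξ_{N+k} w_k z^k with log-concave w_k. Above, the
logarithmic moment and a union bound show that no coefficient exceeds e^{ηD}, so log |p(z)| exceeds
the logarithm of the largest w_k |z|^k by little. Below, the number of k whose term is within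
e^{-ηD} of the maximum tends to infinity, and a sum with many independent nondegenerate summands of
weight at least r rarely falls in a disk of radius r (`exists_prob_norm_sum_le`). Hence log |p(z)|
follows the maximal term (`tendstoInMeasure_log_norm_sum`).

The maximal term is convex in s = log |z| and its slope is the maximising index, located where
w_{k+1} |z| / w_k crosses 1. At k = yD the square of this ratio tends to β e^{2s} (a + (1-a)y)(1-y)
/ y², so the index divided by D tends to `radialCDF`, the root of a quadratic. This limiting slope
is the radial distribution function of the limit: `radialLaw` is built from the quantile function,
and by Jensen's formula its potential is convex with that slope. The same quadratic is the critical
point equation of the Legendre-Fenchel problem for `logUE`, which identifies the left derivative.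

For D constant, ξ_{N+k} is replaced by ξ_k, which preserves the law of the zeros; after
normalisation the polynomials then converge coefficientwise almost surely, and their zeros follow.
Convergence to δ₀ combines both regimes: along subsequences D is constant or tends to infinity. -/

lemma log_one_add_le_two_mul_sqrt {x : ℝ} (hx : 0 ≤ x) : Real.log (1 + x) ≤ 2 * √x := by
  have h1 : 1 + x ≤ (1 + √x) ^ 2 := by nlinarith [Real.sq_sqrt hx, Real.sqrt_nonneg x]
  calc Real.log (1 + x) ≤ Real.log ((1 + √x) ^ 2) := Real.log_le_log (by linarith) h1
    _ = 2 * Real.log (1 + √x) := by rw [Real.log_pow]; norm_num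
    _ ≤ 2 * √x := by
      have := Real.log_le_sub_one_of_pos (show 0 < 1 + √x by positivity)
      linarith

lemma abs_log_le_add_inv {x : ℝ} (hx : 0 ≤ x) : |Real.log x| ≤ x + x⁻¹ := by
  rcases hx.eq_or_lt with rfl | hx
  · simp
  · have h1 := Real.log_le_sub_one_of_pos hx
    have h2 := Real.log_le_sub_one_of_pos (inv_pos.2 hx)
    rw [Real.log_inv] at h2
    have := inv_pos.2 hx
    rw [abs_le]; constructor <;> linarith

lemma locallyIntegrable_inv_norm : LocallyIntegrable (fun z : ℂ => ‖z‖⁻¹) volume := by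
  refine locallyIntegrable_of_norm_le_rpow (C := 1) (α := 1) ?_ ?_ ?_ ?_
  · simp
  · simp
  · refine Eventually.of_forall fun x => ?_
    simp [Real.rpow_neg_one]
  · exact (measurable_norm.inv).aestronglyMeasurable

lemma locallyIntegrable_log_norm : LocallyIntegrable (fun z : ℂ => Real.log ‖z‖) volume := by
  have h : LocallyIntegrable (fun z : ℂ => ‖z‖ + ‖z‖⁻¹) volume :=
    (continuous_norm.locallyIntegrable).add locallyIntegrable_inv_norm
  refine h.mono (Real.measurable_log.comp measurable_norm).aestronglyMeasurable ?_
  refine Eventually.of_forall fun x => ?_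
  rw [Real.norm_eq_abs, Real.norm_of_nonneg (by positivity)]
  exact abs_log_le_add_inv (norm_nonneg x)

lemma locallyIntegrable_log_norm_sub (w : ℂ) :
    LocallyIntegrable (fun z : ℂ => Real.log ‖z - w‖) volume := by
  rw [locallyIntegrable_iff]
  intro K hK
  have hK' : IsCompact ((fun z => z - w) '' K) := hK.image (by fun_prop)
  have := locallyIntegrable_log_norm.integrableOn_isCompact hK'
  have hmp : MeasurePreserving (fun z : ℂ => z - w) volume volume := measurePreserving_sub_right _ w
  have h2 := (hmp.integrableOn_image (Homeomorph.subRight w).measurableEmbedding (s := K)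
    (f := fun z : ℂ => Real.log ‖z‖)).1 this
  exact h2

/-- The logarithmic kernel `log |z - w|`, normalised so as to be bounded as `w → ∞`. -/
def logKernel (z w : ℂ) : ℝ := Real.log ‖z - w‖ - Real.log (1 + ‖w‖)

lemma measurable_logKernel_left (w : ℂ) : Measurable (fun z => logKernel z w) := by
  unfold logKernel; fun_prop

/-- The two bounds come from |z - w| ≤ (1 + R)(1 + |w|) and 1 + |w| ≤ |z - w| + (1 + R). Trading log
(1 + x) for 2√x leaves an inverse square root singularity, whose square is still locally integrable
in the plane. -/
lemma abs_logKernel_le {R : ℝ} {z w : ℂ} (hz : ‖z‖ ≤ R) :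
    |logKernel z w| ≤ Real.log (1 + R) + 2 * √((1 + R) * ‖z - w‖⁻¹) := by
  have hR : 0 ≤ R := (norm_nonneg z).trans hz
  have hw := norm_nonneg w
  have hl : 0 ≤ Real.log (1 + R) := Real.log_nonneg (by linarith)
  have hs := Real.sqrt_nonneg ((1 + R) * ‖z - w‖⁻¹)
  unfold logKernel
  -- On the diagonal `Real.log 0 = 0`, so only the normalising term is left.
  by_cases hzw : z = w
  · subst hzw
    have h1 : Real.log (1 + ‖z‖) ≤ Real.log (1 + R) := Real.log_le_log (by linarith) (by linarith)
    have h0 : 0 ≤ Real.log (1 + ‖z‖) := Real.log_nonneg (by linarith)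
    simp only [sub_self, norm_zero, Real.log_zero, zero_sub, abs_neg, abs_of_nonneg h0]
    linarith [Real.sqrt_nonneg ((1 + R) * (0 : ℝ)⁻¹)]
  · have hp : 0 < ‖z - w‖ := norm_pos_iff.2 (sub_ne_zero.2 hzw)
    rw [abs_le]
    constructor
    · have h1 : 1 + ‖w‖ ≤ ‖z - w‖ * (1 + (1 + R) * ‖z - w‖⁻¹) := by
        have : ‖z - w‖ * (1 + (1 + R) * ‖z - w‖⁻¹) = ‖z - w‖ + (1 + R) := by field_simp
        rw [this]
        have := norm_sub_norm_le w z
        rw [norm_sub_rev] at this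
        linarith
      have h2 := Real.log_le_log (by linarith) h1
      rw [Real.log_mul hp.ne' (by positivity)] at h2
      have h3 := log_one_add_le_two_mul_sqrt (show 0 ≤ (1 + R) * ‖z - w‖⁻¹ by positivity)
      linarith
    · have h1 : ‖z - w‖ ≤ (1 + R) * (1 + ‖w‖) := by
        have := norm_sub_le z w
        nlinarith
      have h2 := Real.log_le_log hp h1
      rw [Real.log_mul (by positivity) (by positivity)] at h2
      linarith

lemma logKernel_sq_le {R : ℝ} {z w : ℂ} (hz : ‖z‖ ≤ R) :
    logKernel z w ^ 2 ≤ 2 * Real.log (1 + R) ^ 2 + 8 * (1 + R) * ‖z - w‖⁻¹ := by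
  have hR : 0 ≤ R := (norm_nonneg z).trans hz
  have h := abs_logKernel_le (w := w) hz
  have h0 : 0 ≤ (1 + R) * ‖z - w‖⁻¹ := by positivity
  have h1 : logKernel z w ^ 2 ≤ (Real.log (1 + R) + 2 * √((1 + R) * ‖z - w‖⁻¹)) ^ 2 := by
    rw [← sq_abs]; gcongr
  have h2 := Real.sq_sqrt h0
  nlinarith [sq_nonneg (Real.log (1 + R) - 2 * √((1 + R) * ‖z - w‖⁻¹))]

/-- Within distance 1 of w, translation invariance gives a bound free of w; farther away the
integrand is at most 1. -/
lemma exists_lintegral_inv_norm_sub_le (R : ℝ) :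
    ∃ C : ℝ≥0∞, C ≠ ∞ ∧ ∀ w : ℂ,
      ∫⁻ z in Metric.ball (0 : ℂ) R, ENNReal.ofReal ‖z - w‖⁻¹ ≤ C := by
  set A := ∫⁻ z in Metric.closedBall (0 : ℂ) 1, ENNReal.ofReal ‖z‖⁻¹ with hA
  have hAfin : A ≠ ∞ := by
    have := (locallyIntegrable_inv_norm.integrableOn_isCompact
      (isCompact_closedBall (0 : ℂ) 1)).lintegral_lt_top
    exact this.ne
  refine ⟨A + volume (Metric.ball (0 : ℂ) R), ?_, fun w => ?_⟩
  · exact ENNReal.add_ne_top.2 ⟨hAfin, measure_ball_lt_top.ne⟩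
  · have hpt : ∀ z : ℂ, ENNReal.ofReal ‖z - w‖⁻¹ ≤
        (Metric.closedBall (0 : ℂ) 1).indicator (fun z => ENNReal.ofReal ‖z‖⁻¹) (z - w) + 1 := by
      intro z
      by_cases h : z - w ∈ Metric.closedBall (0 : ℂ) 1
      · rw [indicator_of_mem h]; exact le_self_add
      · rw [indicator_of_notMem h, zero_add, ENNReal.ofReal_le_one]
        rw [mem_closedBall_zero_iff, not_le] at h
        exact inv_le_one_of_one_le₀ h.le
    calc ∫⁻ z in Metric.ball (0 : ℂ) R, ENNReal.ofReal ‖z - w‖⁻¹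
        ≤ ∫⁻ z in Metric.ball (0 : ℂ) R,
          ((Metric.closedBall (0 : ℂ) 1).indicator (fun z => ENNReal.ofReal ‖z‖⁻¹) (z - w) + 1) :=
          lintegral_mono hpt
      _ = (∫⁻ z in Metric.ball (0 : ℂ) R,
          (Metric.closedBall (0 : ℂ) 1).indicator (fun z => ENNReal.ofReal ‖z‖⁻¹) (z - w)) +
          volume (Metric.ball (0 : ℂ) R) := by
          rw [lintegral_add_right _ measurable_const]; simp
      _ ≤ A + volume (Metric.ball (0 : ℂ) R) := by
          gcongr
          refine (setLIntegral_le_lintegral _ _).trans ?_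
          rw [lintegral_sub_right_eq_self
            (fun z => (Metric.closedBall (0 : ℂ) 1).indicator (fun z => ENNReal.ofReal ‖z‖⁻¹) z) w,
            lintegral_indicator Metric.isClosed_closedBall.measurableSet]

/-- Uniformity in w is the point: averages of kernels over zeros stay bounded in L² wherever the
zeros lie, even if they escape to infinity. -/
lemma exists_eLpNorm_logKernel_le (R : ℝ) :
    ∃ C : ℝ≥0∞, C ≠ ∞ ∧ ∀ w : ℂ,
      eLpNorm (fun z => logKernel z w) 2 (volume.restrict (Metric.ball (0 : ℂ) R)) ≤ C := by
  obtain ⟨C, hC, h⟩ := exists_lintegral_inv_norm_sub_le R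
  set B : ℝ≥0∞ := ENNReal.ofReal (2 * Real.log (1 + R) ^ 2) * volume (Metric.ball (0 : ℂ) R) +
    ENNReal.ofReal (8 * (1 + R)) * C with hB
  have hBfin : B ≠ ∞ := ENNReal.add_ne_top.2 ⟨ENNReal.mul_ne_top ENNReal.ofReal_ne_top
    measure_ball_lt_top.ne, ENNReal.mul_ne_top ENNReal.ofReal_ne_top hC⟩
  refine ⟨B ^ (1 / 2 : ℝ), ENNReal.rpow_ne_top_of_nonneg (by norm_num) hBfin, fun w => ?_⟩
  rw [eLpNorm_eq_lintegral_rpow_enorm_toReal (by norm_num) (by norm_num)]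
  simp only [ENNReal.toReal_ofNat]
  gcongr
  calc ∫⁻ z in Metric.ball (0 : ℂ) R, ‖logKernel z w‖ₑ ^ (2 : ℝ)
      ≤ ∫⁻ z in Metric.ball (0 : ℂ) R, (ENNReal.ofReal (2 * Real.log (1 + R) ^ 2) +
          ENNReal.ofReal (8 * (1 + R)) * ENNReal.ofReal ‖z - w‖⁻¹) := by
        refine setLIntegral_mono' Metric.isOpen_ball.measurableSet fun z hz => ?_
        have hz' : ‖z‖ ≤ R := (mem_ball_zero_iff.1 hz).le
        have hR : 0 ≤ R := (norm_nonneg z).trans hz'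
        have := logKernel_sq_le (w := w) hz'
        rw [← ENNReal.ofReal_mul (by positivity), ← ENNReal.ofReal_add (by positivity)
          (by positivity), ENNReal.rpow_ofNat, Real.enorm_eq_ofReal_abs,
          ← ENNReal.ofReal_pow (abs_nonneg _), sq_abs]
        exact ENNReal.ofReal_le_ofReal this
    _ ≤ B := by
        rw [lintegral_add_left measurable_const, lintegral_const_mul _ (by fun_prop)]
        simp only [lintegral_const, Measure.restrict_apply_univ]
        rw [hB]
        gcongr
        exact h w

/-! ### The Laplacian and the logarithmic potential -/

/-- The Laplacian of a function on the complex plane. -/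
def lap (φ : ℂ → ℝ) (z : ℂ) : ℝ :=
  fderiv ℝ (fun x => fderiv ℝ φ x 1) z 1 + fderiv ℝ (fun x => fderiv ℝ φ x Complex.I) z Complex.I

lemma contDiff_fderiv_apply {φ : ℂ → ℝ} (hφ : ContDiff ℝ ((⊤ : ℕ∞) : WithTop ℕ∞) φ)
    (v : ℂ) :
    ContDiff ℝ ((⊤ : ℕ∞) : WithTop ℕ∞) (fun x => fderiv ℝ φ x v) :=
  (hφ.fderiv_right (m := ((⊤ : ℕ∞) : WithTop ℕ∞)) (by simp)).clm_apply contDiff_const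

lemma continuous_lap {φ : ℂ → ℝ} (hφ : ContDiff ℝ ((⊤ : ℕ∞) : WithTop ℕ∞) φ) :
    Continuous (lap φ) :=
  (contDiff_fderiv_apply (contDiff_fderiv_apply hφ 1) 1).continuous.add
    (contDiff_fderiv_apply (contDiff_fderiv_apply hφ Complex.I) Complex.I).continuous

lemma hasCompactSupport_lap {φ : ℂ → ℝ} (hc : HasCompactSupport φ) :
    HasCompactSupport (lap φ) :=
  HasCompactSupport.add ((hc.fderiv_apply (𝕜 := ℝ) 1).fderiv_apply (𝕜 := ℝ) 1)
    ((hc.fderiv_apply (𝕜 := ℝ) Complex.I).fderiv_apply (𝕜 := ℝ) Complex.I)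

/-- Integration by parts twice; only φ needs compact support. -/
lemma integral_mul_fderiv_fderiv {φ : ℂ → ℝ} (hφ : ContDiff ℝ ((⊤ : ℕ∞) : WithTop ℕ∞) φ)
    {g : ℂ → ℝ} (hg : ContDiff ℝ ((⊤ : ℕ∞) : WithTop ℕ∞) g)
    (hc : HasCompactSupport φ) (v : ℂ) :
    ∫ z, g z * fderiv ℝ (fun x => fderiv ℝ φ x v) z v =
      ∫ z, fderiv ℝ (fun x => fderiv ℝ g x v) z v * φ z := by
  have hφ1 := contDiff_fderiv_apply hφ v
  have hφ2 := contDiff_fderiv_apply hφ1 v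
  have hg1 := contDiff_fderiv_apply hg v
  have hg2 := contDiff_fderiv_apply hg1 v
  have hc1 := hc.fderiv_apply (𝕜 := ℝ) v
  have hc2 := hc1.fderiv_apply (𝕜 := ℝ) v
  have d {f : ℂ → ℝ} (hf : ContDiff ℝ ((⊤ : ℕ∞) : WithTop ℕ∞) f) (x : ℂ) :
      DifferentiableAt ℝ f x := (hf.differentiable (by simp)) x
  have int {f k : ℂ → ℝ} (hf : ContDiff ℝ ((⊤ : ℕ∞) : WithTop ℕ∞) f)
      (hk : ContDiff ℝ ((⊤ : ℕ∞) : WithTop ℕ∞) k) (hkc : HasCompactSupport k) :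
      Integrable (fun x => f x * k x) volume :=
    (hf.continuous.mul hk.continuous).integrable_of_hasCompactSupport hkc.mul_left
  rw [integral_mul_fderiv_eq_neg_fderiv_mul_of_integrable (f := g)
    (g := fun x => fderiv ℝ φ x v) (int hg1 hφ1 hc1) (int hg hφ2 hc2) (int hg hφ1 hc1)
    (fun x _ => d hg x) (fun x _ => d hφ1 x),
    integral_mul_fderiv_eq_neg_fderiv_mul_of_integrable (f := fun x => fderiv ℝ g x v)
    (g := φ) (int hg2 hφ hc) (int hg1 hφ1 hc1) (int hg1 hφ hc)
    (fun x _ => d hg1 x) (fun x _ => d hφ x), neg_neg]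

lemma integral_mul_lap {φ : ℂ → ℝ} (hφ : ContDiff ℝ ((⊤ : ℕ∞) : WithTop ℕ∞) φ)
    {g : ℂ → ℝ} (hg : ContDiff ℝ ((⊤ : ℕ∞) : WithTop ℕ∞) g)
    (hc : HasCompactSupport φ) : ∫ z, g z * lap φ z = ∫ z, lap g z * φ z := by
  have int {f k : ℂ → ℝ} (hf : ContDiff ℝ ((⊤ : ℕ∞) : WithTop ℕ∞) f)
      (hk : ContDiff ℝ ((⊤ : ℕ∞) : WithTop ℕ∞) k) (hkc : HasCompactSupport k) :
      Integrable (fun x => f x * k x) volume :=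
    (hf.continuous.mul hk.continuous).integrable_of_hasCompactSupport hkc.mul_left
  have A (v : ℂ) : Integrable (fun z => g z * fderiv ℝ (fun x => fderiv ℝ φ x v) z v) :=
    int hg (contDiff_fderiv_apply (contDiff_fderiv_apply hφ v) v)
      ((hc.fderiv_apply (𝕜 := ℝ) v).fderiv_apply (𝕜 := ℝ) v)
  have B (v : ℂ) : Integrable (fun z => fderiv ℝ (fun x => fderiv ℝ g x v) z v * φ z) :=
    int (contDiff_fderiv_apply (contDiff_fderiv_apply hg v) v) hφ hc
  unfold lap
  simp only [mul_add, add_mul]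
  rw [integral_add (A _) (A _), integral_add (B _) (B _), integral_mul_fderiv_fderiv hφ hg hc,
    integral_mul_fderiv_fderiv hφ hg hc]

lemma integral_lap {φ : ℂ → ℝ} (hφ : ContDiff ℝ ((⊤ : ℕ∞) : WithTop ℕ∞) φ)
    (hc : HasCompactSupport φ) : ∫ z, lap φ z = 0 := by
  have h := integral_mul_lap hφ (contDiff_const (c := (1 : ℝ))) hc
  have h0 : ∀ z, lap (fun _ => (1 : ℝ)) z = 0 := fun z => by simp [lap]
  simpa [h0] using h

lemma lap_comp_add_right {φ : ℂ → ℝ} (w z : ℂ) : lap (fun x => φ (x + w)) z = lap φ (z + w) := by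
  unfold lap
  have h (v : ℂ) : (fun x => fderiv ℝ (fun x => φ (x + w)) x v) =
      fun x => (fun y => fderiv ℝ φ y v) (x + w) := by
    ext x; rw [fderiv_comp_add_right]
  rw [h, h, fderiv_comp_add_right (f := fun y => fderiv ℝ φ y 1),
    fderiv_comp_add_right (f := fun y => fderiv ℝ φ y Complex.I)]

lemma lap_eq_zero_of_notMem_tsupport {φ : ℂ → ℝ} {z : ℂ} (hz : z ∉ tsupport φ) : lap φ z = 0 := by
  have hn : φ =ᶠ[𝓝 z] fun _ => 0 := notMem_tsupport_iff_eventuallyEq.1 hz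
  have h1 (v : ℂ) : (fun x => fderiv ℝ φ x v) =ᶠ[𝓝 z] fun _ => 0 := by
    filter_upwards [hn.fderiv (𝕜 := ℝ)] with x hx
    rw [hx]; simp
  unfold lap
  rw [(h1 1).fderiv_eq, (h1 Complex.I).fderiv_eq]
  simp

/-- A smooth regularisation of log |z|, whose Laplacian is an approximate identity of total mass 2π.
-/
lemma contDiff_log_norm_sq_add {ε : ℝ} (hε : 0 < ε) :
    ContDiff ℝ ((⊤ : ℕ∞) : WithTop ℕ∞) (fun z : ℂ => (1 / 2) * Real.log (‖z‖ ^ 2 + ε)) := by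
  refine contDiff_const.mul (ContDiff.log ?_ fun z => by positivity)
  exact (contDiff_norm_sq ℝ).add contDiff_const

lemma fderiv_log_norm_sq_add {ε : ℝ} (hε : 0 < ε) (z v : ℂ) :
    fderiv ℝ (fun z : ℂ => (1 / 2) * Real.log (‖z‖ ^ 2 + ε)) z v =
      inner ℝ z v / (‖z‖ ^ 2 + ε) := by
  have h1 : HasFDerivAt (fun z : ℂ => ‖z‖ ^ 2 + ε) (2 • (innerSL ℝ z)) z :=
    ((hasStrictFDerivAt_norm_sq z).hasFDerivAt).add_const ε
  have h2 := (h1.log (by positivity)).const_mul (1 / 2)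
  rw [h2.fderiv]
  simp
  field_simp

lemma fderiv_fderiv_log_norm_sq_add {ε : ℝ} (hε : 0 < ε) (z v : ℂ) :
    fderiv ℝ (fun x => fderiv ℝ (fun z : ℂ => (1 / 2) * Real.log (‖z‖ ^ 2 + ε)) x v) z v =
      ‖v‖ ^ 2 / (‖z‖ ^ 2 + ε) - 2 * (inner ℝ z v) ^ 2 / (‖z‖ ^ 2 + ε) ^ 2 := by
  have h0 : (fun x => fderiv ℝ (fun z : ℂ => (1 / 2) * Real.log (‖z‖ ^ 2 + ε)) x v) =
      fun x => inner ℝ v x / (‖x‖ ^ 2 + ε) := by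
    ext x; rw [fderiv_log_norm_sq_add hε, real_inner_comm]
  rw [h0]
  have h1 : HasFDerivAt (fun z : ℂ => ‖z‖ ^ 2 + ε) (2 • (innerSL ℝ z)) z :=
    ((hasStrictFDerivAt_norm_sq z).hasFDerivAt).add_const ε
  have h2 : HasFDerivAt (fun x : ℂ => inner ℝ v x) (innerSL ℝ v) z := (innerSL ℝ v).hasFDerivAt
  have hq : (‖z‖ ^ 2 + ε) ≠ 0 := by positivity
  have h3 := h2.mul ((hasDerivAt_inv hq).comp_hasFDerivAt z h1)
  have h4 : (fun x : ℂ => inner ℝ v x / (‖x‖ ^ 2 + ε)) =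
      (fun x : ℂ => inner ℝ v x) * (Inv.inv ∘ fun z : ℂ => ‖z‖ ^ 2 + ε) := by
    ext x; simp [div_eq_mul_inv]
  rw [h4, h3.fderiv]
  simp [real_inner_comm v z]
  field_simp
  ring

lemma lap_log_norm_sq_add {ε : ℝ} (hε : 0 < ε) (z : ℂ) :
    lap (fun z : ℂ => (1 / 2) * Real.log (‖z‖ ^ 2 + ε)) z = 2 * ε / (‖z‖ ^ 2 + ε) ^ 2 := by
  unfold lap
  rw [fderiv_fderiv_log_norm_sq_add hε, fderiv_fderiv_log_norm_sq_add hε]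
  have h1 : inner ℝ z (1 : ℂ) = z.re := by simp [Complex.inner]
  have h2 : inner ℝ z Complex.I = z.im := by simp [Complex.inner]
  rw [h1, h2]
  have h3 : ‖z‖ ^ 2 = z.re ^ 2 + z.im ^ 2 := by
    rw [Complex.sq_norm, Complex.normSq_apply]; ring
  have hq : (‖z‖ ^ 2 + ε) ≠ 0 := by positivity
  simp only [norm_one, Complex.norm_I]
  field_simp
  rw [h3]; ring

lemma integral_two_div_norm_sq_add_one_sq :
    Integrable (fun z : ℂ => 2 / (‖z‖ ^ 2 + 1) ^ 2) ∧
      ∫ z : ℂ, 2 / (‖z‖ ^ 2 + 1) ^ 2 = 2 * Real.pi := by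
  -- The factor y from polar coordinates turns the integrand into an exact derivative.
  have hd : ∀ y : ℝ, HasDerivAt (fun y : ℝ => -(y ^ 2 + 1)⁻¹) (y * (2 / (y ^ 2 + 1) ^ 2)) y := by
    intro y
    have h1 : HasDerivAt (fun y : ℝ => y ^ 2 + 1) (2 * y) y := by
      simpa using (hasDerivAt_pow 2 y).add_const (1 : ℝ)
    have h2 := (h1.inv (by positivity)).neg
    convert! h2 using 1
    field_simp
  have hlim : Tendsto (fun y : ℝ => -(y ^ 2 + 1)⁻¹) atTop (𝓝 0) := by
    have : Tendsto (fun y : ℝ => y ^ 2 + 1) atTop atTop :=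
      tendsto_atTop_add_const_right _ _ (tendsto_pow_atTop (by norm_num))
    simpa using (tendsto_inv_atTop_zero.comp this).neg
  have hint : IntegrableOn (fun y : ℝ => y * (2 / (y ^ 2 + 1) ^ 2)) (Ioi 0) :=
    integrableOn_Ioi_deriv_of_nonneg' (fun x _ => hd x)
      (fun x (hx : 0 < x) => by positivity) hlim
  have hval := integral_Ioi_of_hasDerivAt_of_tendsto' (fun x _ => hd x) hint hlim
  have hdim : Module.finrank ℝ ℂ = 2 := Complex.finrank_real_complex
  constructor
  · have := (integrable_fun_norm_addHaar (volume : Measure ℂ)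
      (f := fun y : ℝ => 2 / (y ^ 2 + 1) ^ 2))
    rw [hdim] at this
    rw [this]
    simpa using hint
  · have := integral_fun_norm_addHaar (volume : Measure ℂ) (fun y : ℝ => 2 / (y ^ 2 + 1) ^ 2)
    rw [hdim] at this
    rw [this]
    simp only [Nat.add_one_sub_one, pow_one, smul_eq_mul]
    rw [hval]
    simp [Measure.real]

/-- Both sides are limits of the same integrals as the regularisation is removed: the left one
directly, the right one after moving the Laplacian onto the regularised logarithm and rescaling. -/
lemma integral_log_norm_mul_lap_zero {φ : ℂ → ℝ} (hφ : ContDiff ℝ ((⊤ : ℕ∞) : WithTop ℕ∞) φ)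
    (hc : HasCompactSupport φ) :
    ∫ z, Real.log ‖z‖ * lap φ z = 2 * Real.pi * φ 0 := by
  set δ : ℕ → ℝ := fun n => 1 / ((n : ℝ) + 1) with hδdef
  have hδ0 : ∀ n, 0 < δ n := fun n => Nat.one_div_pos_of_nat
  have hδ1 : ∀ n, δ n ≤ 1 := fun n => by
    rw [hδdef]; simp only; rw [div_le_one (by positivity)]; linarith [n.cast_nonneg (α := ℝ)]
  have hδ : Tendsto δ atTop (𝓝 0) := tendsto_one_div_add_atTop_nhds_zero_nat
  have hlc := continuous_lap hφ
  have hls := hasCompactSupport_lap hc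
  -- the left hand sides
  have hleft : Tendsto (fun n => ∫ z : ℂ, (1 / 2) * Real.log (‖z‖ ^ 2 + δ n ^ 2) * lap φ z) atTop
      (𝓝 (∫ z, Real.log ‖z‖ * lap φ z)) := by
    -- Dominating function: ½ log (|z|² + δ²) is at least log |z|, and at most |z|² / 2 because log
    -- x ≤ x - 1 and δ ≤ 1.
    have hli : LocallyIntegrable (fun z : ℂ => |Real.log ‖z‖| + ‖z‖ ^ 2) volume := by
      refine LocallyIntegrable.add ?_ (Continuous.locallyIntegrable (by fun_prop))
      exact fun x => (locallyIntegrable_log_norm x).norm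
    refine tendsto_integral_of_dominated_convergence
      (fun z => (|Real.log ‖z‖| + ‖z‖ ^ 2) * |lap φ z|) ?_ ?_ ?_ ?_
    · intro n
      exact Continuous.aestronglyMeasurable
        ((contDiff_log_norm_sq_add (pow_pos (hδ0 n) 2)).continuous.mul hlc)
    · exact hli.integrable_smul_right_of_hasCompactSupport hlc.abs
        (hls.comp_left (g := fun x => |x|) (by simp))
    · intro n
      have h0 : ∀ᵐ z : ℂ, z ≠ 0 := Measure.ae_ne volume 0
      filter_upwards [h0] with z hz
      rw [norm_mul, Real.norm_eq_abs, Real.norm_eq_abs]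
      gcongr
      have hzp : 0 < ‖z‖ := norm_pos_iff.2 hz
      have hl1 : 2 * Real.log ‖z‖ ≤ Real.log (‖z‖ ^ 2 + δ n ^ 2) := by
        have := Real.log_le_log (by positivity) (show ‖z‖ ^ 2 ≤ ‖z‖ ^ 2 + δ n ^ 2 by
          nlinarith [hδ0 n])
        rwa [Real.log_pow] at this
      have hl2 : Real.log (‖z‖ ^ 2 + δ n ^ 2) ≤ ‖z‖ ^ 2 := by
        have h3 := Real.log_le_sub_one_of_pos (show 0 < ‖z‖ ^ 2 + δ n ^ 2 by positivity)
        nlinarith [hδ0 n, hδ1 n]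
      have h4 := neg_abs_le (Real.log ‖z‖)
      have h5 := abs_nonneg (Real.log ‖z‖)
      rw [abs_le]; constructor <;> nlinarith
    · have h0 : ∀ᵐ z : ℂ, z ≠ 0 := Measure.ae_ne volume 0
      filter_upwards [h0] with z hz
      have hzp : 0 < ‖z‖ := norm_pos_iff.2 hz
      refine Tendsto.mul_const _ ?_
      have h1 : Tendsto (fun n => ‖z‖ ^ 2 + δ n ^ 2) atTop (𝓝 (‖z‖ ^ 2)) := by
        simpa using (hδ.pow 2).const_add (‖z‖ ^ 2)
      have h2 := ((Real.continuousAt_log (by positivity : ‖z‖ ^ 2 ≠ 0)).tendsto.comp h1).const_mul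
        (1 / 2)
      rw [Real.log_pow] at h2
      simpa using h2
  -- the right hand sides
  have hright : Tendsto (fun n => ∫ z : ℂ, 2 / (‖z‖ ^ 2 + 1) ^ 2 * φ (δ n • z)) atTop
      (𝓝 (∫ z : ℂ, 2 / (‖z‖ ^ 2 + 1) ^ 2 * φ 0)) := by
    obtain ⟨B, hB⟩ := hφ.continuous.bounded_above_of_compact_support hc
    have hφc := hφ.continuous
    refine tendsto_integral_of_dominated_convergence
      (fun z : ℂ => 2 / (‖z‖ ^ 2 + 1) ^ 2 * B) ?_ ?_ ?_ ?_
    · intro n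
      refine AEStronglyMeasurable.mul integral_two_div_norm_sq_add_one_sq.1.1 ?_
      exact Continuous.aestronglyMeasurable (by fun_prop)
    · exact integral_two_div_norm_sq_add_one_sq.1.mul_const B
    · intro n
      refine Eventually.of_forall fun z => ?_
      rw [norm_mul, Real.norm_of_nonneg (by positivity)]
      gcongr
      exact hB _
    · refine Eventually.of_forall fun z => ?_
      refine Tendsto.const_mul _ ?_
      have : Tendsto (fun n => δ n • z) atTop (𝓝 0) := by simpa using hδ.smul_const z
      exact (hφc.tendsto 0).comp this
  rw [integral_mul_const, integral_two_div_norm_sq_add_one_sq.2] at hright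
  refine tendsto_nhds_unique hleft (hright.congr fun n => ?_)
  rw [integral_mul_lap hφ (contDiff_log_norm_sq_add (pow_pos (hδ0 n) 2)) hc]
  simp only [lap_log_norm_sq_add (pow_pos (hδ0 n) 2)]
  -- The substitution z ↦ δz turns the regularised Laplacian into a fixed profile tested against
  -- φ(δz).
  have h := Measure.integral_comp_smul (volume : Measure ℂ)
    (fun z => 2 * δ n ^ 2 / (‖z‖ ^ 2 + δ n ^ 2) ^ 2 * φ z) (δ n)
  rw [Complex.finrank_real_complex, abs_of_pos (by have := hδ0 n; positivity)] at h
  have hne := (hδ0 n).ne'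
  have h' : ∫ z : ℂ, 2 * δ n ^ 2 / (‖z‖ ^ 2 + δ n ^ 2) ^ 2 * φ z =
      δ n ^ 2 • ∫ z : ℂ, 2 * δ n ^ 2 / (‖δ n • z‖ ^ 2 + δ n ^ 2) ^ 2 * φ (δ n • z) := by
    rw [h, smul_smul, mul_inv_cancel₀ (by positivity), one_smul]
  rw [h', ← integral_smul]
  refine integral_congr_ae (Eventually.of_forall fun z => ?_)
  simp only [norm_smul, Real.norm_of_nonneg (hδ0 n).le, smul_eq_mul]
  have : (δ n * ‖z‖) ^ 2 + δ n ^ 2 = δ n ^ 2 * (‖z‖ ^ 2 + 1) := by ring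
  rw [this]
  field_simp

/-- The logarithm is the fundamental solution of the Laplace equation in the plane. -/
lemma integral_log_norm_sub_mul_lap {φ : ℂ → ℝ} (hφ : ContDiff ℝ ((⊤ : ℕ∞) : WithTop ℕ∞) φ)
    (hc : HasCompactSupport φ) (w : ℂ) :
    ∫ z, Real.log ‖z - w‖ * lap φ z = 2 * Real.pi * φ w := by
  have h := integral_log_norm_mul_lap_zero (φ := fun x => φ (x + w))
    (hφ.comp (contDiff_id.add contDiff_const))
    (hc.comp_homeomorph (Homeomorph.addRight w))
  simp only [lap_comp_add_right, zero_add] at h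
  rw [← h, ← integral_add_right_eq_self _ w]
  simp

/-! ### Zeros of polynomials and logarithmic potentials -/

lemma integral_zeroMeasure (p : Polynomial ℂ) (φ : ℂ → ℝ) :
    Integrable φ (zeroMeasure p) ∧ ∫ z, φ z ∂(zeroMeasure p) = (p.roots.map φ).sum := by
  unfold zeroMeasure
  generalize p.roots = s
  induction s using Multiset.induction with
  | empty => simp
  | cons a s ih =>
    have ha : Integrable φ (Measure.dirac a) := integrable_dirac (by simp)
    simp only [Multiset.map_cons, Multiset.sum_cons]
    refine ⟨ha.add_measure ih.1, ?_⟩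
    rw [integral_add_measure ha ih.1, ih.2, integral_dirac]

lemma integral_smul_zeroMeasure (p : Polynomial ℂ) (φ : ℂ → ℝ) (d : ℕ) :
    ∫ z, φ z ∂((d : ℝ≥0∞)⁻¹ • zeroMeasure p) = (d : ℝ)⁻¹ * (p.roots.map φ).sum := by
  rw [integral_smul_measure, (integral_zeroMeasure p φ).2]
  simp

lemma log_norm_eval (p : Polynomial ℂ) {z : ℂ} (hz : z ∉ p.roots) :
    Real.log ‖p.eval z‖ =
      Real.log ‖p.leadingCoeff‖ + (p.roots.map fun w => Real.log ‖z - w‖).sum := by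
  -- The zero polynomial has empty `roots`, and both remaining logarithms are `Real.log 0 = 0`.
  by_cases hp : p = 0
  · simp [hp]
  have h := (IsAlgClosed.splits p).eval_eq_prod_roots z
  have hne : ∀ x ∈ p.roots.map (fun w => ‖z - w‖), x ≠ 0 := by
    intro x hx
    obtain ⟨w, hw, rfl⟩ := Multiset.mem_map.1 hx
    exact norm_ne_zero_iff.2 (sub_ne_zero.2 fun h => hz (h ▸ hw))
  have hprod : ‖(p.roots.map fun w => z - w).prod‖ = (p.roots.map fun w => ‖z - w‖).prod := by
    have := map_multiset_prod (normHom : ℂ →*₀ ℝ) (p.roots.map fun w => z - w)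
    simpa [Multiset.map_map, Function.comp_def] using this
  rw [h, norm_mul, Real.log_mul (by simpa using hp) ?_, hprod, Real.log_multiset_prod hne,
    Multiset.map_map]
  · rfl
  · rw [hprod]
    exact Multiset.prod_ne_zero fun h0 => hne 0 h0 rfl

lemma ae_log_norm_eval (p : Polynomial ℂ) : ∀ᵐ z : ℂ, Real.log ‖p.eval z‖ =
      Real.log ‖p.leadingCoeff‖ + (p.roots.map fun w => Real.log ‖z - w‖).sum := by
  have : ∀ᵐ z : ℂ, z ∉ p.roots := by
    have h : (volume : Measure ℂ) (p.roots.toFinset : Set ℂ) = 0 :=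
      (Finset.countable_toSet _).measure_zero _
    filter_upwards [measure_eq_zero_iff_ae_notMem.1 h] with z hz
    simpa using hz
  filter_upwards [this] with z hz using log_norm_eval p hz

/-- Each linear factor contributes its value of φ, and the leading coefficient drops out because a
Laplacian of a test function integrates to 0. -/
lemma sum_roots_eq_integral {φ : ℂ → ℝ} (hφ : ContDiff ℝ ((⊤ : ℕ∞) : WithTop ℕ∞) φ)
    (hc : HasCompactSupport φ) (p : Polynomial ℂ) :
    Integrable (fun z => Real.log ‖p.eval z‖ * lap φ z) ∧
      2 * Real.pi * (p.roots.map φ).sum = ∫ z, Real.log ‖p.eval z‖ * lap φ z := by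
  have hlc := continuous_lap hφ
  have hls := hasCompactSupport_lap hc
  have key : ∀ s : Multiset ℂ,
      Integrable (fun z => (s.map fun w => Real.log ‖z - w‖).sum * lap φ z) ∧
      ∫ z, (s.map fun w => Real.log ‖z - w‖).sum * lap φ z = 2 * Real.pi * (s.map φ).sum := by
    intro s
    induction s using Multiset.induction with
    | empty => simp
    | cons a s ih =>
      have ha : Integrable (fun z => Real.log ‖z - a‖ * lap φ z) :=
        (locallyIntegrable_log_norm_sub a).integrable_smul_right_of_hasCompactSupport hlc hls
      simp only [Multiset.map_cons, Multiset.sum_cons, add_mul, mul_add]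
      refine ⟨ha.add ih.1, ?_⟩
      rw [integral_add ha ih.1, ih.2, integral_log_norm_sub_mul_lap hφ hc]
  have hae : (fun z => Real.log ‖p.eval z‖ * lap φ z) =ᵐ[volume]
      fun z => Real.log ‖p.leadingCoeff‖ * lap φ z +
        (p.roots.map fun w => Real.log ‖z - w‖).sum * lap φ z := by
    filter_upwards [ae_log_norm_eval p] with z hz
    rw [hz, add_mul]
  have hl := (hlc.integrable_of_hasCompactSupport hls (μ := volume)).const_mul
    (Real.log ‖p.leadingCoeff‖)
  refine ⟨(hl.add (key _).1).congr hae.symm, ?_⟩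
  rw [integral_congr_ae hae, integral_add hl (key _).1, (key _).2, integral_const_mul,
    integral_lap hφ hc]
  ring

lemma eLpNorm_sum_logKernel_le {μ : Measure ℂ} {C : ℝ≥0∞}
    (hC : ∀ w : ℂ, eLpNorm (fun z => logKernel z w) 2 μ ≤ C) (s : Multiset ℂ) :
    Measurable (fun z => (s.map (logKernel z)).sum) ∧
    eLpNorm (fun z => (s.map (logKernel z)).sum) 2 μ ≤ (Multiset.card s : ℝ≥0∞) * C := by
  induction s using Multiset.induction with
  | empty => simp
  | cons a s ih =>
    simp only [Multiset.map_cons, Multiset.sum_cons, Multiset.card_cons]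
    refine ⟨(measurable_logKernel_left a).add ih.1, ?_⟩
    refine (eLpNorm_add_le (measurable_logKernel_left a).aestronglyMeasurable
      ih.1.aestronglyMeasurable (by norm_num)).trans ?_
    push_cast
    rw [add_mul, one_mul, add_comm]
    exact add_le_add ih.2 (hC a)

/-! ### Convergence of integrals under an `L²` bound -/

/-- If c were unbounded along a subsequence, convergence of c + v would force |v| → ∞ almost
everywhere, and Fatou's lemma would contradict the L² bound. No a priori control of the constants is
therefore needed. -/
lemma eventually_abs_le_of_tendsto_add {α : Type*} [MeasurableSpace α] {μ : Measure α}
    (hμ : μ ≠ 0) {v : ℕ → α → ℝ} {c : ℕ → ℝ} {V : α → ℝ} {C : ℝ≥0∞}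
    (hv : ∀ n, Measurable (v n)) (hC : C ≠ ∞) (hvC : ∀ n, eLpNorm (v n) 2 μ ≤ C)
    (hlim : ∀ᵐ z ∂μ, Tendsto (fun n => c n + v n z) atTop (𝓝 (V z))) :
    ∃ M : ℝ, ∀ᶠ n in atTop, |c n| ≤ M := by
  by_contra! hcon
  obtain ⟨ns, hns, hbig⟩ := extraction_forall_of_frequently
    (P := fun k n => (k : ℝ) < |c n|) fun k => hcon k
  have hctop : Tendsto (fun k => |c (ns k)|) atTop atTop :=
    tendsto_atTop_mono (fun k => (hbig k).le) tendsto_natCast_atTop_atTop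
  have hae : ∀ᵐ z ∂μ, liminf (fun k => ‖v (ns k) z‖ₑ ^ (2 : ℕ)) atTop = ∞ := by
    filter_upwards [hlim] with z hz
    have h1 := (hz.comp hns.tendsto_atTop).abs
    have h2 : Tendsto (fun k => |v (ns k) z|) atTop atTop := by
      have h3 : Tendsto (fun k => |c (ns k)| - |c (ns k) + v (ns k) z|) atTop atTop := by
        simpa [sub_eq_add_neg] using hctop.atTop_add (h1.neg)
      refine tendsto_atTop_mono (fun k => ?_) h3
      have := abs_sub (c (ns k) + v (ns k) z) (v (ns k) z)
      rw [add_sub_cancel_right] at this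
      linarith
    have h4 : Tendsto (fun k => ‖v (ns k) z‖ₑ) atTop (𝓝 ∞) := by
      simp only [Real.enorm_eq_ofReal_abs]
      exact ENNReal.tendsto_ofReal_nhds_top.2 h2
    have h5 : Tendsto (fun k => ‖v (ns k) z‖ₑ ^ (2 : ℕ)) atTop (𝓝 (∞ ^ 2)) :=
      ((ENNReal.continuous_pow 2).tendsto ∞).comp h4
    rw [h5.liminf_eq]; simp
  have hF : ∫⁻ z, liminf (fun k => ‖v (ns k) z‖ₑ ^ (2 : ℕ)) atTop ∂μ ≤
      liminf (fun k => ∫⁻ z, ‖v (ns k) z‖ₑ ^ (2 : ℕ) ∂μ) atTop :=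
    lintegral_liminf_le fun k => ((hv _).enorm.pow_const 2)
  have hle : ∀ n, ∫⁻ z, ‖v n z‖ₑ ^ (2 : ℕ) ∂μ ≤ C ^ 2 := by
    intro n
    have := hvC n
    rw [eLpNorm_eq_lintegral_rpow_enorm_toReal (by norm_num) (by norm_num)] at this
    simp only [ENNReal.toReal_ofNat, ENNReal.rpow_ofNat] at this
    have h2 := pow_le_pow_left' this 2
    rwa [← ENNReal.rpow_natCast, ← ENNReal.rpow_mul, show (1 / 2 : ℝ) * (2 : ℕ) = 1 by norm_num,
      ENNReal.rpow_one] at h2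
  have hlim2 : liminf (fun k => ∫⁻ z, ‖v (ns k) z‖ₑ ^ (2 : ℕ) ∂μ) atTop ≤ C ^ 2 := by
    refine liminf_le_of_frequently_le' (Eventually.frequently (Eventually.of_forall fun k => hle _))
  rw [lintegral_congr_ae hae, lintegral_const] at hF
  have : (∞ : ℝ≥0∞) * μ univ = ∞ := ENNReal.top_mul (by simpa using hμ)
  rw [this] at hF
  exact (ENNReal.pow_ne_top hC) (top_le_iff.1 (hF.trans hlim2))

/-- An L² bound gives uniform integrability: x ≤ min(x, K) + x² / K, where the truncated part tends
to 0 by dominated convergence and the rest is at most C² / K. -/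
lemma tendsto_lintegral_enorm_of_eLpNorm_two_le {α : Type*} [MeasurableSpace α] {μ : Measure α}
    [IsFiniteMeasure μ] {h : ℕ → α → ℝ} {C : ℝ≥0∞} (hC : C ≠ ∞)
    (hm : ∀ n, AEStronglyMeasurable (h n) μ) (hh : ∀ᶠ n in atTop, eLpNorm (h n) 2 μ ≤ C)
    (hlim : ∀ᵐ z ∂μ, Tendsto (fun n => h n z) atTop (𝓝 0)) :
    Tendsto (fun n => ∫⁻ z, ‖h n z‖ₑ ∂μ) atTop (𝓝 0) := by
  rw [ENNReal.tendsto_nhds_zero]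
  intro ε hε
  by_cases hεtop : ε = ∞
  · simp [hεtop]
  have hε2 : ε / 2 ≠ 0 := (ENNReal.half_pos hε.ne').ne'
  have hε2t : ε / 2 ≠ ∞ := ENNReal.div_ne_top hεtop (by norm_num)
  -- Chosen so that (C² + 1) / K is ε / 2; the added 1 keeps K nonzero when C = 0.
  set K : ℝ≥0∞ := (C ^ 2 + 1) / (ε / 2) with hK
  have hK0 : K ≠ 0 := ENNReal.div_ne_zero.2 ⟨by simp, hε2t⟩
  have hKt : K ≠ ∞ := ENNReal.div_ne_top (by simp [hC]) hε2
  have hpt : ∀ x : ℝ≥0∞, x ≤ min x K + K⁻¹ * x ^ 2 := by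
    intro x
    rcases le_total x K with hx | hx
    · rw [min_eq_left hx]; exact le_self_add
    · calc x = K⁻¹ * (K * x) := by rw [← mul_assoc, ENNReal.inv_mul_cancel hK0 hKt, one_mul]
        _ ≤ K⁻¹ * x ^ 2 := by rw [sq]; gcongr
        _ ≤ _ := le_add_self
  have hmin : Tendsto (fun n => ∫⁻ z, min ‖h n z‖ₑ K ∂μ) atTop (𝓝 0) := by
    have := tendsto_lintegral_of_dominated_convergence' (μ := μ)
      (F := fun n z => min ‖h n z‖ₑ K) (f := fun _ => 0) (fun _ => K)
      (fun n => (hm n).enorm.min aemeasurable_const)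
      (fun n => Eventually.of_forall fun z => min_le_right _ _)
      (by rw [lintegral_const]; exact ENNReal.mul_ne_top hKt (measure_ne_top _ _))
      (by
        filter_upwards [hlim] with z hz
        have h1 : Tendsto (fun n => ‖h n z‖ₑ) atTop (𝓝 0) := by
          simpa using hz.enorm
        simpa using h1.min (tendsto_const_nhds (x := K)))
    simpa using this
  have hmin' := (ENNReal.tendsto_nhds_zero.1 hmin) (ε / 2) (pos_iff_ne_zero.2 hε2)
  filter_upwards [hh, hmin'] with n hn hn2
  have hsq : ∫⁻ z, ‖h n z‖ₑ ^ (2 : ℕ) ∂μ ≤ C ^ 2 := by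
    have := hn
    rw [eLpNorm_eq_lintegral_rpow_enorm_toReal (by norm_num) (by norm_num)] at this
    simp only [ENNReal.toReal_ofNat, ENNReal.rpow_ofNat] at this
    have h2 := pow_le_pow_left' this 2
    rwa [← ENNReal.rpow_natCast, ← ENNReal.rpow_mul, show (1 / 2 : ℝ) * (2 : ℕ) = 1 by norm_num,
      ENNReal.rpow_one] at h2
  calc ∫⁻ z, ‖h n z‖ₑ ∂μ ≤ ∫⁻ z, (min ‖h n z‖ₑ K + K⁻¹ * ‖h n z‖ₑ ^ 2) ∂μ :=
        lintegral_mono fun z => hpt _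
    _ = (∫⁻ z, min ‖h n z‖ₑ K ∂μ) + K⁻¹ * ∫⁻ z, ‖h n z‖ₑ ^ 2 ∂μ := by
        rw [lintegral_add_left' ((hm n).enorm.min aemeasurable_const),
          lintegral_const_mul'' _ ((hm n).enorm.pow_const 2)]
    _ ≤ ε / 2 + K⁻¹ * (C ^ 2 + 1) := by
        gcongr
        exact hsq.trans le_self_add
    _ = ε := by
        rw [hK, ENNReal.inv_div (Or.inl hε2t) (Or.inl hε2),
          ENNReal.div_mul_cancel (by simp) (by simp [hC]), ENNReal.add_halves]

/-- Once the constants are bounded, c + v is bounded in L², Fatou puts V in L² as well, and the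
difference tends to 0 in L¹. -/
lemma tendsto_integral_mul_of_eLpNorm_two_le {α : Type*} [MeasurableSpace α] {μ : Measure α}
    [IsFiniteMeasure μ] {v : ℕ → α → ℝ} {c : ℕ → ℝ} {V ψ : α → ℝ} {C : ℝ≥0∞}
    (hv : ∀ n, Measurable (v n)) (hC : C ≠ ∞) (hvC : ∀ n, eLpNorm (v n) 2 μ ≤ C)
    (hlim : ∀ᵐ z ∂μ, Tendsto (fun n => c n + v n z) atTop (𝓝 (V z)))
    (hψ : Measurable ψ) {B : ℝ} (hB : ∀ z, ‖ψ z‖ ≤ B) :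
    Tendsto (fun n => ∫ z, (c n + v n z) * ψ z ∂μ) atTop (𝓝 (∫ z, V z * ψ z ∂μ)) := by
  by_cases hμ : μ = 0
  · simp [hμ]
  obtain ⟨M, hM⟩ := eventually_abs_le_of_tendsto_add hμ hv hC hvC hlim
  set C' : ℝ≥0∞ := eLpNorm (fun _ : α => M) 2 μ + C with hC'
  have hC't : C' ≠ ∞ := ENNReal.add_ne_top.2 ⟨(memLp_const M).eLpNorm_ne_top, hC⟩
  have hg : ∀ n, Measurable (fun z => c n + v n z) := fun n => (hv n).const_add _
  have hgC : ∀ᶠ n in atTop, eLpNorm (fun z => c n + v n z) 2 μ ≤ C' := by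
    filter_upwards [hM] with n hn
    refine (eLpNorm_add_le (f := fun _ => c n) aestronglyMeasurable_const
      (hv n).aestronglyMeasurable (by norm_num)).trans ?_
    refine add_le_add (eLpNorm_mono fun z => ?_) (hvC n)
    exact hn.trans (le_abs_self M)
  have hVm : AEStronglyMeasurable V μ :=
    aestronglyMeasurable_of_tendsto_ae atTop (fun n => (hg n).aestronglyMeasurable) hlim
  have hVC : eLpNorm V 2 μ ≤ C' := by
    refine (Lp.eLpNorm_lim_le_liminf_eLpNorm (fun n => (hg n).aestronglyMeasurable) V hlim).trans ?_
    exact liminf_le_of_frequently_le' hgC.frequently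
  have hdiff : Tendsto (fun n => ∫⁻ z, ‖(c n + v n z) - V z‖ₑ ∂μ) atTop (𝓝 0) := by
    refine tendsto_lintegral_enorm_of_eLpNorm_two_le (C := C' + C')
      (h := fun n z => (c n + v n z) - V z)
      (ENNReal.add_ne_top.2 ⟨hC't, hC't⟩) (fun n => (hg n).aestronglyMeasurable.sub hVm) ?_ ?_
    · filter_upwards [hgC] with n hn
      exact (eLpNorm_sub_le (hg n).aestronglyMeasurable hVm (by norm_num)).trans
        (add_le_add hn hVC)
    · filter_upwards [hlim] with z hz
      simpa using hz.sub_const (V z)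
  refine tendsto_integral_of_L1 _ (hVm.mul hψ.aestronglyMeasurable) ?_ ?_
  · filter_upwards [hgC] with n hn
    have h1 : MemLp (fun z => c n + v n z) 2 μ :=
      ⟨(hg n).aestronglyMeasurable, hn.trans_lt (lt_top_iff_ne_top.2 hC't)⟩
    exact (h1.integrable (by norm_num)).mul_bdd (c := B) hψ.aestronglyMeasurable
      (Eventually.of_forall hB)
  · have h0 : Tendsto (fun n => (∫⁻ z, ‖(c n + v n z) - V z‖ₑ ∂μ) * ENNReal.ofReal B) atTop
        (𝓝 0) := by
      simpa using ENNReal.Tendsto.mul_const hdiff (b := ENNReal.ofReal B) (Or.inr (by simp))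
    refine tendsto_of_tendsto_of_tendsto_of_le_of_le tendsto_const_nhds h0 (fun _ => bot_le)
      fun n => ?_
    have hae : AEMeasurable (fun z => ‖(c n + v n z) - V z‖ₑ) μ :=
      ((hg n).aestronglyMeasurable.sub hVm).enorm
    rw [← lintegral_mul_const'' _ hae]
    refine lintegral_mono fun z => ?_
    rw [Pi.mul_apply, ← sub_mul, enorm_mul]
    gcongr
    rw [← ofReal_norm]
    exact ENNReal.ofReal_le_ofReal (hB z)

/-- If the normalised logarithmic potentials of polynomials converge almost everywhere, then the
normalised zero counting measures converge. -/
lemma tendsto_sum_roots {φ : ℂ → ℝ} (hφ : ContDiff ℝ ((⊤ : ℕ∞) : WithTop ℕ∞) φ)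
    (hc : HasCompactSupport φ) {R : ℝ} (hR : tsupport φ ⊆ Metric.ball 0 R)
    {p : ℕ → Polynomial ℂ} {d : ℕ → ℕ} (hdeg : ∀ j, (p j).natDegree ≤ d j) {κ : ℕ → ℝ}
    {V : ℂ → ℝ}
    (hlim : ∀ᵐ z ∂(volume.restrict (Metric.ball (0 : ℂ) R)),
      Tendsto (fun j => (d j : ℝ)⁻¹ * Real.log ‖(p j).eval z‖ - κ j) atTop (𝓝 (V z))) :
    Tendsto (fun j => (d j : ℝ)⁻¹ * ((p j).roots.map φ).sum) atTop
      (𝓝 ((2 * Real.pi)⁻¹ * ∫ z, V z * lap φ z)) := by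
  set μ := volume.restrict (Metric.ball (0 : ℂ) R) with hμ
  have : IsFiniteMeasure μ := ⟨by
    rw [hμ, Measure.restrict_apply_univ]; exact measure_ball_lt_top⟩
  obtain ⟨C, hC, hk⟩ := exists_eLpNorm_logKernel_le R
  set v : ℕ → ℂ → ℝ := fun j z => (d j : ℝ)⁻¹ * ((p j).roots.map (logKernel z)).sum with hv
  -- Everything independent of z: the leading coefficient, the normalisations log (1 + |w|) of the
  -- kernel, and κ.
  set c : ℕ → ℝ := fun j => (d j : ℝ)⁻¹ * (Real.log ‖(p j).leadingCoeff‖ +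
    ((p j).roots.map fun w => Real.log (1 + ‖w‖)).sum) - κ j with hcdef
  have hvm : ∀ j, Measurable (v j) := fun j =>
    (eLpNorm_sum_logKernel_le hk (p j).roots).1.const_mul _
  have hvC : ∀ j, eLpNorm (v j) 2 μ ≤ C := by
    intro j
    have h1 := (eLpNorm_sum_logKernel_le hk (p j).roots).2
    have h2 : eLpNorm (v j) 2 μ ≤ ‖(d j : ℝ)⁻¹‖ₑ *
        eLpNorm (fun z => ((p j).roots.map (logKernel z)).sum) 2 μ :=
      eLpNorm_const_smul_le (c := (d j : ℝ)⁻¹)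
        (f := fun z => ((p j).roots.map (logKernel z)).sum)
    -- For d j = 0 the prefactor `0⁻¹ = 0` makes v j vanish.
    rcases Nat.eq_zero_or_pos (d j) with h0 | h0
    · rw [h0] at h2
      simp only [CharP.cast_eq_zero, inv_zero, enorm_zero, zero_mul] at h2
      exact h2.trans bot_le
    · have hcard : ((Multiset.card (p j).roots : ℕ) : ℝ≥0∞) ≤ d j := by
        exact_mod_cast ((p j).card_roots').trans (hdeg j)
      have hen : ‖(d j : ℝ)⁻¹‖ₑ = (d j : ℝ≥0∞)⁻¹ := by
        rw [enorm_inv (by positivity)]; simp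
      rw [hen] at h2
      calc eLpNorm (v j) 2 μ ≤ (d j : ℝ≥0∞)⁻¹ * ((d j : ℝ≥0∞) * C) :=
            h2.trans (mul_le_mul_right (h1.trans (mul_le_mul_left hcard _)) _)
        _ = C := by
            rw [← mul_assoc, ENNReal.inv_mul_cancel (by positivity) (by simp), one_mul]
  have hsum (j : ℕ) (z : ℂ) : ((p j).roots.map fun w => Real.log ‖z - w‖).sum =
      ((p j).roots.map (logKernel z)).sum +
        ((p j).roots.map fun w => Real.log (1 + ‖w‖)).sum := by
    rw [← Multiset.sum_map_add]
    congr 2; ext w; simp [logKernel]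
  have hae : ∀ᵐ z : ℂ, ∀ j, (d j : ℝ)⁻¹ * Real.log ‖(p j).eval z‖ - κ j = c j + v j z := by
    rw [ae_all_iff]
    intro j
    filter_upwards [ae_log_norm_eval (p j)] with z hz
    rw [hz, hsum, hcdef, hv]
    ring
  obtain ⟨B, hB⟩ := (continuous_lap hφ).bounded_above_of_compact_support (hasCompactSupport_lap hc)
  have hmain := tendsto_integral_mul_of_eLpNorm_two_le (c := c) (V := V) (ψ := lap φ) hvm hC hvC
    (by
      filter_upwards [hlim, ae_restrict_of_ae hae] with z hz hz2
      exact hz.congr hz2) (continuous_lap hφ).measurable hB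
  have hsupp : ∀ g : ℂ → ℝ, ∫ z, g z * lap φ z ∂μ = ∫ z, g z * lap φ z := by
    intro g
    refine setIntegral_eq_integral_of_forall_compl_eq_zero fun z hz => ?_
    rw [lap_eq_zero_of_notMem_tsupport fun h => hz (hR h), mul_zero]
  simp only [hsupp] at hmain
  refine (hmain.const_mul ((2 * Real.pi)⁻¹)).congr fun j => ?_
  obtain ⟨hi, h1⟩ := sum_roots_eq_integral hφ hc (p j)
  have h2 : ∫ z, (c j + v j z) * lap φ z =
      (d j : ℝ)⁻¹ * ∫ z, Real.log ‖(p j).eval z‖ * lap φ z := by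
    have hl : Integrable (lap φ) :=
      (continuous_lap hφ).integrable_of_hasCompactSupport (hasCompactSupport_lap hc)
    -- Subtracting κ j changes nothing, since the Laplacian of φ has integral 0.
    rw [← integral_const_mul, ← sub_zero (∫ z, _ * (_ * _)),
      ← mul_zero (κ j), ← integral_lap hφ hc, ← integral_const_mul,
      ← integral_sub (hi.const_mul _) (hl.const_mul _)]
    refine integral_congr_ae ?_
    filter_upwards [hae] with z hz
    rw [← hz j]; ring
  rw [h2, ← h1]
  have := Real.pi_pos
  field_simp

/-! ### Random polynomials -/

/-- Measurability of the multiset of roots is avoided: the linear statistic is a parameter integral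
of a jointly measurable function. -/
lemma measurable_sum_roots {Ω : Type*} [MeasurableSpace Ω] {p : Ω → Polynomial ℂ}
    (hp : Measurable (fun x : Ω × ℂ => (p x.1).eval x.2)) {φ : ℂ → ℝ}
    (hφ : ContDiff ℝ ((⊤ : ℕ∞) : WithTop ℕ∞) φ) (hc : HasCompactSupport φ) :
    Measurable (fun ω => ((p ω).roots.map φ).sum) := by
  have h : (fun ω => ((p ω).roots.map φ).sum) =
      fun ω => (2 * Real.pi)⁻¹ * ∫ z, Real.log ‖(p ω).eval z‖ * lap φ z := by
    ext ω
    rw [← (sum_roots_eq_integral hφ hc (p ω)).2]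
    have := Real.pi_pos
    field_simp
  rw [h]
  refine Measurable.const_mul ?_ _
  have hm : Measurable (fun x : Ω × ℂ => Real.log ‖(p x.1).eval x.2‖ * lap φ x.2) :=
    (Real.measurable_log.comp hp.norm).mul ((continuous_lap hφ).measurable.comp measurable_snd)
  exact (hm.stronglyMeasurable.integral_prod_right (ν := volume)).measurable

lemma exists_ball_of_hasCompactSupport {φ : ℂ → ℝ} (hc : HasCompactSupport φ) :
    ∃ R : ℝ, tsupport φ ⊆ Metric.ball 0 R := by
  obtain ⟨R, hR⟩ := (IsCompact.isBounded hc).subset_ball 0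
  exact ⟨R, hR⟩

/-- If the normalised logarithmic potentials of random polynomials converge in probability at
almost every point, then so do the normalised zero counting measures. -/
theorem convInProb_of_tendstoInMeasure_log {Ω : Type*} [MeasurableSpace Ω] {P : Measure Ω}
    [IsProbabilityMeasure P] {p : ℕ → Ω → Polynomial ℂ} {d : ℕ → ℕ}
    (hdeg : ∀ j ω, (p j ω).natDegree ≤ d j)
    (hmeas : ∀ j, Measurable (fun x : Ω × ℂ => (p j x.1).eval x.2)) {κ : ℕ → ℝ} {V : ℂ → ℝ}
    (hV : Measurable V)
    (hlim : ∀ᵐ z : ℂ, TendstoInMeasure P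
      (fun j ω => (d j : ℝ)⁻¹ * Real.log ‖(p j ω).eval z‖ - κ j) atTop (fun _ => V z))
    {μ : Measure ℂ}
    (hμ : ∀ φ : ℂ → ℝ, ContDiff ℝ ((⊤ : ℕ∞) : WithTop ℕ∞) φ → HasCompactSupport φ →
      ∫ z, V z * lap φ z = 2 * Real.pi * ∫ z, φ z ∂μ) :
    ConvInProb P (fun j ω => (d j : ℝ≥0∞)⁻¹ • zeroMeasure (p j ω)) μ := by
  intro φ hφ hc
  simp only [integral_smul_zeroMeasure]
  obtain ⟨R, hR⟩ := exists_ball_of_hasCompactSupport hc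
  set ν := volume.restrict (Metric.ball (0 : ℂ) R) with hν
  have : IsFiniteMeasure ν := ⟨by
    rw [hν, Measure.restrict_apply_univ]; exact measure_ball_lt_top⟩
  set u : ℕ → Ω × ℂ → ℝ :=
    fun j x => (d j : ℝ)⁻¹ * Real.log ‖(p j x.1).eval x.2‖ - κ j with hu
  have hum : ∀ j, Measurable (u j) := fun j =>
    ((Real.measurable_log.comp (hmeas j).norm).const_mul _).sub_const _
  -- Integrating the exceptional probabilities over z, by dominated convergence, gives convergence
  -- in measure on the product space.
  have hprod : TendstoInMeasure (P.prod ν) u atTop (fun x => V x.2) := by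
    intro ε hε
    have hs : ∀ j, MeasurableSet {x : Ω × ℂ | ε ≤ edist (u j x) (V x.2)} := fun j =>
      measurableSet_le measurable_const ((hum j).edist (hV.comp measurable_snd))
    simp only [Measure.prod_apply_symm (hs _)]
    have h0 : (0 : ℝ≥0∞) = ∫⁻ _ : ℂ, 0 ∂ν := by simp
    rw [h0]
    refine tendsto_lintegral_of_dominated_convergence (fun _ => 1)
      (fun j => measurable_measure_prodMk_right (hs j)) (fun j => Eventually.of_forall fun z => ?_)
      (by simp) ?_
    · exact prob_le_one
    · filter_upwards [ae_restrict_of_ae hlim] with z hz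
      exact hz ε hε
  -- Along a further subsequence convergence holds almost everywhere on the product; for almost
  -- every ω it then holds for almost every z, and the deterministic result applies.
  rw [exists_seq_tendstoInMeasure_atTop_iff
    (fun j => ((measurable_sum_roots (hmeas j) hφ hc).const_mul _).aestronglyMeasurable)]
  intro ns hns
  obtain ⟨ms, hms, hae⟩ := (hprod.comp hns.tendsto_atTop).exists_seq_tendsto_ae
  refine ⟨ms, hms, ?_⟩
  filter_upwards [Measure.ae_ae_of_ae_prod hae] with ω hω
  have h := tendsto_sum_roots hφ hc hR (p := fun j => p (ns (ms j)) ω)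
    (d := fun j => d (ns (ms j))) (fun j => hdeg _ _) (κ := fun j => κ (ns (ms j))) (V := V) hω
  rw [hμ φ hφ hc] at h
  have := Real.pi_pos
  rwa [inv_mul_cancel_left₀ (by positivity)] at h

/-! ### Anti-concentration of weighted sums -/

lemma measurable_charFun_complex (ν : Measure ℂ) [IsFiniteMeasure ν] : Measurable (charFun ν) :=
  (continuous_charFun (μ := ν)).measurable

/-- Fubini, together with the characteristic function exp(-|x|² / 2) of the standard Gaussian. -/
lemma integral_charFun_stdGaussian (ν : Measure ℂ) [IsProbabilityMeasure ν] :
    ∫ t, charFun ν t ∂(stdGaussian ℂ) = ((∫ x, Real.exp (-‖x‖ ^ 2 / 2) ∂ν : ℝ) : ℂ) := by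
  simp only [charFun_apply]
  rw [integral_integral_swap]
  · rw [← integral_complex_ofReal]
    refine integral_congr_ae (Eventually.of_forall fun x => ?_)
    have := charFun_stdGaussian (E := ℂ) x
    rw [charFun_apply] at this
    simp only [real_inner_comm x] at this ⊢
    rw [this]
    push_cast
    rfl
  · refine Integrable.of_bound (C := 1) ?_ (Eventually.of_forall fun x => ?_)
    · refine Continuous.aestronglyMeasurable ?_
      simp only [Function.uncurry_def]
      fun_prop
    · exact (Complex.norm_exp_ofReal_mul_I _).le

/-- The symmetrisation of a law: the law of the difference of two independent copies. -/
def symmetrization (ρ : Measure ℂ) : Measure ℂ := (ρ.prod ρ).map (fun x => x.1 - x.2)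

instance (ρ : Measure ℂ) [IsProbabilityMeasure ρ] : IsProbabilityMeasure (symmetrization ρ) :=
  Measure.isProbabilityMeasure_map (by fun_prop)

lemma charFun_symmetrization (ρ : Measure ℂ) [IsProbabilityMeasure ρ] (t : ℂ) :
    charFun (symmetrization ρ) t = ((‖charFun ρ t‖ ^ 2 : ℝ) : ℂ) := by
  rw [symmetrization, charFun_apply, integral_map (by fun_prop)
    (Continuous.aestronglyMeasurable (by fun_prop))]
  have h : ∀ x : ℂ × ℂ, Complex.exp ((inner ℝ (x.1 - x.2) t : ℝ) * Complex.I) =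
      Complex.exp ((inner ℝ x.1 t : ℝ) * Complex.I) *
        Complex.exp ((inner ℝ x.2 (-t) : ℝ) * Complex.I) := by
    intro x
    rw [← Complex.exp_add, inner_sub_left, inner_neg_right]
    push_cast; ring_nf
  simp only [h]
  rw [integral_prod_mul (fun x : ℂ => Complex.exp ((inner ℝ x t : ℝ) * Complex.I))
    (fun x : ℂ => Complex.exp ((inner ℝ x (-t) : ℝ) * Complex.I)), ← charFun_apply,
    ← charFun_apply, charFun_neg, Complex.mul_conj, Complex.normSq_eq_norm_sq]

/-- Convolving l copies of the symmetrisation multiplies l factors |charFun|². -/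
lemma exists_charFun_eq_pow (ρ : Measure ℂ) [IsProbabilityMeasure ρ] (l : ℕ) :
    ∃ ν : Measure ℂ, IsProbabilityMeasure ν ∧
      ∀ t, charFun ν t = ((‖charFun ρ t‖ ^ (2 * l) : ℝ) : ℂ) := by
  induction l with
  | zero => exact ⟨Measure.dirac 0, inferInstance, fun t => by simp [charFun_dirac]⟩
  | succ l ih =>
    obtain ⟨ν, hν, h⟩ := ih
    refine ⟨Measure.conv ν (symmetrization ρ), inferInstance, fun t => ?_⟩
    rw [charFun_conv, h, charFun_symmetrization]
    push_cast
    ring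

/-- The integrand is itself a characteristic function, so its Gaussian average is ∫ exp(-|x|² / 2)
against some law. Multiplying the argument by b dilates that law by the conjugate of b, which for
|b| ≥ 1 can only decrease the integral. Large weights thus cannot worsen the concentration bound. -/
lemma integral_norm_charFun_pow_le (ρ : Measure ℂ) [IsProbabilityMeasure ρ] (l : ℕ) {b : ℂ}
    (hb : 1 ≤ ‖b‖) :
    ∫ t, ‖charFun ρ (b * t)‖ ^ (2 * l) ∂(stdGaussian ℂ) ≤
      ∫ t, ‖charFun ρ t‖ ^ (2 * l) ∂(stdGaussian ℂ) := by
  obtain ⟨ν, hν, h⟩ := exists_charFun_eq_pow ρ l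
  set ν' := ν.map (fun x => (starRingEnd ℂ b) * x) with hν'
  have : IsProbabilityMeasure ν' := Measure.isProbabilityMeasure_map (by fun_prop)
  have h' : ∀ t, charFun ν' t = ((‖charFun ρ (b * t)‖ ^ (2 * l) : ℝ) : ℂ) := by
    intro t
    rw [← h, charFun_apply, charFun_apply, hν', integral_map (by fun_prop)
      (Continuous.aestronglyMeasurable (by fun_prop))]
    refine integral_congr_ae (Eventually.of_forall fun x => ?_)
    simp only
    congr 3
    simp only [Complex.inner, map_mul, Complex.conj_conj]
    congr 1; ring
  have e1 := integral_charFun_stdGaussian ν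
  have e2 := integral_charFun_stdGaussian ν'
  simp only [h, h', integral_complex_ofReal] at e1 e2
  rw [Complex.ofReal_inj] at e1 e2
  rw [e1, e2, hν', integral_map (by fun_prop) (Continuous.aestronglyMeasurable (by fun_prop))]
  have hint : ∀ c : ℂ, Integrable (fun x : ℂ => Real.exp (-‖c * x‖ ^ 2 / 2)) ν := by
    intro c
    refine Integrable.of_bound (C := 1) (Continuous.aestronglyMeasurable (by fun_prop))
      (Eventually.of_forall fun x => ?_)
    rw [Real.norm_of_nonneg (Real.exp_pos _).le, Real.exp_le_one_iff]
    have := sq_nonneg ‖c * x‖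
    linarith
  refine integral_mono (hint _) (by simpa using hint 1) fun x => ?_
  simp only [norm_mul, RCLike.norm_conj]
  gcongr
  nlinarith [norm_nonneg x, norm_nonneg b]

/-- The projection of the Gaussian on the direction x is a nondegenerate real Gaussian, which has no
atoms, while cos equals 1 only on a countable set. -/
lemma stdGaussian_setOf_cos_inner_eq_one {x : ℂ} (hx : x ≠ 0) :
    stdGaussian ℂ {t | Real.cos (inner ℝ x t) = 1} = 0 := by
  set L : StrongDual ℝ ℂ := innerSL ℝ x with hL
  have hLn : ‖L‖ = ‖x‖ := innerSL_apply_norm (𝕜 := ℝ) x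
  have hmap : (stdGaussian ℂ).map L =
      gaussianReal ((stdGaussian ℂ)[L]) (Var[L; stdGaussian ℂ]).toNNReal :=
    IsGaussian.map_eq_gaussianReal L
  have hv : (Var[L; stdGaussian ℂ]).toNNReal ≠ 0 := by
    rw [variance_dual_stdGaussian, hLn]
    have : 0 < ‖x‖ := norm_pos_iff.2 hx
    simpa using by positivity
  have hna : NullSingletonClass ((stdGaussian ℂ).map L) := by
    rw [hmap]; exact nullSingletonClass_gaussianReal hv
  have hcount : (range fun k : ℤ => (k : ℝ) * (2 * Real.pi)).Countable := countable_range _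
  have hz := hcount.measure_zero ((stdGaussian ℂ).map L)
  rw [Measure.map_apply (by fun_prop) hcount.measurableSet] at hz
  refine measure_mono_null (fun t ht => ?_) hz
  obtain ⟨k, hk⟩ := (Real.cos_eq_one_iff _).1 ht
  exact ⟨k, hk⟩

/-- If |charFun ρ t| = 1, the symmetrisation has cos⟨x, t⟩ = 1 almost surely. For Gaussian-almost
every t this is excluded on x ≠ 0, so the symmetrisation would be concentrated at 0 and ρ at one
point. -/
lemma ae_norm_charFun_lt_one (ρ : Measure ℂ) [IsProbabilityMeasure ρ]
    (hρ : ¬ ∃ c : ℂ, ∀ᵐ x ∂ρ, x = c) :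
    ∀ᵐ t ∂(stdGaussian ℂ), ‖charFun ρ t‖ < 1 := by
  set ν := symmetrization ρ with hν
  have hms : MeasurableSet {y : ℂ × ℂ | ¬ (y.2 ≠ 0 ∧ Real.cos (inner ℝ y.2 y.1) = 1)} := by
    refine MeasurableSet.compl (MeasurableSet.inter ?_ ?_)
    · exact (measurableSet_singleton (0 : ℂ)).compl.preimage measurable_snd
    · exact (measurableSet_singleton (1 : ℝ)).preimage
        (f := fun y : ℂ × ℂ => Real.cos (inner ℝ y.2 y.1)) (by fun_prop)
  have h1 : ∀ᵐ t ∂(stdGaussian ℂ), ∀ᵐ x ∂ν, ¬ (x ≠ 0 ∧ Real.cos (inner ℝ x t) = 1) := by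
    rw [Measure.ae_ae_comm hms]
    refine Eventually.of_forall fun x => ?_
    by_cases hx : x = 0
    · simp [hx]
    · have := stdGaussian_setOf_cos_inner_eq_one hx
      filter_upwards [measure_eq_zero_iff_ae_notMem.1 this] with t ht h
      exact ht h.2
  filter_upwards [h1] with t ht
  refine lt_of_le_of_ne (norm_charFun_le_one t) fun hcon => hρ ?_
  -- the symmetrisation vanishes almost surely
  have h2 := charFun_symmetrization ρ t
  rw [hcon, charFun_apply, ← hν] at h2
  have hint : Integrable (fun x : ℂ => Real.cos (inner ℝ x t)) ν :=
    Integrable.of_bound (C := 1) (Continuous.aestronglyMeasurable (by fun_prop))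
      (Eventually.of_forall fun x => by simpa using Real.abs_cos_le_one _)
  have h3 : ∫ x, Real.cos (inner ℝ x t) ∂ν = 1 := by
    have hi : Integrable (fun x : ℂ => Complex.exp ((inner ℝ x t : ℝ) * Complex.I)) ν :=
      Integrable.of_bound (C := 1) (Continuous.aestronglyMeasurable (by fun_prop))
        (Eventually.of_forall fun x => (Complex.norm_exp_ofReal_mul_I _).le)
    have h4 := congrArg Complex.re h2
    have h5 : (∫ x : ℂ, Complex.exp ((inner ℝ x t : ℝ) * Complex.I) ∂ν).re =
        ∫ x : ℂ, (Complex.exp ((inner ℝ x t : ℝ) * Complex.I)).re ∂ν :=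
      (integral_re (𝕜 := ℂ) hi).symm
    rw [h5] at h4
    simp only [Complex.exp_ofReal_mul_I_re] at h4
    rw [h4]; norm_num
  have h4 : ∀ᵐ x ∂ν, 1 - Real.cos (inner ℝ x t) = 0 := by
    have h5 : ∫ x, (1 - Real.cos (inner ℝ x t)) ∂ν = 0 := by
      rw [integral_sub (integrable_const _) hint, h3]; simp
    exact (integral_eq_zero_iff_of_nonneg (fun x => sub_nonneg.2 (Real.cos_le_one _))
      ((integrable_const _).sub hint)).1 h5
  have h5 : ∀ᵐ x ∂ν, x = 0 := by
    filter_upwards [ht, h4] with x hx hx2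
    by_contra h0
    exact hx ⟨h0, by linarith⟩
  have h6 := Measure.ae_ae_of_ae_prod (ae_of_ae_map (by fun_prop) h5)
  obtain ⟨c, hc⟩ := h6.exists
  refine ⟨c, hc.mono fun x hx => ?_⟩
  simpa [eq_comm, sub_eq_zero] using hx

lemma tendsto_integral_norm_charFun_pow (ρ : Measure ℂ) [IsProbabilityMeasure ρ]
    (hρ : ¬ ∃ c : ℂ, ∀ᵐ x ∂ρ, x = c) :
    Tendsto (fun l : ℕ => ∫ t, ‖charFun ρ t‖ ^ (2 * l) ∂(stdGaussian ℂ)) atTop (𝓝 0) := by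
  have h0 : (0 : ℝ) = ∫ _ : ℂ, (0 : ℝ) ∂(stdGaussian ℂ) := by simp
  rw [h0]
  refine tendsto_integral_of_dominated_convergence (fun _ => 1) (fun l => ?_)
    (integrable_const _) (fun l => Eventually.of_forall fun t => ?_) ?_
  · exact ((measurable_charFun_complex ρ).norm.pow_const _).aestronglyMeasurable
  · rw [norm_pow, norm_norm]
    exact pow_le_one₀ (norm_nonneg _) (norm_charFun_le_one t)
  · filter_upwards [ae_norm_charFun_lt_one ρ hρ] with t ht
    refine (tendsto_pow_atTop_nhds_zero_of_lt_one (norm_nonneg _) ht).comp ?_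
    exact tendsto_id.const_mul_atTop' (by norm_num)

lemma charFun_map_mul_left {Ω : Type*} [MeasurableSpace Ω] {P : Measure Ω}
    {X : Ω → ℂ} (hX : Measurable X) (c t : ℂ) :
    charFun (P.map (fun ω => c * X ω)) t = charFun (P.map X) (starRingEnd ℂ c * t) := by
  rw [charFun_apply, charFun_apply, integral_map (by fun_prop)
    (Continuous.aestronglyMeasurable (by fun_prop)), integral_map (by fun_prop)
    (Continuous.aestronglyMeasurable (by fun_prop))]
  refine integral_congr_ae (Eventually.of_forall fun x => ?_)
  simp only [Complex.inner, map_mul]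
  congr 4; ring

/-- The arithmetic-geometric mean inequality separates the factors, so that each weight can be
compared with the unit weight on its own. -/
lemma prod_norm_le_sum_pow {s : Finset ℕ} {m : ℕ} (hm : s.card = m) (hm0 : m ≠ 0) {f : ℕ → ℝ}
    (hf : ∀ k, 0 ≤ f k) : ∏ k ∈ s, f k ≤ (m : ℝ)⁻¹ * ∑ k ∈ s, f k ^ m := by
  have h := Real.geom_mean_le_arith_mean_weighted s (fun _ => (m : ℝ)⁻¹) (fun k => f k ^ m)
    (fun _ _ => by positivity) (by simp [hm, hm0]) (fun k _ => pow_nonneg (hf k) _)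
  rw [← Finset.mul_sum] at h
  refine le_trans (le_of_eq ?_) h
  refine Finset.prod_congr rfl fun k _ => ?_
  rw [Real.pow_rpow_inv_natCast (hf k) hm0]

/-- Divide by r and call the sum S. On |S| ≤ 1 the variable exp(-|S|² / 2) is at least e^{-1/2}, and
its mean is the Gaussian average of the characteristic function of S. That is a product in which
factors outside K are bounded by 1 and those in K are treated by the arithmetic-geometric mean
inequality and `integral_norm_charFun_pow_le`. -/
lemma prob_norm_sum_le {Ω : Type*} [MeasurableSpace Ω] {P : Measure Ω} [IsProbabilityMeasure P]
    {ξ : ℕ → Ω → ℂ} (hmeas : ∀ k, Measurable (ξ k)) (hindep : iIndepFun ξ P)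
    (hident : ∀ k, IdentDistrib (ξ k) (ξ 0) P P) {T K : Finset ℕ} (hKT : K ⊆ T) {l : ℕ}
    (hl : l ≠ 0) (hK : K.card = 2 * l) {a : ℕ → ℂ} {r : ℝ} (hr : 0 < r)
    (ha : ∀ k ∈ K, r ≤ ‖a k‖) :
    P.real {ω | ‖∑ k ∈ T, a k * ξ k ω‖ ≤ r} ≤
      Real.exp (1 / 2) * ∫ t, ‖charFun (P.map (ξ 0)) t‖ ^ (2 * l) ∂(stdGaussian ℂ) := by
  set ρ := P.map (ξ 0) with hρ
  have : IsProbabilityMeasure ρ := Measure.isProbabilityMeasure_map (hmeas 0).aemeasurable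
  set b : ℕ → ℂ := fun k => a k / r with hb
  set X : ℕ → Ω → ℂ := fun k ω => b k * ξ k ω with hX
  have hXm : ∀ k, Measurable (X k) := fun k => (hmeas k).const_mul _
  have hXi : iIndepFun X P := hindep.comp (fun k x => b k * x) fun k => by fun_prop
  set S : Ω → ℂ := fun ω => ∑ k ∈ T, X k ω with hS
  have hSm : Measurable S := Finset.measurable_fun_sum _ fun k _ => hXm k
  have : IsProbabilityMeasure (P.map S) := Measure.isProbabilityMeasure_map hSm.aemeasurable
  have hSr : ∀ ω, ∑ k ∈ T, a k * ξ k ω = r * S ω := by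
    intro ω
    rw [hS, Finset.mul_sum]
    refine Finset.sum_congr rfl fun k _ => ?_
    have : (r : ℂ) ≠ 0 := by exact_mod_cast hr.ne'
    simp only [hX, hb]; field_simp
  -- the characteristic function of the sum
  have hchar : ∀ t, charFun (P.map S) t = ∏ k ∈ T, charFun ρ (starRingEnd ℂ (b k) * t) := by
    intro t
    have h1 := (hXi.restrict T).charFun_map_fun_finsetSum_eq_prod
      (fun k _ => (hXm k).aemeasurable)
    rw [hS, h1, Finset.prod_apply]
    refine Finset.prod_congr rfl fun k _ => ?_
    rw [charFun_map_mul_left (hmeas k), (hident k).map_eq]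
  have hcharle : ∀ t, ‖charFun (P.map S) t‖ ≤ ((2 * l : ℕ) : ℝ)⁻¹ *
      ∑ k ∈ K, ‖charFun ρ (starRingEnd ℂ (b k) * t)‖ ^ (2 * l) := by
    intro t
    rw [hchar, norm_prod]
    refine le_trans ?_ (prod_norm_le_sum_pow hK (by omega) fun k => norm_nonneg _)
    rw [← Finset.prod_sdiff hKT]
    refine mul_le_of_le_one_left (Finset.prod_nonneg fun k _ => norm_nonneg _) ?_
    exact Finset.prod_le_one (fun k _ => norm_nonneg _) fun k _ => norm_charFun_le_one _
  -- Gaussian smoothing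
  have hgauss : ∫ x, Real.exp (-‖x‖ ^ 2 / 2) ∂(P.map S) ≤
      ∫ t, ‖charFun ρ t‖ ^ (2 * l) ∂(stdGaussian ℂ) := by
    have h1 := integral_charFun_stdGaussian (P.map S)
    have h2 : ∫ x, Real.exp (-‖x‖ ^ 2 / 2) ∂(P.map S) ≤
        ∫ t, ‖charFun (P.map S) t‖ ∂(stdGaussian ℂ) := by
      have := norm_integral_le_integral_norm (μ := stdGaussian ℂ) (charFun (P.map S))
      rw [h1, Complex.norm_real] at this
      exact (le_abs_self _).trans this
    refine h2.trans ?_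
    have hint : ∀ c : ℂ, Integrable (fun t => ‖charFun ρ (c * t)‖ ^ (2 * l)) (stdGaussian ℂ) := by
      intro c
      refine Integrable.of_bound (C := 1) ?_ (Eventually.of_forall fun t => ?_)
      · exact (((measurable_charFun_complex ρ).comp
          (measurable_id.const_mul c)).norm.pow_const _).aestronglyMeasurable
      · rw [norm_pow, norm_norm]
        exact pow_le_one₀ (norm_nonneg _) (norm_charFun_le_one _)
    calc ∫ t, ‖charFun (P.map S) t‖ ∂(stdGaussian ℂ)
        ≤ ∫ t, ((2 * l : ℕ) : ℝ)⁻¹ *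
          ∑ k ∈ K, ‖charFun ρ (starRingEnd ℂ (b k) * t)‖ ^ (2 * l) ∂(stdGaussian ℂ) := by
          refine integral_mono_of_nonneg (Eventually.of_forall fun t => norm_nonneg _) ?_
            (Eventually.of_forall hcharle)
          exact (integrable_finsetSum _ fun k _ => hint _).const_mul _
      _ = ((2 * l : ℕ) : ℝ)⁻¹ * ∑ k ∈ K,
          ∫ t, ‖charFun ρ (starRingEnd ℂ (b k) * t)‖ ^ (2 * l) ∂(stdGaussian ℂ) := by
          rw [integral_const_mul, integral_finsetSum _ fun k _ => hint _]
      _ ≤ ((2 * l : ℕ) : ℝ)⁻¹ * ∑ k ∈ K,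
          ∫ t, ‖charFun ρ t‖ ^ (2 * l) ∂(stdGaussian ℂ) := by
          refine mul_le_mul_of_nonneg_left (Finset.sum_le_sum fun k hk => ?_) (by positivity)
          refine integral_norm_charFun_pow_le ρ l ?_
          rw [RCLike.norm_conj, hb, norm_div, Complex.norm_real, Real.norm_of_nonneg hr.le,
            one_le_div hr]
          exact ha k hk
      _ = ∫ t, ‖charFun ρ t‖ ^ (2 * l) ∂(stdGaussian ℂ) := by
          rw [Finset.sum_const, hK, nsmul_eq_mul, inv_mul_cancel_left₀]
          exact_mod_cast (by omega : 2 * l ≠ 0)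
  -- Chebyshev
  have hset : {ω | ‖∑ k ∈ T, a k * ξ k ω‖ ≤ r} = {ω | ‖S ω‖ ≤ 1} := by
    ext ω
    simp only [mem_ofPred_eq, hSr, norm_mul, Complex.norm_real, Real.norm_of_nonneg hr.le]
    exact mul_le_iff_le_one_right hr
  rw [hset]
  have hexpint : Integrable (fun ω => Real.exp (-‖S ω‖ ^ 2 / 2)) P := by
    refine Integrable.of_bound (C := 1) (by fun_prop) (Eventually.of_forall fun ω => ?_)
    rw [Real.norm_of_nonneg (Real.exp_pos _).le, Real.exp_le_one_iff]
    have := sq_nonneg ‖S ω‖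
    linarith
  have hmk := mul_meas_ge_le_integral_of_nonneg
    (Eventually.of_forall fun ω => (Real.exp_pos (-‖S ω‖ ^ 2 / 2)).le) hexpint
    (Real.exp (-(1 / 2)))
  rw [integral_map hSm.aemeasurable (Continuous.aestronglyMeasurable (by fun_prop))] at hgauss
  have hsub : P.real {ω | ‖S ω‖ ≤ 1} ≤
      P.real {ω | Real.exp (-(1 / 2)) ≤ Real.exp (-‖S ω‖ ^ 2 / 2)} := by
    refine measureReal_mono fun ω (hω : ‖S ω‖ ≤ 1) => ?_
    rw [mem_ofPred_eq, Real.exp_le_exp]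
    nlinarith [norm_nonneg (S ω)]
  calc P.real {ω | ‖S ω‖ ≤ 1}
      = Real.exp (1 / 2) * (Real.exp (-(1 / 2)) * P.real {ω | ‖S ω‖ ≤ 1}) := by
        rw [← mul_assoc, ← Real.exp_add]; simp
    _ ≤ _ := by
        gcongr
        refine le_trans ?_ (hmk.trans hgauss)
        gcongr

/-- Weighted sums of independent copies of a nondegenerate random variable are not concentrated in
a disk whose radius is small compared to many of the weights. -/
theorem exists_prob_norm_sum_le {Ω : Type*} [MeasurableSpace Ω] {P : Measure Ω}
    [IsProbabilityMeasure P] {ξ : ℕ → Ω → ℂ} (hmeas : ∀ k, Measurable (ξ k))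
    (hindep : iIndepFun ξ P) (hident : ∀ k, IdentDistrib (ξ k) (ξ 0) P P)
    (hnondeg : ¬ ∃ c : ℂ, ∀ᵐ ω ∂P, ξ 0 ω = c) {ε : ℝ} (hε : 0 < ε) :
    ∃ m : ℕ, ∀ (T K : Finset ℕ) (a : ℕ → ℂ) (r : ℝ), 0 < r → K ⊆ T → m ≤ K.card →
      (∀ k ∈ K, r ≤ ‖a k‖) → P.real {ω | ‖∑ k ∈ T, a k * ξ k ω‖ ≤ r} ≤ ε := by
  have : IsProbabilityMeasure (P.map (ξ 0)) :=
    Measure.isProbabilityMeasure_map (hmeas 0).aemeasurable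
  have hρ : ¬ ∃ c : ℂ, ∀ᵐ x ∂(P.map (ξ 0)), x = c := by
    rintro ⟨c, hc⟩
    exact hnondeg ⟨c, ae_of_ae_map (hmeas 0).aemeasurable hc⟩
  have h := (tendsto_integral_norm_charFun_pow _ hρ).const_mul (Real.exp (1 / 2))
  rw [mul_zero] at h
  obtain ⟨l, hl, hl0⟩ := ((h.eventually_le_const hε).and (eventually_ne_atTop 0)).exists
  refine ⟨2 * l, fun T K a r hr hKT hK ha => ?_⟩
  obtain ⟨K', hK', hcard⟩ := Finset.exists_subset_card_eq hK
  exact (prob_norm_sum_le hmeas hindep hident (hK'.trans hKT) hl0 hcard hr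
    fun k hk => ha k (hK' hk)).trans hl

/-! ### Logarithmic potentials of measures -/

lemma measurable_logKernel : Measurable (fun x : ℂ × ℂ => logKernel x.1 x.2) := by
  unfold logKernel; fun_prop

/-- The L² bound uniform in w gives a uniform L¹ bound in z, which the probability measure then
integrates. -/
lemma integrable_logKernel_mul_lap {φ : ℂ → ℝ} (hφ : ContDiff ℝ ((⊤ : ℕ∞) : WithTop ℕ∞) φ)
    (hc : HasCompactSupport φ) (μ : Measure ℂ) [IsProbabilityMeasure μ] :
    Integrable (fun x : ℂ × ℂ => logKernel x.1 x.2 * lap φ x.1) (volume.prod μ) := by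
  have hm : Measurable (fun x : ℂ × ℂ => logKernel x.1 x.2 * lap φ x.1) :=
    measurable_logKernel.mul ((continuous_lap hφ).measurable.comp measurable_fst)
  refine ⟨hm.aestronglyMeasurable, ?_⟩
  obtain ⟨R, hR⟩ := exists_ball_of_hasCompactSupport hc
  obtain ⟨B, hB⟩ := (continuous_lap hφ).bounded_above_of_compact_support (hasCompactSupport_lap hc)
  obtain ⟨C, hC, hk⟩ := exists_eLpNorm_logKernel_le R
  set ν := volume.restrict (Metric.ball (0 : ℂ) R) with hν
  have hνu : ν univ = volume (Metric.ball (0 : ℂ) R) := by rw [hν, Measure.restrict_apply_univ]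
  set D : ℝ≥0∞ := C * ν univ ^ (1 / (1 : ℝ≥0∞).toReal - 1 / (2 : ℝ≥0∞).toReal) with hD
  have hDfin : D ≠ ∞ := by
    refine ENNReal.mul_ne_top hC (ENNReal.rpow_ne_top_of_nonneg (by norm_num) ?_)
    rw [hνu]; exact measure_ball_lt_top.ne
  rw [hasFiniteIntegral_iff_enorm, lintegral_prod_symm _ hm.enorm.aemeasurable]
  have hbound : ∀ w : ℂ, ∫⁻ z, ‖logKernel z w * lap φ z‖ₑ ≤ D * ENNReal.ofReal B := by
    intro w
    calc ∫⁻ z, ‖logKernel z w * lap φ z‖ₑ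
        ≤ ∫⁻ z, (Metric.ball (0 : ℂ) R).indicator
            (fun z => ‖logKernel z w‖ₑ * ENNReal.ofReal B) z := by
          refine lintegral_mono fun z => ?_
          by_cases hz : z ∈ Metric.ball (0 : ℂ) R
          · rw [indicator_of_mem hz, enorm_mul]
            gcongr
            rw [← ofReal_norm]
            exact ENNReal.ofReal_le_ofReal (hB z)
          · rw [lap_eq_zero_of_notMem_tsupport fun h => hz (hR h)]; simp
      _ = (∫⁻ z, ‖logKernel z w‖ₑ ∂ν) * ENNReal.ofReal B := by
          rw [lintegral_indicator Metric.isOpen_ball.measurableSet,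
            lintegral_mul_const _ (measurable_logKernel_left w).enorm]
      _ ≤ D * ENNReal.ofReal B := by
          gcongr
          have h1 := eLpNorm_le_eLpNorm_mul_rpow_measure_univ (μ := ν) (p := 1) (q := 2)
            (by norm_num) (measurable_logKernel_left w).aestronglyMeasurable
          rw [eLpNorm_one_eq_lintegral_enorm] at h1
          exact h1.trans (mul_le_mul_left (hk w) _)
  calc ∫⁻ w, ∫⁻ z, ‖logKernel z w * lap φ z‖ₑ ∂volume ∂μ
      ≤ ∫⁻ _, D * ENNReal.ofReal B ∂μ := lintegral_mono hbound
    _ < ∞ := by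
      rw [lintegral_const, measure_univ, mul_one]
      exact (ENNReal.mul_ne_top hDfin ENNReal.ofReal_ne_top).lt_top

lemma integrable_log_norm_sub_mul_lap {φ : ℂ → ℝ} (hφ : ContDiff ℝ ((⊤ : ℕ∞) : WithTop ℕ∞) φ)
    (hc : HasCompactSupport φ) {μ : Measure ℂ} [IsProbabilityMeasure μ]
    (hμ : Integrable (fun w : ℂ => Real.log (1 + ‖w‖)) μ) :
    Integrable (fun x : ℂ × ℂ => Real.log ‖x.1 - x.2‖ * lap φ x.1) (volume.prod μ) := by
  have hl : Integrable (lap φ) :=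
    (continuous_lap hφ).integrable_of_hasCompactSupport (hasCompactSupport_lap hc)
  refine ((integrable_logKernel_mul_lap hφ hc μ).add (hl.mul_prod hμ)).congr
    (Eventually.of_forall fun x => ?_)
  simp only [Pi.add_apply, logKernel]
  ring

/-- The Laplacian of the logarithmic potential of a measure is `2π` times the measure. -/
lemma integral_potential_mul_lap {φ : ℂ → ℝ} (hφ : ContDiff ℝ ((⊤ : ℕ∞) : WithTop ℕ∞) φ)
    (hc : HasCompactSupport φ) {μ : Measure ℂ} [IsProbabilityMeasure μ]
    (hμ : Integrable (fun w : ℂ => Real.log (1 + ‖w‖)) μ) :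
    ∫ z, (∫ w, Real.log ‖z - w‖ ∂μ) * lap φ z = 2 * Real.pi * ∫ w, φ w ∂μ := by
  simp only [← integral_mul_const]
  rw [integral_integral_swap (integrable_log_norm_sub_mul_lap hφ hc hμ)]
  simp only [integral_log_norm_sub_mul_lap hφ hc, integral_const_mul]

/-! ### Rotationally invariant measures -/

instance fact_two_pi_pos : Fact (0 < 2 * Real.pi) := ⟨Real.two_pi_pos⟩

/-- The point of the plane with given modulus and argument. -/
def polarPoint (q : ℝ) (θ : AddCircle (2 * Real.pi)) : ℂ := q * (AddCircle.toCircle θ : ℂ)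

lemma norm_polarPoint (q : ℝ) (θ : AddCircle (2 * Real.pi)) : ‖polarPoint q θ‖ = |q| := by
  rw [polarPoint, norm_mul, Circle.norm_coe, Complex.norm_real, mul_one, Real.norm_eq_abs]

lemma measurable_polarPoint :
    Measurable (fun x : ℝ × AddCircle (2 * Real.pi) => polarPoint x.1 x.2) := by
  unfold polarPoint
  refine (Complex.measurable_ofReal.comp measurable_fst).mul ?_
  exact ((continuous_subtype_val.comp AddCircle.continuous_toCircle).measurable).comp measurable_snd

lemma integral_polarPoint (f : ℂ → ℝ) (q : ℝ) :
    ∫ θ, f (polarPoint q θ) ∂(AddCircle.haarAddCircle (T := 2 * Real.pi)) =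
      Real.circleAverage f 0 q := by
  rw [AddCircle.integral_haarAddCircle, Real.circleAverage_def,
    ← AddCircle.intervalIntegral_preimage (2 * Real.pi) 0]
  simp only [zero_add]
  congr 1
  refine intervalIntegral.integral_congr fun θ _ => ?_
  simp only [polarPoint, circleMap, AddCircle.toCircle_apply_mk, zero_add, Circle.coe_exp]
  congr 3
  have := Real.pi_pos
  rw [div_self (by positivity), one_mul]

/-- The rotationally invariant law of a point whose modulus is `Q y` for `y` uniform
in `(0, 1)`. -/
def radialLaw (Q : ℝ → ℝ) : Measure ℂ :=
  ((volume.restrict (Ioo (0 : ℝ) 1)).prod (AddCircle.haarAddCircle (T := 2 * Real.pi))).map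
    (fun x => polarPoint (Q x.1) x.2)

instance isProbabilityMeasure_restrict_Ioo :
    IsProbabilityMeasure (volume.restrict (Ioo (0 : ℝ) 1)) :=
  ⟨by simp⟩

variable {Q : ℝ → ℝ}

lemma measurable_polarPoint_comp (hQ : Measurable Q) :
    Measurable (fun x : ℝ × AddCircle (2 * Real.pi) => polarPoint (Q x.1) x.2) :=
  measurable_polarPoint.comp ((hQ.comp measurable_fst).prodMk measurable_snd)

lemma isProbabilityMeasure_radialLaw (hQ : Measurable Q) :
    IsProbabilityMeasure (radialLaw Q) :=
  Measure.isProbabilityMeasure_map (measurable_polarPoint_comp hQ).aemeasurable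

lemma rotInvariant_radialLaw (hQ : Measurable Q) : RotInvariant (radialLaw Q) := by
  intro c hc
  obtain ⟨τ, hτ⟩ : ∃ τ : AddCircle (2 * Real.pi), (AddCircle.toCircle τ : ℂ) = c := by
    refine ⟨((Complex.arg c : ℝ) : AddCircle (2 * Real.pi)), ?_⟩
    have := Real.pi_pos
    rw [AddCircle.toCircle_apply_mk, div_self (by positivity), one_mul, Circle.coe_exp]
    have := Complex.norm_mul_exp_arg_mul_I c
    rwa [hc, Complex.ofReal_one, one_mul] at this
  have hmp : MeasurePreserving (fun x : ℝ × AddCircle (2 * Real.pi) => (x.1, τ + x.2))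
      ((volume.restrict (Ioo (0 : ℝ) 1)).prod AddCircle.haarAddCircle)
      ((volume.restrict (Ioo (0 : ℝ) 1)).prod AddCircle.haarAddCircle) :=
    (MeasurePreserving.id _).prod (measurePreserving_add_left _ τ)
  unfold radialLaw
  rw [Measure.map_map (by fun_prop) (measurable_polarPoint_comp hQ)]
  conv_rhs => rw [← hmp.map_eq]
  rw [Measure.map_map (measurable_polarPoint_comp hQ) hmp.measurable]
  congr 1
  ext x
  simp only [Function.comp, polarPoint, AddCircle.toCircle_add, Circle.coe_mul, hτ]
  ring

lemma radialLaw_ball (hQ : Measurable Q) (r : ℝ) :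
    radialLaw Q (Metric.ball 0 r) = volume (Ioo (0 : ℝ) 1 ∩ {y | |Q y| < r}) := by
  rw [radialLaw, Measure.map_apply (measurable_polarPoint_comp hQ) Metric.isOpen_ball.measurableSet]
  have : (fun x : ℝ × AddCircle (2 * Real.pi) => polarPoint (Q x.1) x.2) ⁻¹' Metric.ball 0 r =
      {y | |Q y| < r} ×ˢ univ := by
    ext x; simp [norm_polarPoint]
  have hs : MeasurableSet {y | |Q y| < r} := measurableSet_lt hQ.abs measurable_const
  rw [this, Measure.prod_prod, measure_univ, mul_one, Measure.restrict_apply hs, inter_comm]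

/-- Jensen's formula: the potential of the uniform law on a circle is constant inside and log |z|
outside. -/
lemma circleAverage_log_norm_sub {q : ℝ} (hq : 0 < q) {z : ℂ} (hz : z ≠ 0) :
    Real.circleAverage (fun w => Real.log ‖z - w‖) 0 q = max (Real.log ‖z‖) (Real.log q) := by
  have h := circleAverage_log_norm_sub_const_eq_log_radius_add_posLog (a := z) (c := 0) hq.ne'
  have h2 : (fun w => Real.log ‖z - w‖) = (fun w => Real.log ‖w - z‖) := by
    ext w; rw [norm_sub_rev]
  have hzp : 0 < ‖z‖ := norm_pos_iff.2 hz
  rw [h2, h, zero_sub, norm_neg, Real.posLog, Real.log_mul (by positivity) hzp.ne', Real.log_inv,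
    max_def, max_def]
  split_ifs <;> linarith

/-- The logarithmic potential of `radialLaw Q`, as a function of the logarithm of the modulus. -/
def radialPotential (Q : ℝ → ℝ) (s : ℝ) : ℝ :=
  ∫ y in Ioo (0 : ℝ) 1, max s (Real.log (Q y))

lemma integrable_log_one_add_radialLaw (hQ : Measurable Q) (hpos : ∀ y ∈ Ioo (0 : ℝ) 1, 0 < Q y)
    (hint : IntegrableOn (fun y => Real.log (Q y)) (Ioo 0 1)) :
    Integrable (fun w : ℂ => Real.log (1 + ‖w‖)) (radialLaw Q) := by
  rw [radialLaw, integrable_map_measure (Measurable.aestronglyMeasurable (by fun_prop)) (measurable_polarPoint_comp hQ).aemeasurable]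
  have h1 : Integrable (fun y => Real.log (1 + |Q y|)) (volume.restrict (Ioo (0 : ℝ) 1)) := by
    refine Integrable.mono' (g := fun y => Real.log 2 + |Real.log (Q y)|)
      ((integrable_const _).add hint.abs) (Measurable.aestronglyMeasurable (by fun_prop)) ?_
    refine (ae_restrict_iff' measurableSet_Ioo).2 (Eventually.of_forall fun y hy => ?_)
    have hq := hpos y hy
    rw [abs_of_pos hq, Real.norm_of_nonneg (Real.log_nonneg (by linarith))]
    have hl2 : 0 < Real.log 2 := Real.log_pos (by norm_num)
    rcases le_total (Q y) 1 with h | h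
    · have := Real.log_le_log (by linarith) (show 1 + Q y ≤ 2 by linarith)
      linarith [abs_nonneg (Real.log (Q y))]
    · have := Real.log_le_log (by linarith) (show 1 + Q y ≤ 2 * Q y by linarith)
      rw [Real.log_mul (by norm_num) hq.ne'] at this
      linarith [le_abs_self (Real.log (Q y))]
  have h2 := h1.comp_fst (ν := AddCircle.haarAddCircle (T := 2 * Real.pi))
  refine h2.congr (Eventually.of_forall fun x => ?_)
  simp [norm_polarPoint]

lemma integral_log_norm_sub_radialLaw (hQ : Measurable Q) (hpos : ∀ y ∈ Ioo (0 : ℝ) 1, 0 < Q y)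
    {z : ℂ} (hz : z ≠ 0)
    (hi : Integrable (fun w => Real.log ‖z - w‖) (radialLaw Q)) :
    ∫ w, Real.log ‖z - w‖ ∂(radialLaw Q) = radialPotential Q (Real.log ‖z‖) := by
  have hm := (measurable_polarPoint_comp hQ).aemeasurable
    (μ := (volume.restrict (Ioo (0 : ℝ) 1)).prod (AddCircle.haarAddCircle (T := 2 * Real.pi)))
  rw [radialLaw] at hi ⊢
  rw [integrable_map_measure hi.1 hm] at hi
  rw [integral_map hm (Measurable.aestronglyMeasurable (by fun_prop)),
    integral_prod (fun x => Real.log ‖z - polarPoint (Q x.1) x.2‖) hi, radialPotential]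
  refine setIntegral_congr_fun measurableSet_Ioo fun y hy => ?_
  simp only
  rw [integral_polarPoint (fun w => Real.log ‖z - w‖), circleAverage_log_norm_sub (hpos y hy) hz]

lemma integrable_max_log (hint : IntegrableOn (fun y => Real.log (Q y)) (Ioo 0 1)) (s : ℝ) :
    IntegrableOn (fun y => max s (Real.log (Q y))) (Ioo 0 1) :=
  (integrable_const s).sup hint

/-- Averaging over circles first identifies the potential of `radialLaw Q` with `radialPotential Q`,
so this function can serve as the limit V in the convergence criterion. -/
lemma integral_radialPotential_mul_lap (hQ : Measurable Q)
    (hpos : ∀ y ∈ Ioo (0 : ℝ) 1, 0 < Q y)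
    (hint : IntegrableOn (fun y => Real.log (Q y)) (Ioo 0 1)) {φ : ℂ → ℝ}
    (hφ : ContDiff ℝ ((⊤ : ℕ∞) : WithTop ℕ∞) φ) (hc : HasCompactSupport φ) :
    ∫ z, radialPotential Q (Real.log ‖z‖) * lap φ z = 2 * Real.pi * ∫ w, φ w ∂(radialLaw Q) := by
  have := isProbabilityMeasure_radialLaw hQ
  have hl := integrable_log_one_add_radialLaw hQ hpos hint
  rw [← integral_potential_mul_lap hφ hc hl]
  refine integral_congr_ae ?_
  have h0 : ∀ᵐ z : ℂ, z ≠ 0 := Measure.ae_ne volume 0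
  filter_upwards [(integrable_log_norm_sub_mul_lap hφ hc hl).prod_right_ae, h0] with z hz hz0
  -- Integrability of w ↦ log |z - w| is extracted from the product with the Laplacian, hence only
  -- where the latter is nonzero; elsewhere both integrands vanish.
  by_cases hzl : lap φ z = 0
  · simp [hzl]
  · rw [integral_log_norm_sub_radialLaw hQ hpos hz0]
    simpa [hzl] using hz.mul_const (lap φ z)⁻¹

/-! ### The limiting radial distributions -/

/-- The solution `y` in `(0, 1)` of `y ^ 2 = B * (a + (1 - a) * y) * (1 - y)`. -/
def radialCDF (a B : ℝ) : ℝ :=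
  (B * (1 - 2 * a) + √(B ^ 2 + 4 * a * B)) / (2 * (1 + (1 - a) * B))

/-- Complete the square in the quadratic. Since B(1 - 2a) is at most the square root of the
discriminant, the smaller root is not positive, so for y > 0 only the larger one matters. -/
lemma lt_radialCDF_iff {a B y : ℝ} (ha0 : 0 ≤ a) (ha1 : a ≤ 1) (hB : 0 < B) (hy : 0 < y) :
    y < radialCDF a B ↔ y ^ 2 < B * (a + (1 - a) * y) * (1 - y) := by
  have hA : 0 < 1 + (1 - a) * B := by nlinarith
  have hs0 := Real.sqrt_nonneg (B ^ 2 + 4 * a * B)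
  have hs : √(B ^ 2 + 4 * a * B) ^ 2 = B ^ 2 + 4 * a * B := Real.sq_sqrt (by positivity)
  have hle : B * (1 - 2 * a) ≤ √(B ^ 2 + 4 * a * B) := by
    refine Real.le_sqrt_of_sq_le ?_
    have h1 : 0 ≤ a * (1 - a) := mul_nonneg ha0 (by linarith)
    nlinarith [mul_nonneg h1 (sq_nonneg B), mul_nonneg ha0 hB.le]
  set σ := √(B ^ 2 + 4 * a * B) with hσ
  have hid : 4 * (1 + (1 - a) * B) * (y ^ 2 - B * (a + (1 - a) * y) * (1 - y)) =
      (2 * (1 + (1 - a) * B) * y - B * (1 - 2 * a)) ^ 2 - σ ^ 2 := by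
    rw [hs]; ring
  have hAy : 0 < 2 * (1 + (1 - a) * B) * y := by positivity
  rw [radialCDF, lt_div_iff₀ (by positivity)]
  constructor
  · intro h
    have h2 : (2 * (1 + (1 - a) * B) * y - B * (1 - 2 * a)) ^ 2 < σ ^ 2 := by
      refine sq_lt_sq' ?_ ?_ <;> nlinarith
    nlinarith
  · intro h
    have h2 : (2 * (1 + (1 - a) * B) * y - B * (1 - 2 * a)) ^ 2 < σ ^ 2 := by nlinarith
    have := abs_lt_of_sq_lt_sq h2 hs0
    linarith [(abs_lt.1 this).2]

lemma radialCDF_lt_iff {a B y : ℝ} (ha0 : 0 ≤ a) (ha1 : a ≤ 1) (hB : 0 < B) (hy : 0 < y) :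
    radialCDF a B < y ↔ B * (a + (1 - a) * y) * (1 - y) < y ^ 2 := by
  have hA : 0 < 1 + (1 - a) * B := by nlinarith
  have hs0 := Real.sqrt_nonneg (B ^ 2 + 4 * a * B)
  have hs : √(B ^ 2 + 4 * a * B) ^ 2 = B ^ 2 + 4 * a * B := Real.sq_sqrt (by positivity)
  have hle : B * (1 - 2 * a) ≤ √(B ^ 2 + 4 * a * B) := by
    refine Real.le_sqrt_of_sq_le ?_
    have h1 : 0 ≤ a * (1 - a) := mul_nonneg ha0 (by linarith)
    nlinarith [mul_nonneg h1 (sq_nonneg B), mul_nonneg ha0 hB.le]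
  set σ := √(B ^ 2 + 4 * a * B) with hσ
  have hid : 4 * (1 + (1 - a) * B) * (y ^ 2 - B * (a + (1 - a) * y) * (1 - y)) =
      (2 * (1 + (1 - a) * B) * y - B * (1 - 2 * a)) ^ 2 - σ ^ 2 := by
    rw [hs]; ring
  have hAy : 0 < 2 * (1 + (1 - a) * B) * y := by positivity
  rw [radialCDF, div_lt_iff₀ (by positivity)]
  constructor
  · intro h
    have h2 : σ ^ 2 < (2 * (1 + (1 - a) * B) * y - B * (1 - 2 * a)) ^ 2 := by
      refine pow_lt_pow_left₀ ?_ hs0 (by norm_num)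
      linarith
    nlinarith
  · intro h
    have h2 : σ ^ 2 < (2 * (1 + (1 - a) * B) * y - B * (1 - 2 * a)) ^ 2 := by nlinarith
    have := lt_abs.1 ((le_abs_self σ).trans_lt (sq_lt_sq.1 h2))
    rcases this with h | h <;> linarith

lemma radialCDF_pos {a B : ℝ} (ha0 : 0 ≤ a) (ha1 : a ≤ 1) (hB : 0 < B) : 0 < radialCDF a B := by
  -- A test point below the root: δ ≤ 1/2 gives 1 - δ ≥ 1/2, and δ < B/2 gives δ² < Bδ/2. The bound
  -- δ ≤ a + (1 - a)δ covers a = 0 too.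
  set δ : ℝ := min (1 / 2) (B / (4 * (1 + B))) with hδ
  have hδ0 : 0 < δ := by positivity
  refine hδ0.trans ((lt_radialCDF_iff ha0 ha1 hB hδ0).2 ?_)
  have h1 : δ ≤ 1 / 2 := min_le_left _ _
  have h2 : δ * (4 * (1 + B)) ≤ B := by
    rw [← le_div_iff₀ (by positivity)]; exact min_le_right _ _
  have h3 : δ ≤ a + (1 - a) * δ := by nlinarith
  calc δ ^ 2 = δ * δ := sq δ
    _ < B / 2 * δ := by
      refine mul_lt_mul_of_pos_right ?_ hδ0
      nlinarith
    _ = B * δ * (1 / 2) := by ring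
    _ ≤ B * (a + (1 - a) * δ) * (1 - δ) := by
      refine mul_le_mul ?_ (by linarith) (by norm_num) (by nlinarith)
      exact mul_le_mul_of_nonneg_left h3 hB.le

lemma radialCDF_lt_one {a B : ℝ} (ha0 : 0 ≤ a) (ha1 : a ≤ 1) (hB : 0 < B) : radialCDF a B < 1 :=
  (radialCDF_lt_iff ha0 ha1 hB one_pos).2 (by norm_num)

lemma radialCDF_sq {a B : ℝ} (ha0 : 0 ≤ a) (ha1 : a ≤ 1) (hB : 0 < B) :
    radialCDF a B ^ 2 = B * (a + (1 - a) * radialCDF a B) * (1 - radialCDF a B) := by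
  have hp := radialCDF_pos ha0 ha1 hB
  refine le_antisymm ?_ ?_
  · by_contra! h
    exact lt_irrefl _ ((radialCDF_lt_iff ha0 ha1 hB hp).2 h)
  · by_contra! h
    exact lt_irrefl _ ((lt_radialCDF_iff ha0 ha1 hB hp).2 h)

lemma radialCDF_strictMono {a B B' : ℝ} (ha0 : 0 ≤ a) (ha1 : a ≤ 1) (hB : 0 < B) (hBB : B < B') :
    radialCDF a B < radialCDF a B' := by
  have hp := radialCDF_pos ha0 ha1 hB
  have hl := radialCDF_lt_one ha0 ha1 hB
  rw [lt_radialCDF_iff ha0 ha1 (hB.trans hBB) hp, radialCDF_sq ha0 ha1 hB]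
  have h1 : 0 < a + (1 - a) * radialCDF a B := by nlinarith
  have h2 : 0 < 1 - radialCDF a B := by linarith
  gcongr

lemma continuousAt_radialCDF {a B : ℝ} (ha1 : a ≤ 1) (hB : 0 < B) :
    ContinuousAt (radialCDF a) B := by
  unfold radialCDF
  refine ContinuousAt.div (by fun_prop) (by fun_prop) ?_
  have : 0 ≤ (1 - a) * B := mul_nonneg (by linarith) hB.le
  positivity

/-- The quantile function of the distribution function `ρ ↦ radialCDF a (β * ρ ^ 2)`. -/
def radialQuantile (a β y : ℝ) : ℝ := y / √(β * (a + (1 - a) * y) * (1 - y))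

lemma measurable_radialQuantile (a β : ℝ) : Measurable (radialQuantile a β) := by
  unfold radialQuantile; fun_prop

lemma radialQuantile_arg_pos {a β : ℝ} (ha0 : 0 ≤ a) (hβ : 0 < β)
    {y : ℝ} (hy : y ∈ Ioo (0 : ℝ) 1) :
    0 < β * (a + (1 - a) * y) * (1 - y) := by
  have h1 : 0 < a + (1 - a) * y := by nlinarith [hy.1, hy.2]
  have h2 : 0 < 1 - y := by linarith [hy.2]
  positivity

lemma radialQuantile_pos {a β : ℝ} (ha0 : 0 ≤ a) (hβ : 0 < β)
    {y : ℝ} (hy : y ∈ Ioo (0 : ℝ) 1) : 0 < radialQuantile a β y :=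
  div_pos hy.1 (Real.sqrt_pos.2 (radialQuantile_arg_pos ha0 hβ hy))

lemma radialQuantile_lt_iff {a β : ℝ} (ha0 : 0 ≤ a) (ha1 : a ≤ 1) (hβ : 0 < β)
    {y ρ : ℝ} (hy : y ∈ Ioo (0 : ℝ) 1) (hρ : 0 < ρ) :
    radialQuantile a β y < ρ ↔ y < radialCDF a (β * ρ ^ 2) := by
  have hpos := radialQuantile_arg_pos ha0 hβ hy
  have hs := Real.sqrt_pos.2 hpos
  rw [lt_radialCDF_iff ha0 ha1 (by positivity) hy.1, radialQuantile, div_lt_iff₀ hs,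
    ← sq_lt_sq₀ hy.1.le (by positivity), mul_pow, Real.sq_sqrt hpos.le]
  ring_nf

/-- Since y ≤ a + (1 - a)y ≤ 1, the logarithm of the middle factor is dominated by |log y|; what
remains are integrable logarithms at the two endpoints. -/
lemma integrableOn_log_radialQuantile {a β : ℝ} (ha0 : 0 ≤ a) (ha1 : a ≤ 1) (hβ : 0 < β) :
    IntegrableOn (fun y => Real.log (radialQuantile a β y)) (Ioo 0 1) := by
  have hl : IntegrableOn (fun y : ℝ => |Real.log y|) (Ioo 0 1) :=
    ((intervalIntegrable_iff_integrableOn_Ioo_of_le zero_le_one).1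
      intervalIntegral.intervalIntegrable_log').abs
  have hl1 : IntegrableOn (fun y : ℝ => |Real.log (1 - y)|) (Ioo 0 1) := by
    have h := (intervalIntegral.intervalIntegrable_log' (a := 1) (b := 0)).comp_sub_left 1
    norm_num at h
    exact ((intervalIntegrable_iff_integrableOn_Ioo_of_le zero_le_one).1 h).abs
  have hconst : IntegrableOn (fun _ : ℝ => |Real.log β|) (Ioo 0 1) := integrable_const _
  refine Integrable.mono' (((hl.add hl).add hconst).add hl1)
    (Real.measurable_log.comp (measurable_radialQuantile a β)).aestronglyMeasurable ?_
  refine (ae_restrict_iff' measurableSet_Ioo).2 (Eventually.of_forall fun y hy => ?_)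
  have hpos := radialQuantile_arg_pos ha0 hβ hy
  have h1 : 0 < a + (1 - a) * y := by nlinarith [hy.1, hy.2]
  have h2 : 0 < 1 - y := by linarith [hy.2]
  have h3 : y ≤ a + (1 - a) * y := by nlinarith [hy.1, hy.2]
  have h4 : a + (1 - a) * y ≤ 1 := by nlinarith [hy.1, hy.2]
  have h5 := Real.log_le_log hy.1 h3
  have h6 := Real.log_nonpos h1.le h4
  rw [radialQuantile, Real.log_div hy.1.ne' (Real.sqrt_pos.2 hpos).ne', Real.log_sqrt hpos.le,
    Real.log_mul (by positivity) h2.ne', Real.log_mul hβ.ne' h1.ne', Real.norm_eq_abs]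
  simp only [Pi.add_apply]
  have e1 := neg_abs_le (Real.log y)
  have e2 := le_abs_self (Real.log y)
  have e3 := neg_abs_le (Real.log β)
  have e4 := le_abs_self (Real.log β)
  have e5 := neg_abs_le (Real.log (1 - y))
  have e6 := le_abs_self (Real.log (1 - y))
  have e7 := abs_nonneg (Real.log y)
  have e8 := abs_nonneg (Real.log β)
  have e9 := abs_nonneg (Real.log (1 - y))
  rw [abs_le]; constructor <;> linarith

lemma Ioo_inter_radialQuantile_lt {a β : ℝ} (ha0 : 0 ≤ a) (ha1 : a ≤ 1) (hβ : 0 < β)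
    {ρ : ℝ} (hρ : 0 < ρ) :
    Ioo (0 : ℝ) 1 ∩ {y | |radialQuantile a β y| < ρ} = Ioo 0 (radialCDF a (β * ρ ^ 2)) := by
  have hlt := radialCDF_lt_one ha0 ha1 (show 0 < β * ρ ^ 2 by positivity)
  ext y
  constructor
  · rintro ⟨hy, hy2⟩
    rw [mem_ofPred_eq, abs_of_pos (radialQuantile_pos ha0 hβ hy),
      radialQuantile_lt_iff ha0 ha1 hβ hy hρ] at hy2
    exact ⟨hy.1, hy2⟩
  · intro hy
    have hy' : y ∈ Ioo (0 : ℝ) 1 := ⟨hy.1, hy.2.trans hlt⟩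
    refine ⟨hy', ?_⟩
    rw [mem_ofPred_eq, abs_of_pos (radialQuantile_pos ha0 hβ hy'),
      radialQuantile_lt_iff ha0 ha1 hβ hy' hρ]
    exact hy.2

lemma radialLaw_real_ball {a β : ℝ} (ha0 : 0 ≤ a) (ha1 : a ≤ 1) (hβ : 0 < β)
    {ρ : ℝ} (hρ : 0 < ρ) :
    (radialLaw (radialQuantile a β)).real (Metric.ball 0 ρ) = radialCDF a (β * ρ ^ 2) := by
  have h := radialCDF_pos ha0 ha1 (show 0 < β * ρ ^ 2 by positivity)
  rw [Measure.real, radialLaw_ball (measurable_radialQuantile a β),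
    Ioo_inter_radialQuantile_lt ha0 ha1 hβ hρ, Real.volume_Ioo, sub_zero,
    ENNReal.toReal_ofReal h.le]

/-- The radial potential is convex, with the distribution function as its derivative. -/
lemma radialPotential_subgradient {a β : ℝ} (ha0 : 0 ≤ a) (ha1 : a ≤ 1) (hβ : 0 < β)
    (s s' : ℝ) :
    radialPotential (radialQuantile a β) s +
      (s' - s) * radialCDF a (β * Real.exp s ^ 2) ≤ radialPotential (radialQuantile a β) s' := by
  have hint := integrableOn_log_radialQuantile ha0 ha1 hβ
  have hE := Ioo_inter_radialQuantile_lt ha0 ha1 hβ (Real.exp_pos s)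
  set E := {y | |radialQuantile a β y| < Real.exp s} with hEdef
  have hEm : MeasurableSet E := measurableSet_lt (measurable_radialQuantile a β).abs
    measurable_const
  have hp := radialCDF_pos ha0 ha1 (show 0 < β * Real.exp s ^ 2 by positivity)
  -- Pointwise, s ↦ max(s, log Q(y)) has subgradient 1 where log Q(y) < s and 0 elsewhere;
  -- integrating this slope over y gives the distribution function.
  have hind : ∫ y in Ioo (0 : ℝ) 1, E.indicator (fun _ => s' - s) y =
      (s' - s) * radialCDF a (β * Real.exp s ^ 2) := by
    rw [setIntegral_indicator hEm, hE, setIntegral_const, smul_eq_mul, Measure.real,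
      Real.volume_Ioo, sub_zero, ENNReal.toReal_ofReal hp.le, mul_comm]
  rw [← hind, radialPotential, radialPotential, ← integral_add (integrable_max_log hint s)
    ((integrable_const _).indicator hEm)]
  refine setIntegral_mono_on ((integrable_max_log hint s).add
    ((integrable_const _).indicator hEm)) (integrable_max_log hint s') measurableSet_Ioo
    fun y hy => ?_
  have hq := radialQuantile_pos ha0 hβ hy
  by_cases hyE : y ∈ E
  · rw [indicator_of_mem hyE]
    rw [hEdef, mem_ofPred_eq, abs_of_pos hq, ← Real.log_lt_iff_lt_exp hq] at hyE
    rw [max_eq_left hyE.le]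
    linarith [le_max_left s' (Real.log (radialQuantile a β y))]
  · rw [indicator_of_notMem hyE, add_zero]
    rw [hEdef, mem_ofPred_eq, abs_of_pos hq, ← Real.log_lt_iff_lt_exp hq, not_lt] at hyE
    rw [max_eq_right hyE]
    exact le_max_right _ _

lemma measurable_radialPotential (hint : IntegrableOn (fun y => Real.log (Q y)) (Ioo 0 1)) :
    Measurable (radialPotential Q) := by
  refine Monotone.measurable fun s s' hs => ?_
  exact integral_mono (integrable_max_log hint s) (integrable_max_log hint s') fun y =>
    max_le_max_right _ hs

/-! ### Legendre-Fenchel transforms -/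

/-- A function with a continuous subgradient is differentiable. -/
lemma hasDerivAt_of_subgradient {f g : ℝ → ℝ} (h : ∀ s s', f s + (s' - s) * g s ≤ f s') {s : ℝ}
    (hg : ContinuousAt g s) : HasDerivAt f (g s) s := by
  rw [hasDerivAt_iff_isLittleO]
  -- The subgradient inequalities at s and at s' place the linearisation error between 0 and (s' -
  -- s)(g s' - g s).
  have h1 : (fun s' => (s' - s) * (g s' - g s)) =o[𝓝 s] fun s' => s' - s := by
    have h2 : Tendsto (fun s' => g s' - g s) (𝓝 s) (𝓝 0) := by
      simpa using hg.tendsto.sub_const (g s)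
    have := (Asymptotics.isBigO_refl (fun s' => s' - s) (𝓝 s)).mul_isLittleO
      ((Asymptotics.isLittleO_one_iff ℝ).2 h2)
    simpa using this
  refine Asymptotics.IsBigO.trans_isLittleO
    (Asymptotics.IsBigO.of_bound 1 (Eventually.of_forall fun s' => ?_)) h1
  have e1 := h s s'
  have e2 := h s' s
  rw [one_mul, smul_eq_mul, Real.norm_of_nonneg (by linarith), Real.norm_eq_abs]
  refine le_trans ?_ (le_abs_self _)
  nlinarith

/-- The finite part of `logUE`. -/
def logU (a t : ℝ) : ℝ :=
  1 / 2 * ((t + a) * Real.log (t + a)) - 1 / 2 * ((1 - a - t) * Real.log (1 - a - t)) -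
    t * Real.log t + (1 - a) * Real.log (1 - a)

lemma logUE_of_mem {a t : ℝ} (ha0 : 0 ≤ a) (ht : t ∈ Icc 0 (1 - a)) :
    logUE a t = (logU a t : EReal) := by
  have h : t + a ∈ Icc (0 : ℝ) 1 := ⟨by linarith [ht.1], by linarith [ht.2]⟩
  rw [logUE, if_pos ht, logPE, if_pos h, ← EReal.coe_add]
  congr 1
  rw [logU, show 1 - (t + a) = 1 - a - t by ring]
  ring

lemma logUE_of_notMem {a t : ℝ} (ht : t ∉ Icc 0 (1 - a)) : logUE a t = ⊥ := by
  rw [logUE, if_neg ht]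

/-- This lets a = 0 and 0 < a < 1 share one Legendre-Fenchel computation. -/
lemma logUE_zero : logUE 0 = logPE := by
  ext t
  by_cases ht : t ∈ Icc (0 : ℝ) 1
  · rw [logUE_of_mem le_rfl (by simpa using ht), logPE, if_pos ht]
    congr 1
    simp only [logU, sub_zero, add_zero, Real.log_one]
    ring
  · rw [logUE_of_notMem (by simpa using ht), logPE, if_neg ht]

/-- The point at which the supremum in the Legendre-Fenchel transform of `-logUE a` at `s` is
attained. -/
def legendrePoint (a s : ℝ) : ℝ := (1 - a) * radialCDF a ((1 - a)⁻¹ * Real.exp s ^ 2)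

lemma legendrePoint_mem {a : ℝ} (ha0 : 0 ≤ a) (ha1 : a < 1) (s : ℝ) :
    legendrePoint a s ∈ Ioo 0 (1 - a) := by
  have hb : 0 < 1 - a := by linarith
  have hB : 0 < (1 - a)⁻¹ * Real.exp s ^ 2 := by positivity
  have h1 := radialCDF_pos ha0 ha1.le hB
  have h2 := radialCDF_lt_one ha0 ha1.le hB
  exact ⟨mul_pos hb h1, by rw [legendrePoint]; nlinarith⟩

/-- The substitution y = t / (1 - a) turns the quadratic of `radialCDF` into the critical point
equation t² = e^{2s}(t + a)(1 - a - t). -/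
lemma lt_legendrePoint_iff {a t : ℝ} (ha0 : 0 ≤ a) (ha1 : a < 1) (s : ℝ) (ht : 0 < t) :
    t < legendrePoint a s ↔ t ^ 2 < Real.exp s ^ 2 * ((t + a) * (1 - a - t)) := by
  have hb : 0 < 1 - a := by linarith
  have hB : 0 < (1 - a)⁻¹ * Real.exp s ^ 2 := by positivity
  have h := lt_radialCDF_iff ha0 ha1.le hB (show 0 < t / (1 - a) by positivity)
  rw [div_lt_iff₀ hb, mul_comm] at h
  rw [legendrePoint, h, div_pow, div_lt_iff₀ (by positivity)]
  have : (1 - a)⁻¹ * Real.exp s ^ 2 * (a + (1 - a) * (t / (1 - a))) * (1 - t / (1 - a)) *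
      (1 - a) ^ 2 = Real.exp s ^ 2 * ((t + a) * (1 - a - t)) := by
    field_simp; ring
  rw [this]

lemma hasDerivAt_mul_add_logU {a t : ℝ} (ha0 : 0 ≤ a) (s : ℝ) (ht : t ∈ Ioo 0 (1 - a)) :
    HasDerivAt (fun t => s * t + logU a t)
      (s + 1 / 2 * Real.log ((t + a) * (1 - a - t)) - Real.log t) t := by
  have h1 : t + a ≠ 0 := by linarith [ht.1]
  have h2 : 1 - a - t ≠ 0 := by linarith [ht.2]
  have e1 : HasDerivAt (fun t => (t + a) * Real.log (t + a)) (Real.log (t + a) + 1) t := by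
    have := (Real.hasDerivAt_mul_log h1).comp t ((hasDerivAt_id t).add_const a)
    rwa [mul_one] at this
  have e2 : HasDerivAt (fun t => (1 - a - t) * Real.log (1 - a - t))
      ((Real.log (1 - a - t) + 1) * -1) t :=
    (Real.hasDerivAt_mul_log h2).comp t ((hasDerivAt_id t).const_sub (1 - a))
  have e3 := Real.hasDerivAt_mul_log ht.1.ne'
  have e4 := ((((e1.const_mul (1 / 2)).sub (e2.const_mul (1 / 2))).sub e3).add_const
    ((1 - a) * Real.log (1 - a)))
  have e5 := ((hasDerivAt_id t).const_mul s).add e4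
  refine e5.congr_deriv ?_
  rw [Real.log_mul h1 h2]
  ring

/-- The derivative has the sign of e^{2s}(t + a)(1 - a - t) - t², nonnegative before the critical
point and nonpositive after it. Continuity of x log x at 0 carries this to the endpoints. -/
lemma mul_add_logU_le {a t : ℝ} (ha0 : 0 ≤ a) (ha1 : a < 1) (s : ℝ) (ht : t ∈ Icc 0 (1 - a)) :
    s * t + logU a t ≤ s * legendrePoint a s + logU a (legendrePoint a s) := by
  have hcont : Continuous (fun t => s * t + logU a t) := by
    unfold logU
    have h1 : Continuous fun t : ℝ => (t + a) * Real.log (t + a) :=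
      Real.continuous_mul_log.comp (continuous_id.add_const a)
    have h2 : Continuous fun t : ℝ => (1 - a - t) * Real.log (1 - a - t) :=
      Real.continuous_mul_log.comp (continuous_const.sub continuous_id)
    have h3 := Real.continuous_mul_log
    exact (continuous_const.mul continuous_id).add
      ((((continuous_const.mul h1).sub (continuous_const.mul h2)).sub h3).add continuous_const)
  have hm := legendrePoint_mem ha0 ha1 s
  have hder : ∀ t ∈ Ioo 0 (1 - a), deriv (fun t => s * t + logU a t) t =
      s + 1 / 2 * Real.log ((t + a) * (1 - a - t)) - Real.log t := fun t ht =>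
    (hasDerivAt_mul_add_logU ha0 s ht).deriv
  have hsign : ∀ t ∈ Ioo 0 (1 - a), s + 1 / 2 * Real.log ((t + a) * (1 - a - t)) - Real.log t =
      1 / 2 * (Real.log (Real.exp s ^ 2 * ((t + a) * (1 - a - t))) - Real.log (t ^ 2)) := by
    intro t ht
    have h1 : 0 < (t + a) * (1 - a - t) :=
      mul_pos (by linarith [ht.1]) (by linarith [ht.2])
    rw [Real.log_mul (by positivity) h1.ne', Real.log_pow, Real.log_pow, Real.log_exp]
    push_cast; ring
  rcases le_total t (legendrePoint a s) with h | h
  · refine monotoneOn_of_deriv_nonneg (convex_Icc 0 (legendrePoint a s)) hcont.continuousOn ?_ ?_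
      ⟨ht.1, h⟩ ⟨hm.1.le, le_rfl⟩ h
    · intro x hx
      rw [interior_Icc] at hx
      exact (hasDerivAt_mul_add_logU ha0 s
        ⟨hx.1, hx.2.trans hm.2⟩).differentiableAt.differentiableWithinAt
    · intro x hx
      rw [interior_Icc] at hx
      have hx' : x ∈ Ioo 0 (1 - a) := ⟨hx.1, hx.2.trans hm.2⟩
      rw [hder x hx', hsign x hx']
      have := Real.log_le_log (pow_pos hx.1 2) ((lt_legendrePoint_iff ha0 ha1 s hx.1).1 hx.2).le
      linarith
  · refine antitoneOn_of_deriv_nonpos (convex_Icc (legendrePoint a s) (1 - a))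
      hcont.continuousOn ?_ ?_ ⟨le_rfl, hm.2.le⟩ ⟨h, ht.2⟩ h
    · intro x hx
      rw [interior_Icc] at hx
      exact (hasDerivAt_mul_add_logU ha0 s
        ⟨hm.1.trans hx.1, hx.2⟩).differentiableAt.differentiableWithinAt
    · intro x hx
      rw [interior_Icc] at hx
      have hx' : x ∈ Ioo 0 (1 - a) := ⟨hm.1.trans hx.1, hx.2⟩
      rw [hder x hx', hsign x hx']
      have h1 : 0 < (x + a) * (1 - a - x) :=
        mul_pos (by linarith [hx'.1]) (by linarith [hx'.2])
      have h2 : Real.exp s ^ 2 * ((x + a) * (1 - a - x)) ≤ x ^ 2 := by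
        by_contra! hcon
        exact absurd ((lt_legendrePoint_iff ha0 ha1 s hx'.1).2 hcon) (not_lt.2 hx.1.le)
      have := Real.log_le_log (by positivity) h2
      linarith

lemma legendreFenchel_neg_logUE {a : ℝ} (ha0 : 0 ≤ a) (ha1 : a < 1) (s : ℝ) :
    legendreFenchel (fun t => -logUE a t) s =
      ((s * legendrePoint a s + logU a (legendrePoint a s) : ℝ) : EReal) := by
  have hm := legendrePoint_mem ha0 ha1 s
  unfold legendreFenchel
  refine le_antisymm (iSup₂_le fun t ht => ?_) ?_
  · by_cases h : t ∈ Icc 0 (1 - a)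
    · simp only
      rw [logUE_of_mem ha0 h, ← EReal.coe_neg, ← EReal.coe_sub, EReal.coe_le_coe_iff,
        sub_neg_eq_add]
      exact mul_add_logU_le ha0 ha1 s h
    · simp only
      rw [logUE_of_notMem h, EReal.neg_bot, EReal.sub_top]
      exact bot_le
  · refine le_trans (le_of_eq ?_) (le_iSup₂ (legendrePoint a s) hm.1.le)
    simp only
    rw [logUE_of_mem ha0 ⟨hm.1.le, hm.2.le⟩, ← EReal.coe_neg, ← EReal.coe_sub, sub_neg_eq_add]

/-- The left derivative of the Legendre-Fenchel transform of `-logUE a`. -/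
lemma hasLeftDerivAt_legendreFenchel_neg_logUE {a : ℝ} (ha0 : 0 ≤ a) (ha1 : a < 1) (s : ℝ) :
    HasLeftDerivAt (legendreFenchel (fun t => -logUE a t)) (legendrePoint a s) s := by
  constructor
  · refine Eventually.of_forall fun x => ?_
    rw [legendreFenchel_neg_logUE ha0 ha1]
    exact ⟨EReal.coe_ne_top _, EReal.coe_ne_bot _⟩
  · simp only [legendreFenchel_neg_logUE ha0 ha1, EReal.toReal_coe]
    -- Envelope argument: using the maximiser for s as a competitor at s' makes it a subgradient,
    -- and its continuity in s gives a two-sided derivative.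
    refine (hasDerivAt_of_subgradient
      (f := fun x => x * legendrePoint a x + logU a (legendrePoint a x))
      (g := legendrePoint a) (fun s s' => ?_) ?_).hasDerivWithinAt
    · have hm := legendrePoint_mem ha0 ha1 s
      have := mul_add_logU_le ha0 ha1 s' ⟨hm.1.le, hm.2.le⟩
      linarith
    · have hb : 0 < 1 - a := by linarith
      unfold legendrePoint
      refine continuousAt_const.mul (ContinuousAt.comp (g := radialCDF a)
        (f := fun s => (1 - a)⁻¹ * Real.exp s ^ 2) (continuousAt_radialCDF ha1.le ?_) ?_)
      · positivity
      · fun_prop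

/-! ### Log-concave weights -/

/-- Positivity and log-concavity of the weights `w 0, …, w D`. -/
structure IsLogConcave (w : ℕ → ℝ) (D : ℕ) : Prop where
  pos : ∀ k ≤ D, 0 < w k
  ratio_antitone : ∀ i k, i ≤ k → k < D → w (k + 1) / w k ≤ w (i + 1) / w i

lemma exists_peak (w : ℕ → ℝ) (D : ℕ) (s : ℝ) :
    ∃ k, D ≤ k ∨ w (k + 1) / w k * Real.exp s < 1 := ⟨D, Or.inl le_rfl⟩

open Classical in
/-- The index at which `w k * exp (k * s)`, `k ≤ D`, is maximal. -/
def peak (w : ℕ → ℝ) (D : ℕ) (s : ℝ) : ℕ := Nat.find (exists_peak w D s)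

/-- The logarithm of the maximum of `w k * exp (k * s)`, `k ≤ D`. -/
def logMax (w : ℕ → ℝ) (D : ℕ) (s : ℝ) : ℝ := Real.log (w (peak w D s)) + peak w D s * s

lemma peak_le (w : ℕ → ℝ) (D : ℕ) (s : ℝ) : peak w D s ≤ D := by
  classical
  exact Nat.find_min' _ (Or.inl le_rfl)

lemma peak_le_of_ratio_lt {w : ℕ → ℝ} {D m : ℕ} {s : ℝ}
    (h : w (m + 1) / w m * Real.exp s < 1) : peak w D s ≤ m := by
  classical
  exact Nat.find_min' _ (Or.inr h)

lemma one_le_ratio_of_lt_peak {w : ℕ → ℝ} {D k : ℕ} {s : ℝ} (h : k < peak w D s) :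
    1 ≤ w (k + 1) / w k * Real.exp s := by
  classical
  have := Nat.find_min (exists_peak w D s) h
  push Not at this
  exact this.2

/-- The peak is the first index with ratio below 1, or D; log-concavity keeps the later ratios below
1. -/
lemma IsLogConcave.ratio_lt_one {w : ℕ → ℝ} {D k : ℕ} (hw : IsLogConcave w D) {s : ℝ}
    (h : peak w D s ≤ k) (hk : k < D) : w (k + 1) / w k * Real.exp s < 1 := by
  classical
  rcases Nat.find_spec (exists_peak w D s) with h1 | h1
  · have : D ≤ peak w D s := h1
    omega
  · refine lt_of_le_of_lt ?_ h1
    exact mul_le_mul_of_nonneg_right (hw.ratio_antitone _ _ h hk) (Real.exp_pos s).le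

/-- The logarithm of the `k`-th term. -/
def logTerm (w : ℕ → ℝ) (s : ℝ) (k : ℕ) : ℝ := Real.log (w k) + k * s

lemma logMax_eq (w : ℕ → ℝ) (D : ℕ) (s : ℝ) : logMax w D s = logTerm w s (peak w D s) := rfl

lemma IsLogConcave.logTerm_succ_sub {w : ℕ → ℝ} {D k : ℕ} (hw : IsLogConcave w D) (s : ℝ)
    (hk : k < D) :
    logTerm w s (k + 1) - logTerm w s k = Real.log (w (k + 1) / w k * Real.exp s) := by
  have h1 := hw.pos k hk.le
  have h2 := hw.pos (k + 1) hk
  rw [Real.log_mul (by positivity) (Real.exp_pos s).ne', Real.log_div h2.ne' h1.ne', Real.log_exp,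
    logTerm, logTerm]
  push_cast; ring

lemma IsLogConcave.logTerm_le_of_le_peak {w : ℕ → ℝ} {D i k : ℕ} (hw : IsLogConcave w D) {s : ℝ}
    (hik : i ≤ k) (hk : k ≤ peak w D s) : logTerm w s i ≤ logTerm w s k := by
  induction k, hik using Nat.le_induction with
  | base => exact le_rfl
  | succ k hik ih =>
    refine (ih (by omega)).trans ?_
    have h1 := one_le_ratio_of_lt_peak (Nat.lt_of_succ_le hk)
    have h2 := hw.logTerm_succ_sub s (show k < D by have := peak_le w D s; omega)
    have := Real.log_nonneg h1
    linarith

lemma IsLogConcave.logTerm_le_of_peak_le {w : ℕ → ℝ} {D i k : ℕ} (hw : IsLogConcave w D) {s : ℝ}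
    (hk : peak w D s ≤ k) (hki : k ≤ i) (hi : i ≤ D) : logTerm w s i ≤ logTerm w s k := by
  induction i, hki using Nat.le_induction with
  | base => exact le_rfl
  | succ i hki ih =>
    refine le_trans ?_ (ih (by omega))
    have h1 := hw.ratio_lt_one (hk.trans hki) (by omega)
    have h2 := hw.logTerm_succ_sub s (show i < D by omega)
    have hp1 := hw.pos i (by omega)
    have hp2 := hw.pos (i + 1) hi
    have := Real.log_nonpos (by positivity) h1.le
    linarith

lemma IsLogConcave.logTerm_le_logMax {w : ℕ → ℝ} {D k : ℕ} (hw : IsLogConcave w D) (s : ℝ)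
    (hk : k ≤ D) : logTerm w s k ≤ logMax w D s := by
  rw [logMax_eq]
  rcases le_total k (peak w D s) with h | h
  · exact hw.logTerm_le_of_le_peak h le_rfl
  · exact hw.logTerm_le_of_peak_le le_rfl h hk

/-- A maximum of affine functions of s has the slope of any maximising one as a subgradient. -/
lemma IsLogConcave.logMax_subgradient {w : ℕ → ℝ} {D : ℕ} (hw : IsLogConcave w D) (s s' : ℝ) :
    logMax w D s + (s' - s) * peak w D s ≤ logMax w D s' := by
  have h := hw.logTerm_le_logMax s' (peak_le w D s)
  rw [logMax_eq w D s]
  unfold logTerm at *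
  linarith

/-- Between the peaks at `s - η` and at `s` all terms are large. -/
lemma IsLogConcave.logMax_sub_le_logTerm {w : ℕ → ℝ} {D k : ℕ} (hw : IsLogConcave w D) {s η : ℝ}
    (hη : 0 ≤ η) (h1 : peak w D (s - η) ≤ k) (h2 : k ≤ peak w D s) :
    logMax w D s - η * D ≤ logTerm w s k := by
  -- Terms at s increase up to the peak, so term k dominates the term at the peak for s - η. Passing
  -- from s - η to s does not decrease that term, and the maximum at s - η is lower than at s by at
  -- most η times the peak, hence by at most ηD.
  have e1 := hw.logTerm_le_of_le_peak h1 h2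
  have e2 := hw.logMax_subgradient s (s - η)
  have e3 : logMax w D (s - η) = logTerm w (s - η) (peak w D (s - η)) := rfl
  have e4 : (peak w D s : ℝ) ≤ D := by exact_mod_cast peak_le w D s
  have e5 : (0 : ℝ) ≤ peak w D (s - η) := Nat.cast_nonneg _
  unfold logTerm at *
  nlinarith

/-- Location of the peak. -/
lemma tendsto_peak_div {w : ℕ → ℕ → ℝ} {D : ℕ → ℕ} (hw : ∀ j, IsLogConcave (w j) (D j))
    (hD : Tendsto D atTop atTop) {s x : ℝ} (hx : x ∈ Ioo (0 : ℝ) 1)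
    (hlow : ∀ y ∈ Ioo (0 : ℝ) 1, y < x → ∀ᶠ j in atTop,
      1 ≤ w j (⌊y * D j⌋₊ + 1) / w j ⌊y * D j⌋₊ * Real.exp s)
    (hupp : ∀ y ∈ Ioo (0 : ℝ) 1, x < y → ∀ᶠ j in atTop,
      w j (⌊y * D j⌋₊ + 1) / w j ⌊y * D j⌋₊ * Real.exp s < 1) :
    Tendsto (fun j => (peak (w j) (D j) s : ℝ) / D j) atTop (𝓝 x) := by
  have hDpos := hD.eventually_gt_atTop 0
  rw [tendsto_order]
  constructor
  · intro c hc
    -- By log-concavity a single ratio, at index ⌊yD⌋ with c < y < x, decides on which side the peak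
    -- lies.
    obtain ⟨y, hy1, hy2⟩ := exists_between (max_lt hc hx.1)
    have hy : y ∈ Ioo (0 : ℝ) 1 := ⟨(le_max_right _ _).trans_lt hy1, hy2.trans hx.2⟩
    filter_upwards [hlow y hy hy2, hDpos] with j hj hjD
    have hDr : (0 : ℝ) < D j := by exact_mod_cast hjD
    have hm : ⌊y * D j⌋₊ < D j := by
      rw [Nat.floor_lt (mul_nonneg hy.1.le hDr.le)]
      nlinarith [hy.2]
    have hlt : ⌊y * D j⌋₊ + 1 ≤ peak (w j) (D j) s := by
      by_contra! hcon
      exact absurd ((hw j).ratio_lt_one (by omega) hm) (not_lt.2 hj)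
    rw [lt_div_iff₀ hDr]
    have h3 := Nat.lt_floor_add_one (y * D j)
    have h4 : ((⌊y * D j⌋₊ : ℝ) + 1) ≤ peak (w j) (D j) s := by exact_mod_cast hlt
    have h5 : c < y := (le_max_left _ _).trans_lt hy1
    nlinarith
  · intro c hc
    obtain ⟨y, hy1, hy2⟩ := exists_between (lt_min hc hx.2)
    have hy : y ∈ Ioo (0 : ℝ) 1 := ⟨hx.1.trans hy1, hy2.trans_le (min_le_right _ _)⟩
    filter_upwards [hupp y hy hy1, hDpos] with j hj hjD
    have hDr : (0 : ℝ) < D j := by exact_mod_cast hjD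
    have h1 : (peak (w j) (D j) s : ℝ) ≤ ⌊y * D j⌋₊ := by exact_mod_cast peak_le_of_ratio_lt hj
    have h2 := Nat.floor_le (mul_nonneg hy.1.le hDr.le)
    have h3 : y < c := hy2.trans_le (min_le_left _ _)
    rw [div_lt_iff₀ hDr]
    nlinarith

/-! ### Convergence of functions from convergence of subgradients -/

lemma sum_subgradient_le {f g : ℝ → ℝ} (h : ∀ s s', f s + (s' - s) * g s ≤ f s') (s₀ d : ℝ)
    (M : ℕ) :
    d * ∑ i ∈ Finset.range M, g (s₀ + i * d) ≤ f (s₀ + M * d) - f s₀ ∧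
    f (s₀ + M * d) - f s₀ ≤ d * ∑ i ∈ Finset.range M, g (s₀ + (i + 1 : ℕ) * d) := by
  induction M with
  | zero => simp
  | succ M ih =>
    rw [Finset.sum_range_succ, Finset.sum_range_succ, mul_add, mul_add]
    have e1 := h (s₀ + M * d) (s₀ + (M + 1 : ℕ) * d)
    have e2 := h (s₀ + (M + 1 : ℕ) * d) (s₀ + M * d)
    have e3 : s₀ + (M + 1 : ℕ) * d - (s₀ + M * d) = d := by push_cast; ring
    have e4 : s₀ + M * d - (s₀ + (M + 1 : ℕ) * d) = -d := by push_cast; ring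
    rw [e3] at e1
    rw [e4] at e2
    constructor <;> linarith [ih.1, ih.2]

/-- Increments of a convex function lie between lower and upper Riemann sums of its slopes. Finite
sums pass to the limit, and the gap between the two limiting sums telescopes to d(G s₁ - G s₀). -/
lemma tendsto_sub_of_tendsto_subgradient_of_le {f g : ℕ → ℝ → ℝ} {F G : ℝ → ℝ}
    (hf : ∀ j s s', f j s + (s' - s) * g j s ≤ f j s')
    (hF : ∀ s s', F s + (s' - s) * G s ≤ F s')
    (hg : ∀ s, Tendsto (fun j => g j s) atTop (𝓝 (G s))) {s₀ s₁ : ℝ} (hs : s₀ ≤ s₁) :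
    Tendsto (fun j => f j s₁ - f j s₀) atTop (𝓝 (F s₁ - F s₀)) := by
  rw [Metric.tendsto_atTop']
  intro ε hε
  -- Enough intervals to make the gap less than ε/2; the maximum with 0 ensures M > 0.
  obtain ⟨M, hM⟩ := exists_nat_gt (max 0 ((s₁ - s₀) * (G s₁ - G s₀) / (ε / 2)))
  have hM0 : (0 : ℝ) < M := (le_max_left _ _).trans_lt hM
  set d := (s₁ - s₀) / M with hd
  have hd0 : 0 ≤ d := div_nonneg (by linarith) hM0.le
  have hend : s₀ + M * d = s₁ := by rw [hd]; field_simp; ring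
  have hsmall : d * (G s₁ - G s₀) < ε / 2 := by
    have h1 := (le_max_right _ _).trans_lt hM
    rw [div_lt_iff₀ (by positivity)] at h1
    rw [hd, div_mul_eq_mul_div, div_lt_iff₀ hM0]
    linarith
  have htele : ∑ i ∈ Finset.range M, G (s₀ + (i + 1 : ℕ) * d) -
      ∑ i ∈ Finset.range M, G (s₀ + i * d) = G s₁ - G s₀ := by
    rw [← Finset.sum_sub_distrib, Finset.sum_range_sub (fun i : ℕ => G (s₀ + i * d)), hend]
    simp
  have hlow : Tendsto (fun j => d * ∑ i ∈ Finset.range M, g j (s₀ + i * d)) atTop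
      (𝓝 (d * ∑ i ∈ Finset.range M, G (s₀ + i * d))) :=
    (tendsto_finsetSum _ fun i _ => hg _).const_mul d
  have hupp : Tendsto (fun j => d * ∑ i ∈ Finset.range M, g j (s₀ + (i + 1 : ℕ) * d)) atTop
      (𝓝 (d * ∑ i ∈ Finset.range M, G (s₀ + (i + 1 : ℕ) * d))) :=
    (tendsto_finsetSum _ fun i _ => hg _).const_mul d
  have hFs := sum_subgradient_le hF s₀ d M
  rw [hend] at hFs
  have e1 := hlow.eventually_const_lt
    (show d * ∑ i ∈ Finset.range M, G (s₀ + i * d) - ε / 2 < _ by linarith)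
  have e2 := hupp.eventually_lt_const
    (show _ < d * ∑ i ∈ Finset.range M, G (s₀ + (i + 1 : ℕ) * d) + ε / 2 by linarith)
  obtain ⟨j₀, hj₀⟩ := eventually_atTop.1 (e1.and e2)
  refine ⟨j₀, fun j hj => ?_⟩
  obtain ⟨h1, h2⟩ := hj₀ j hj.le
  have hfs := sum_subgradient_le (hf j) s₀ d M
  rw [hend] at hfs
  have hkey : d * ∑ i ∈ Finset.range M, G (s₀ + (i + 1 : ℕ) * d) -
      d * ∑ i ∈ Finset.range M, G (s₀ + i * d) < ε / 2 := by
    rw [← mul_sub, htele]; exact hsmall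
  rw [Real.dist_eq, abs_lt]
  constructor <;> linarith [hfs.1, hfs.2, hFs.1, hFs.2]

lemma tendsto_sub_of_tendsto_subgradient {f g : ℕ → ℝ → ℝ} {F G : ℝ → ℝ}
    (hf : ∀ j s s', f j s + (s' - s) * g j s ≤ f j s')
    (hF : ∀ s s', F s + (s' - s) * G s ≤ F s')
    (hg : ∀ s, Tendsto (fun j => g j s) atTop (𝓝 (G s))) (s₀ s₁ : ℝ) :
    Tendsto (fun j => f j s₁ - f j s₀) atTop (𝓝 (F s₁ - F s₀)) := by
  rcases le_total s₀ s₁ with h | h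
  · exact tendsto_sub_of_tendsto_subgradient_of_le hf hF hg h
  · simpa using (tendsto_sub_of_tendsto_subgradient_of_le hf hF hg h).neg

/-! ### Random polynomials with log-concave weights -/

/-- Markov on the tail: ηD P(X > ηD) ≤ E[X; X > ηD], which tends to 0 by integrability. The factor
2/η absorbs D + 1 ≤ 2D. -/
lemma tendsto_mul_prob_gt {Ω : Type*} [MeasurableSpace Ω] {P : Measure Ω} [IsProbabilityMeasure P]
    {X : Ω → ℝ} (hX : Integrable X P) (hX0 : ∀ ω, 0 ≤ X ω) {D : ℕ → ℕ} (hD : Tendsto D atTop atTop)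
    {η : ℝ} (hη : 0 < η) :
    Tendsto (fun j => ((D j : ℝ) + 1) * P.real {ω | η * D j < X ω}) atTop (𝓝 0) := by
  have hms : ∀ c : ℝ, NullMeasurableSet {ω | c < X ω} P := fun c =>
    nullMeasurableSet_lt aemeasurable_const hX.aemeasurable
  have h1 : Tendsto (fun j => ∫ ω, {ω | η * D j < X ω}.indicator X ω ∂P) atTop (𝓝 0) := by
    have h0 : (0 : ℝ) = ∫ _ : Ω, (0 : ℝ) ∂P := by simp
    rw [h0]
    refine tendsto_integral_of_dominated_convergence X
      (fun j => (hX.1.indicator₀ (hms _))) hX (fun j => Eventually.of_forall fun ω => ?_)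
      (Eventually.of_forall fun ω => ?_)
    · rw [Real.norm_of_nonneg (indicator_nonneg (fun ω _ => hX0 ω) ω)]
      exact indicator_le_self' (fun ω _ => hX0 ω) ω
    · have hDr : Tendsto (fun j => η * (D j : ℝ)) atTop atTop :=
        (tendsto_natCast_atTop_atTop.comp hD).const_mul_atTop hη
      refine tendsto_const_nhds.congr' ?_
      filter_upwards [hDr.eventually_ge_atTop (X ω)] with j hj
      rw [indicator_of_notMem]
      simpa using hj
  have h2 := h1.const_mul (2 / η)
  rw [mul_zero] at h2
  refine tendsto_of_tendsto_of_tendsto_of_le_of_le' tendsto_const_nhds h2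
    (Eventually.of_forall fun j => by positivity) ?_
  filter_upwards [hD.eventually_ge_atTop 1] with j hj
  have hDr : (1 : ℝ) ≤ D j := by exact_mod_cast hj
  have h3 : η * D j * P.real {ω | η * D j < X ω} ≤
      ∫ ω, {ω | η * D j < X ω}.indicator X ω ∂P := by
    rw [integral_indicator₀ (hms _)]
    have h4 : ∫ _ in {ω | η * D j < X ω}, (η * D j : ℝ) ∂P ≤ ∫ ω in {ω | η * D j < X ω}, X ω ∂P := by
      refine setIntegral_mono_on₀ (integrable_const _) hX.integrableOn (hms _) fun ω hω => ?_
      exact le_of_lt hω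
    rw [setIntegral_const, smul_eq_mul, mul_comm] at h4
    exact h4
  have hp : 0 ≤ P.real {ω | η * D j < X ω} := measureReal_nonneg
  calc ((D j : ℝ) + 1) * P.real {ω | η * D j < X ω}
      ≤ 2 * D j * P.real {ω | η * D j < X ω} := by gcongr; linarith
    _ = 2 / η * (η * D j * P.real {ω | η * D j < X ω}) := by field_simp
    _ ≤ _ := by gcongr

lemma tendsto_inv_mul_log_add_one : Tendsto (fun y : ℝ => y⁻¹ * Real.log (y + 1)) atTop (𝓝 0) := by
  have h : Tendsto (fun y : ℝ => 2 * (√y)⁻¹) atTop (𝓝 0) := by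
    simpa using (tendsto_inv_atTop_zero.comp Real.tendsto_sqrt_atTop).const_mul 2
  refine tendsto_of_tendsto_of_tendsto_of_le_of_le' tendsto_const_nhds h ?_ ?_
  · filter_upwards [eventually_ge_atTop 0] with y hy
    have := Real.log_nonneg (show 1 ≤ y + 1 by linarith)
    positivity
  · filter_upwards [eventually_gt_atTop 0] with y hy
    have h1 := log_one_add_le_two_mul_sqrt hy.le
    rw [add_comm] at h1
    calc y⁻¹ * Real.log (y + 1) ≤ y⁻¹ * (2 * √y) := by gcongr
      _ = 2 * (√y)⁻¹ := by
        have := Real.sq_sqrt hy.le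
        have h2 := Real.sqrt_pos.2 hy
        field_simp
        exact this

section

variable {Ω : Type*} [MeasurableSpace Ω] {P : Measure Ω} [IsProbabilityMeasure P]
  {ξ : ℕ → Ω → ℂ}

/-- A union bound over D + 1 identically distributed coefficients; this is where the logarithmic
moment enters the estimate for the sums. -/
lemma tendsto_prob_exists_norm_gt (hident : ∀ k, IdentDistrib (ξ k) (ξ 0) P P)
    (hlog : Integrable (fun ω => Real.log (1 + ‖ξ 0 ω‖)) P) {D : ℕ → ℕ} (N : ℕ → ℕ)
    (hD : Tendsto D atTop atTop) {η : ℝ} (hη : 0 < η) :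
    Tendsto (fun j => P.real {ω | ∃ k ≤ D j, Real.exp (η * D j) < ‖ξ (N j + k) ω‖}) atTop
      (𝓝 0) := by
  refine tendsto_of_tendsto_of_tendsto_of_le_of_le tendsto_const_nhds
    (tendsto_mul_prob_gt hlog (fun ω => Real.log_nonneg (by linarith [norm_nonneg (ξ 0 ω)])) hD hη)
    (fun j => measureReal_nonneg) fun j => ?_
  have hset : {ω | ∃ k ≤ D j, Real.exp (η * D j) < ‖ξ (N j + k) ω‖} =
      ⋃ k ∈ Finset.range (D j + 1), {ω | Real.exp (η * D j) < ‖ξ (N j + k) ω‖} := by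
    ext ω; simp
  rw [hset]
  refine (measureReal_biUnion_finset_le _ _).trans ?_
  have hk : ∀ k, P.real {ω | Real.exp (η * D j) < ‖ξ (N j + k) ω‖} ≤
      P.real {ω | η * D j < Real.log (1 + ‖ξ 0 ω‖)} := by
    intro k
    have hms : MeasurableSet {x : ℂ | Real.exp (η * D j) < ‖x‖} :=
      measurableSet_lt measurable_const measurable_norm
    have h1 : P.real {ω | Real.exp (η * D j) < ‖ξ (N j + k) ω‖} =
        P.real {ω | Real.exp (η * D j) < ‖ξ 0 ω‖} := by
      rw [Measure.real, Measure.real]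
      congr 1
      exact (hident (N j + k)).measure_mem_eq hms
    rw [h1]
    refine measureReal_mono fun ω hω => ?_
    rw [mem_ofPred_eq] at hω ⊢
    rw [Real.lt_log_iff_exp_lt (by positivity)]
    linarith
  refine (Finset.sum_le_sum fun k _ => hk k).trans ?_
  simp

/-- Logarithmic asymptotics of random polynomials with log-concave weights. -/
theorem tendstoInMeasure_log_norm_sum (hmeas : ∀ k, Measurable (ξ k)) (hindep : iIndepFun ξ P)
    (hident : ∀ k, IdentDistrib (ξ k) (ξ 0) P P)
    (hnondeg : ¬ ∃ c : ℂ, ∀ᵐ ω ∂P, ξ 0 ω = c)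
    (hlog : Integrable (fun ω => Real.log (1 + ‖ξ 0 ω‖)) P)
    {D : ℕ → ℕ} (N : ℕ → ℕ) (hD : Tendsto D atTop atTop) {w : ℕ → ℕ → ℝ}
    (hw : ∀ j, IsLogConcave (w j) (D j)) {U x : ℝ → ℝ} (hx : StrictMono x)
    (hpeak : ∀ s, Tendsto (fun j => (peak (w j) (D j) s : ℝ) / D j) atTop (𝓝 (x s)))
    (hU : ∀ s s', U s + (s' - s) * x s ≤ U s') {z : ℂ} (hz : z ≠ 0) :
    TendstoInMeasure P (fun j ω => (D j : ℝ)⁻¹ *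
        Real.log ‖∑ k ∈ Finset.range (D j + 1), ξ (N j + k) ω * (w j k : ℂ) * z ^ k‖ -
          ((D j : ℝ)⁻¹ * logMax (w j) (D j) 0 - U 0)) atTop (fun _ => U (Real.log ‖z‖)) := by
  set s := Real.log ‖z‖ with hs
  have hzp : 0 < ‖z‖ := norm_pos_iff.2 hz
  set S : ℕ → Ω → ℂ := fun j ω =>
    ∑ k ∈ Finset.range (D j + 1), ξ (N j + k) ω * (w j k : ℂ) * z ^ k with hS
  have hterm : ∀ j, ∀ k ≤ D j, ‖(w j k : ℂ) * z ^ k‖ = Real.exp (logTerm (w j) s k) := by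
    intro j k hk
    have := (hw j).pos k hk
    rw [norm_mul, norm_pow, Complex.norm_real, Real.norm_of_nonneg this.le, logTerm, Real.exp_add,
      Real.exp_log this, hs, mul_comm (k : ℝ), Real.exp_mul, Real.exp_log hzp, Real.rpow_natCast]
  -- deterministic part
  have hdet : Tendsto (fun j => (D j : ℝ)⁻¹ * logMax (w j) (D j) s -
      ((D j : ℝ)⁻¹ * logMax (w j) (D j) 0 - U 0)) atTop (𝓝 (U s)) := by
    -- Slopes determine functions only up to constants, so values are compared with those at s = 0;
    -- this explains the subtracted term.
    have h := tendsto_sub_of_tendsto_subgradient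
      (f := fun j s => (D j : ℝ)⁻¹ * logMax (w j) (D j) s)
      (g := fun j s => (peak (w j) (D j) s : ℝ) / D j) (fun j s s' => ?_) hU hpeak 0 s
    · have h2 := h.add_const (U 0)
      rw [sub_add_cancel] at h2
      refine h2.congr fun j => by ring
    · have h3 := mul_le_mul_of_nonneg_left ((hw j).logMax_subgradient s s')
        (show (0 : ℝ) ≤ (D j : ℝ)⁻¹ by positivity)
      calc _ = (D j : ℝ)⁻¹ * (logMax (w j) (D j) s + (s' - s) * (peak (w j) (D j) s)) := by ring
        _ ≤ _ := h3
  rw [tendstoInMeasure_iff_measureReal_norm]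
  intro ε hε
  -- The upper estimate spends three η, on the number of terms, the coefficients and the
  -- deterministic limit; the lower estimate spends two.
  set η := ε / 4 with hη
  have hη0 : 0 < η := by positivity
  -- lower bound
  have hlow : Tendsto (fun j => P.real {ω | ‖S j ω‖ ≤
      Real.exp (logMax (w j) (D j) s - η * D j)}) atTop (𝓝 0) := by
    rw [Metric.tendsto_atTop']
    intro δ hδ
    obtain ⟨m, hm⟩ := exists_prob_norm_sum_le hmeas hindep hident hnondeg (half_pos hδ)
    -- Strict monotonicity of x makes the number of nearly maximal terms grow linearly in D,
    -- eventually exceeding m.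
    have hgap : Tendsto (fun j => (peak (w j) (D j) s : ℝ) - peak (w j) (D j) (s - η))
        atTop atTop := by
      have h1 := (hpeak s).sub (hpeak (s - η))
      have h2 : 0 < x s - x (s - η) := sub_pos.2 (hx (by linarith))
      have h3 := h1.pos_mul_atTop h2 (tendsto_natCast_atTop_atTop.comp hD)
      refine h3.congr' ?_
      filter_upwards [hD.eventually_gt_atTop 0] with j hj
      have : (0 : ℝ) < D j := by exact_mod_cast hj
      simp only [Function.comp]
      field_simp
    obtain ⟨j₀, hj₀⟩ := eventually_atTop.1 (hgap.eventually_ge_atTop (m : ℝ))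
    refine ⟨j₀, fun j hj => ?_⟩
    rw [Real.dist_eq, sub_zero, abs_of_nonneg measureReal_nonneg]
    refine lt_of_le_of_lt ?_ (half_lt_self hδ)
    have hmem : ∀ i ∈ Finset.image (fun k => N j + k)
        (Finset.Icc (peak (w j) (D j) (s - η)) (peak (w j) (D j) s)),
        Real.exp (logMax (w j) (D j) s - η * D j) ≤ ‖(w j (i - N j) : ℂ) * z ^ (i - N j)‖ := by
      intro i hi
      obtain ⟨k, hk, rfl⟩ := Finset.mem_image.1 hi
      obtain ⟨hk1, hk2⟩ := Finset.mem_Icc.1 hk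
      rw [Nat.add_sub_cancel_left, hterm j k (hk2.trans (peak_le _ _ _)), Real.exp_le_exp]
      exact (hw j).logMax_sub_le_logTerm hη0.le hk1 hk2
    have h := hm (Finset.image (fun k => N j + k) (Finset.range (D j + 1)))
      (Finset.image (fun k => N j + k)
        (Finset.Icc (peak (w j) (D j) (s - η)) (peak (w j) (D j) s)))
      (fun i => (w j (i - N j) : ℂ) * z ^ (i - N j))
      (Real.exp (logMax (w j) (D j) s - η * D j)) (Real.exp_pos _) ?_ ?_ hmem
    · refine le_trans (le_of_eq ?_) h
      congr 1
      ext ω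
      rw [mem_ofPred_eq, mem_ofPred_eq, Finset.sum_image (by intro a _ b _ hab; simpa using hab)]
      simp only [Nat.add_sub_cancel_left, hS]
      have : ∀ k, (w j k : ℂ) * z ^ k * ξ (N j + k) ω = ξ (N j + k) ω * (w j k : ℂ) * z ^ k :=
        fun k => by ring
      simp only [this]
    · refine Finset.image_subset_image fun k hk => ?_
      have := (Finset.mem_Icc.1 hk).2.trans (peak_le (w j) (D j) s)
      exact Finset.mem_range.2 (by omega)
    · rw [Finset.card_image_of_injective _ (add_right_injective (N j)), Nat.card_Icc]
      have h5 := hj₀ j hj.le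
      have h6 : (m : ℝ) + peak (w j) (D j) (s - η) ≤ peak (w j) (D j) s := by linarith
      have h7 : m + peak (w j) (D j) (s - η) ≤ peak (w j) (D j) s := by exact_mod_cast h6
      omega
  have hsum := hlow.add (tendsto_prob_exists_norm_gt hident hlog N hD hη0)
  rw [add_zero] at hsum
  have hlogD : Tendsto (fun j => (D j : ℝ)⁻¹ * Real.log ((D j : ℝ) + 1)) atTop (𝓝 0) :=
    tendsto_inv_mul_log_add_one.comp (tendsto_natCast_atTop_atTop.comp hD)
  refine tendsto_of_tendsto_of_tendsto_of_le_of_le' tendsto_const_nhds hsum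
    (Eventually.of_forall fun j => measureReal_nonneg) ?_
  filter_upwards [hlogD.eventually_lt_const hη0, hD.eventually_gt_atTop 0,
    Metric.tendsto_nhds.1 hdet η hη0] with j hj hjD hjdet
  have hDr : (0 : ℝ) < D j := by exact_mod_cast hjD
  rw [Real.dist_eq, abs_lt] at hjdet
  refine le_trans (measureReal_mono ?_) (measureReal_union_le _ _)
  intro ω hω
  by_contra hcon
  rw [mem_union, not_or] at hcon
  obtain ⟨hc1, hc2⟩ := hcon
  simp only [mem_ofPred_eq, not_le] at hc1
  simp only [mem_ofPred_eq, not_exists, not_and, not_lt] at hc2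
  have hSpos : 0 < ‖S j ω‖ := (Real.exp_pos _).trans hc1
  have hl1 : logMax (w j) (D j) s - η * D j < Real.log ‖S j ω‖ :=
    (Real.lt_log_iff_exp_lt hSpos).2 hc1
  -- There are D + 1 summands, each at most e^{ηD} times the maximal deterministic term.
  have hl2 : Real.log ‖S j ω‖ ≤ Real.log ((D j : ℝ) + 1) + η * D j + logMax (w j) (D j) s := by
    have hle : ‖S j ω‖ ≤ ((D j : ℝ) + 1) *
        (Real.exp (η * D j) * Real.exp (logMax (w j) (D j) s)) := by
      refine (norm_sum_le _ _).trans ?_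
      have : ∀ k ∈ Finset.range (D j + 1), ‖ξ (N j + k) ω * (w j k : ℂ) * z ^ k‖ ≤
          Real.exp (η * D j) * Real.exp (logMax (w j) (D j) s) := by
        intro k hk
        have hk' : k ≤ D j := by have := Finset.mem_range.1 hk; omega
        rw [mul_assoc, norm_mul, hterm j k hk']
        gcongr
        · exact hc2 k hk'
        · exact (hw j).logTerm_le_logMax s hk'
      refine (Finset.sum_le_sum this).trans ?_
      simp
    have := Real.log_le_log hSpos hle
    rw [Real.log_mul (by positivity) (by positivity), Real.log_mul (by positivity) (by positivity),
      Real.log_exp, Real.log_exp] at this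
    linarith
  have hm1 : (D j : ℝ)⁻¹ * logMax (w j) (D j) s - η < (D j : ℝ)⁻¹ * Real.log ‖S j ω‖ := by
    have := mul_lt_mul_of_pos_left hl1 (inv_pos.2 hDr)
    have e : (D j : ℝ)⁻¹ * (logMax (w j) (D j) s - η * D j) =
        (D j : ℝ)⁻¹ * logMax (w j) (D j) s - η := by field_simp
    linarith
  have hm2 : (D j : ℝ)⁻¹ * Real.log ‖S j ω‖ ≤ (D j : ℝ)⁻¹ * Real.log ((D j : ℝ) + 1) + η +
      (D j : ℝ)⁻¹ * logMax (w j) (D j) s := by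
    have := mul_le_mul_of_nonneg_left hl2 (inv_pos.2 hDr).le
    have e : (D j : ℝ)⁻¹ * (Real.log ((D j : ℝ) + 1) + η * D j + logMax (w j) (D j) s) =
        (D j : ℝ)⁻¹ * Real.log ((D j : ℝ) + 1) + η + (D j : ℝ)⁻¹ * logMax (w j) (D j) s := by
      field_simp
    linarith
  rw [mem_ofPred_eq, Real.norm_eq_abs] at hω
  have hlt : |(D j : ℝ)⁻¹ * Real.log ‖S j ω‖ - ((D j : ℝ)⁻¹ * logMax (w j) (D j) 0 - U 0) - U s|
      < ε := by
    rw [abs_lt]; constructor <;> linarith [hjdet.1, hjdet.2]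
  exact absurd hω (not_le.2 hlt)

end

/-! ### Derivatives of elliptic polynomials -/

/-- The polynomial with coefficients `c 0, …, c D`. -/
def coeffPoly (c : ℕ → ℂ) (D : ℕ) : Polynomial ℂ :=
  ∑ k ∈ Finset.range (D + 1), Polynomial.C (c k) * Polynomial.X ^ k

lemma coeff_coeffPoly (c : ℕ → ℂ) (D m : ℕ) :
    (coeffPoly c D).coeff m = if m ≤ D then c m else 0 := by
  simp [coeffPoly, Polynomial.coeff_C_mul, Polynomial.coeff_X_pow]

lemma eval_coeffPoly (c : ℕ → ℂ) (D : ℕ) (z : ℂ) :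
    (coeffPoly c D).eval z = ∑ k ∈ Finset.range (D + 1), c k * z ^ k := by
  simp [coeffPoly, Polynomial.eval_finsetSum]

lemma natDegree_coeffPoly_le (c : ℕ → ℂ) (D : ℕ) : (coeffPoly c D).natDegree ≤ D := by
  rw [Polynomial.natDegree_le_iff_coeff_eq_zero]
  intro m hm
  rw [coeff_coeffPoly, if_neg (by omega)]

/-- The weights of the coefficients of the `N`-th derivative of the elliptic polynomial of
degree `n`. -/
def ellipticWeight (n N k : ℕ) : ℝ := √(n.choose (N + k) : ℝ) * ((N + k).descFactorial N : ℝ)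

lemma iterate_derivative_ellipticPoly_comp {Ω : Type*} (ξ : ℕ → Ω → ℂ) {n N : ℕ} (hN : N ≤ n)
    (h : ℝ) (ω : Ω) :
    (Polynomial.derivative^[N] (ellipticPoly ξ n ω)).comp (Polynomial.C (h : ℂ) * Polynomial.X) =
      coeffPoly (fun k => ξ (N + k) ω * ((ellipticWeight n N k * h ^ k : ℝ) : ℂ)) (n - N) := by
  ext m
  have he : ellipticPoly ξ n ω = coeffPoly (fun k => ξ k ω * (√(n.choose k : ℝ) : ℂ)) n := rfl
  rw [Polynomial.comp_C_mul_X_coeff, Polynomial.coeff_iterate_derivative, he, coeff_coeffPoly,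
    coeff_coeffPoly]
  by_cases hm : m ≤ n - N
  · rw [if_pos hm, if_pos (by omega), ellipticWeight, add_comm m N, nsmul_eq_mul]
    push_cast
    ring
  · rw [if_neg hm, if_neg (by omega)]
    simp

lemma ellipticWeight_pos {n N k : ℕ} (hN : N ≤ n) (hk : k ≤ n - N) : 0 < ellipticWeight n N k := by
  have h1 : 0 < n.choose (N + k) := Nat.choose_pos (by omega)
  have h2 : 0 < (N + k).descFactorial N := Nat.descFactorial_pos.2 (by omega)
  unfold ellipticWeight
  positivity

/-- The binomials contribute (D - k)/(N + k + 1) to the squared ratio, where D = n - N, and the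
falling factorials ((N + k + 1)/(k + 1))². The product is written as two factors, each nonincreasing
in k, which makes log-concavity visible. -/
lemma ellipticWeight_ratio {n N k : ℕ} (hk : k < n - N) :
    ellipticWeight n N (k + 1) / ellipticWeight n N k =
      √((((N : ℝ) + k + 1) / (k + 1)) * ((((n - N : ℕ) : ℝ) - k) / (k + 1))) := by
  have hN : N ≤ n := by omega
  have hp := ellipticWeight_pos hN hk.le
  have hp1 := ellipticWeight_pos hN (show k + 1 ≤ n - N from hk)
  have hkD : (k : ℝ) < ((n - N : ℕ) : ℝ) := by exact_mod_cast hk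
  symm
  rw [Real.sqrt_eq_iff_mul_self_eq (by
    have : 0 ≤ ((n - N : ℕ) : ℝ) - k := by linarith
    positivity) (by positivity)]
  have e1 : (n.choose (N + k + 1) : ℝ) * (N + k + 1) = n.choose (N + k) * (((n - N : ℕ) : ℝ) - k) := by
    have := Nat.choose_succ_right_eq n (N + k)
    have h2 : n - (N + k) = (n - N) - k := by omega
    rw [h2] at this
    have h3 : (((n - N) - k : ℕ) : ℝ) = ((n - N : ℕ) : ℝ) - k := Nat.cast_sub hk.le
    rw [← h3]
    exact_mod_cast this
  have e2 : ((k : ℝ) + 1) * ((N + k + 1).descFactorial N : ℝ) =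
      (N + k + 1) * ((N + k).descFactorial N : ℝ) := by
    have := Nat.succ_descFactorial (N + k) N
    have h2 : N + k + 1 - N = k + 1 := by omega
    rw [h2] at this
    exact_mod_cast this
  have hsq : ∀ i, ellipticWeight n N i * ellipticWeight n N i =
      (n.choose (N + i) : ℝ) * ((N + i).descFactorial N : ℝ) ^ 2 := by
    intro i
    unfold ellipticWeight
    have := Real.mul_self_sqrt (show (0 : ℝ) ≤ (n.choose (N + i) : ℝ) by positivity)
    linear_combination ((N + i).descFactorial N : ℝ) ^ 2 * this
  rw [div_mul_div_comm, div_mul_div_comm, hsq, hsq, ← add_assoc]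
  have hc : (0 : ℝ) < n.choose (N + k) := by exact_mod_cast Nat.choose_pos (by omega)
  have hd : (0 : ℝ) < (N + k).descFactorial N := by
    exact_mod_cast Nat.descFactorial_pos.2 (by omega)
  rw [div_eq_div_iff (by positivity) (by positivity)]
  have e3 : (n.choose (N + k + 1) : ℝ) * ((N + k + 1).descFactorial N : ℝ) ^ 2 *
      (((k : ℝ) + 1) * (k + 1)) = (n.choose (N + k + 1) : ℝ) * (N + k + 1) *
      ((N + k + 1) * ((N + k).descFactorial N : ℝ) ^ 2) := by
    linear_combination (n.choose (N + k + 1) : ℝ) *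
      (((k : ℝ) + 1) * ((N + k + 1).descFactorial N : ℝ) +
        (N + k + 1) * ((N + k).descFactorial N : ℝ)) * e2
  rw [e3, e1]
  ring

lemma ellipticWeight_mul_pow_ratio {n N k : ℕ} {h : ℝ} (hh : 0 < h) (hk : k < n - N) :
    ellipticWeight n N (k + 1) * h ^ (k + 1) / (ellipticWeight n N k * h ^ k) =
      √((((N : ℝ) + k + 1) / (k + 1)) * ((((n - N : ℕ) : ℝ) - k) / (k + 1))) * h := by
  rw [mul_div_mul_comm, pow_succ, mul_div_cancel_left₀ _ (pow_pos hh k).ne',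
    ellipticWeight_ratio hk]

lemma isLogConcave_ellipticWeight {n N : ℕ} (hN : N ≤ n) {h : ℝ} (hh : 0 < h) :
    IsLogConcave (fun k => ellipticWeight n N k * h ^ k) (n - N) where
  pos k hk := mul_pos (ellipticWeight_pos hN hk) (pow_pos hh k)
  ratio_antitone i k hik hk := by
    rw [ellipticWeight_mul_pow_ratio hh hk, ellipticWeight_mul_pow_ratio hh (by omega)]
    have hkD : (k : ℝ) < ((n - N : ℕ) : ℝ) := by exact_mod_cast hk
    have hik' : (i : ℝ) ≤ k := by exact_mod_cast hik
    have hi0 : (0 : ℝ) ≤ i := Nat.cast_nonneg i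
    have hN0 : (0 : ℝ) ≤ N := Nat.cast_nonneg N
    refine mul_le_mul_of_nonneg_right (Real.sqrt_le_sqrt ?_) hh.le
    refine mul_le_mul ?_ ?_ ?_ ?_
    · rw [div_le_div_iff₀ (by positivity) (by positivity)]; nlinarith
    · rw [div_le_div_iff₀ (by positivity) (by positivity)]; nlinarith
    · exact div_nonneg (by linarith) (by positivity)
    · positivity

section

variable {n N : ℕ → ℕ} {h : ℕ → ℝ} {a β : ℝ}

/-- With D = n - N, index k ≈ yD and N + k + 1 measured in units of n, the scales left over combine
to h² n / D, whose limit is β. Nothing is divided by 1 - a, so a = 1 is included. -/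
lemma tendsto_ratio_sq (hh : ∀ j, 0 < h j) (hN : ∀ j, N j ≤ n j)
    (hD : Tendsto (fun j => n j - N j) atTop atTop)
    (ha : Tendsto (fun j => (N j : ℝ) / n j) atTop (𝓝 a))
    (hβ : Tendsto (fun j => h j ^ 2 * (n j / ((n j - N j : ℕ) : ℝ))) atTop (𝓝 β))
    {y : ℝ} (hy : y ∈ Ioo (0 : ℝ) 1) :
    Tendsto (fun j => (ellipticWeight (n j) (N j) (⌊y * (n j - N j : ℕ)⌋₊ + 1) *
        h j ^ (⌊y * (n j - N j : ℕ)⌋₊ + 1) /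
        (ellipticWeight (n j) (N j) ⌊y * (n j - N j : ℕ)⌋₊ * h j ^ ⌊y * (n j - N j : ℕ)⌋₊)) ^ 2)
      atTop (𝓝 (β * (a + (1 - a) * y) * (1 - y) / y ^ 2)) := by
  have hDr : Tendsto (fun j => ((n j - N j : ℕ) : ℝ)) atTop atTop :=
    tendsto_natCast_atTop_atTop.comp hD
  have hDpos := hD.eventually_gt_atTop 0
  have hm : Tendsto (fun j => (⌊y * (n j - N j : ℕ)⌋₊ : ℝ) / ((n j - N j : ℕ) : ℝ)) atTop
      (𝓝 y) := (tendsto_nat_floor_mul_div_atTop hy.1.le).comp hDr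
  have hm1 : Tendsto (fun j => ((⌊y * (n j - N j : ℕ)⌋₊ : ℝ) + 1) / ((n j - N j : ℕ) : ℝ)) atTop
      (𝓝 y) := by
    have := hm.add (tendsto_inv_atTop_zero.comp hDr)
    rw [add_zero] at this
    refine this.congr fun j => ?_
    simp only [Function.comp]
    rw [add_div, one_div]
  have hDn : Tendsto (fun j => ((n j - N j : ℕ) : ℝ) / n j) atTop (𝓝 (1 - a)) := by
    refine (ha.const_sub 1).congr' ?_
    filter_upwards [hDpos] with j hj
    have hn : (0 : ℝ) < n j := by exact_mod_cast (by omega : 0 < n j)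
    rw [Nat.cast_sub (hN j)]
    field_simp
  have h1 : Tendsto (fun j => ((N j : ℝ) + ⌊y * (n j - N j : ℕ)⌋₊ + 1) / n j) atTop
      (𝓝 (a + (1 - a) * y)) := by
    have := ha.add (hDn.mul hm1)
    refine this.congr' ?_
    filter_upwards [hDpos] with j hj
    have hn : (0 : ℝ) < n j := by exact_mod_cast (by omega : 0 < n j)
    have hDp : (0 : ℝ) < ((n j - N j : ℕ) : ℝ) := by exact_mod_cast hj
    field_simp
    ring
  have h2 := ((hβ.mul h1).mul (hm.const_sub 1)).div (hm1.pow 2) (pow_pos hy.1 2).ne'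
  refine h2.congr' ?_
  filter_upwards [hDpos] with j hj
  have hn : (0 : ℝ) < n j := by exact_mod_cast (by omega : 0 < n j)
  have hDp : (0 : ℝ) < ((n j - N j : ℕ) : ℝ) := by exact_mod_cast hj
  have hml : (⌊y * (n j - N j : ℕ)⌋₊ : ℝ) < ((n j - N j : ℕ) : ℝ) := by
    refine (Nat.floor_le (mul_nonneg hy.1.le hDp.le)).trans_lt ?_
    nlinarith [hy.2]
  have hml' : ⌊y * (n j - N j : ℕ)⌋₊ < n j - N j := by exact_mod_cast hml
  rw [ellipticWeight_mul_pow_ratio (hh j) hml', mul_pow, Real.sq_sqrt]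
  · have hm0 : (0 : ℝ) < (⌊y * (n j - N j : ℕ)⌋₊ : ℝ) + 1 := by positivity
    simp only [Pi.div_apply]
    generalize (⌊y * (n j - N j : ℕ)⌋₊ : ℝ) = m at hm0 ⊢
    field_simp
  · have : 0 ≤ ((n j - N j : ℕ) : ℝ) - ⌊y * (n j - N j : ℕ)⌋₊ := by linarith
    positivity

/-- The limiting squared ratio exceeds 1 exactly when y satisfies the quadratic inequality
characterising y < `radialCDF`. -/
lemma tendsto_peak_ellipticWeight (hh : ∀ j, 0 < h j) (hN : ∀ j, N j ≤ n j)
    (hD : Tendsto (fun j => n j - N j) atTop atTop) (ha0 : 0 ≤ a) (ha1 : a ≤ 1)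
    (ha : Tendsto (fun j => (N j : ℝ) / n j) atTop (𝓝 a)) (hβ0 : 0 < β)
    (hβ : Tendsto (fun j => h j ^ 2 * (n j / ((n j - N j : ℕ) : ℝ))) atTop (𝓝 β)) (s : ℝ) :
    Tendsto (fun j => (peak (fun k => ellipticWeight (n j) (N j) k * h j ^ k) (n j - N j) s : ℝ) /
      ((n j - N j : ℕ) : ℝ)) atTop (𝓝 (radialCDF a (β * Real.exp s ^ 2))) := by
  have hB : 0 < β * Real.exp s ^ 2 := by positivity
  have hlim : ∀ y ∈ Ioo (0 : ℝ) 1, Tendsto (fun j =>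
      (ellipticWeight (n j) (N j) (⌊y * (n j - N j : ℕ)⌋₊ + 1) *
        h j ^ (⌊y * (n j - N j : ℕ)⌋₊ + 1) /
        (ellipticWeight (n j) (N j) ⌊y * (n j - N j : ℕ)⌋₊ * h j ^ ⌊y * (n j - N j : ℕ)⌋₊) *
        Real.exp s) ^ 2) atTop
      (𝓝 (β * Real.exp s ^ 2 * (a + (1 - a) * y) * (1 - y) / y ^ 2)) := by
    intro y hy
    have h1 := (tendsto_ratio_sq hh hN hD ha hβ hy).mul_const (Real.exp s ^ 2)
    simp only [mul_pow]
    convert! h1 using 2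
    ring
  refine tendsto_peak_div (w := fun j k => ellipticWeight (n j) (N j) k * h j ^ k)
    (fun j => isLogConcave_ellipticWeight (hN j) (hh j)) hD
    ⟨radialCDF_pos ha0 ha1 hB, radialCDF_lt_one ha0 ha1 hB⟩ ?_ ?_
  · intro y hy hyx
    rw [lt_radialCDF_iff ha0 ha1 hB hy.1] at hyx
    have h1 : 1 < β * Real.exp s ^ 2 * (a + (1 - a) * y) * (1 - y) / y ^ 2 :=
      (one_lt_div (pow_pos hy.1 2)).2 hyx
    filter_upwards [(hlim y hy).eventually_const_lt h1, hD.eventually_gt_atTop 0] with j hj hjD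
    have hDp : (0 : ℝ) < ((n j - N j : ℕ) : ℝ) := by exact_mod_cast hjD
    have hml : ⌊y * (n j - N j : ℕ)⌋₊ < n j - N j := by
      rw [Nat.floor_lt (mul_nonneg hy.1.le hDp.le)]
      nlinarith [hy.2]
    rw [ellipticWeight_mul_pow_ratio (hh j) hml] at hj ⊢
    have hpos : 0 ≤ √(((N j : ℝ) + ⌊y * (n j - N j : ℕ)⌋₊ + 1) / (⌊y * (n j - N j : ℕ)⌋₊ + 1) *
        ((((n j - N j : ℕ) : ℝ) - ⌊y * (n j - N j : ℕ)⌋₊) / (⌊y * (n j - N j : ℕ)⌋₊ + 1))) *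
        h j * Real.exp s := by have := hh j; positivity
    nlinarith
  · intro y hy hyx
    rw [radialCDF_lt_iff ha0 ha1 hB hy.1] at hyx
    have h1 : β * Real.exp s ^ 2 * (a + (1 - a) * y) * (1 - y) / y ^ 2 < 1 :=
      (div_lt_one (pow_pos hy.1 2)).2 hyx
    filter_upwards [(hlim y hy).eventually_lt_const h1] with j hj
    nlinarith

end

/-- Convergence of the rescaled zeros of derivatives of elliptic polynomials. -/
theorem convInProb_derivative_ellipticPoly {Ω : Type*} [MeasurableSpace Ω] {P : Measure Ω}
    [IsProbabilityMeasure P] {ξ : ℕ → Ω → ℂ} (hmeas : ∀ k, Measurable (ξ k))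
    (hindep : iIndepFun ξ P) (hident : ∀ k, IdentDistrib (ξ k) (ξ 0) P P)
    (hnondeg : ¬ ∃ c : ℂ, ∀ᵐ ω ∂P, ξ 0 ω = c)
    (hlog : Integrable (fun ω => Real.log (1 + ‖ξ 0 ω‖)) P)
    {n N : ℕ → ℕ} {h : ℕ → ℝ} {a β : ℝ} (hh : ∀ j, 0 < h j) (hN : ∀ j, N j ≤ n j)
    (hD : Tendsto (fun j => n j - N j) atTop atTop) (ha0 : 0 ≤ a) (ha1 : a ≤ 1)
    (ha : Tendsto (fun j => (N j : ℝ) / n j) atTop (𝓝 a)) (hβ0 : 0 < β)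
    (hβ : Tendsto (fun j => h j ^ 2 * (n j / ((n j - N j : ℕ) : ℝ))) atTop (𝓝 β)) :
    ConvInProb P (fun j ω => ((n j - N j : ℕ) : ℝ≥0∞)⁻¹ •
      zeroMeasure ((Polynomial.derivative^[N j] (ellipticPoly ξ (n j) ω)).comp
        (Polynomial.C (h j : ℂ) * Polynomial.X))) (radialLaw (radialQuantile a β)) := by
  have hint := integrableOn_log_radialQuantile ha0 ha1 hβ0
  have heq : ∀ j ω, (Polynomial.derivative^[N j] (ellipticPoly ξ (n j) ω)).comp
      (Polynomial.C (h j : ℂ) * Polynomial.X) = coeffPoly (fun k => ξ (N j + k) ω *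
        ((ellipticWeight (n j) (N j) k * h j ^ k : ℝ) : ℂ)) (n j - N j) :=
    fun j ω => iterate_derivative_ellipticPoly_comp ξ (hN j) (h j) ω
  simp only [heq]
  have hlim : ∀ᵐ z : ℂ, TendstoInMeasure P
      (fun j ω => ((n j - N j : ℕ) : ℝ)⁻¹ * Real.log ‖(coeffPoly (fun k => ξ (N j + k) ω *
        ((ellipticWeight (n j) (N j) k * h j ^ k : ℝ) : ℂ)) (n j - N j)).eval z‖ -
          (((n j - N j : ℕ) : ℝ)⁻¹ * logMax
      (fun k => ellipticWeight (n j) (N j) k * h j ^ k) (n j - N j) 0 -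
        radialPotential (radialQuantile a β) 0)) atTop
      (fun _ => radialPotential (radialQuantile a β) (Real.log ‖z‖)) := by
    filter_upwards [Measure.ae_ne volume (0 : ℂ)] with z hz
    simp only [eval_coeffPoly]
    refine tendstoInMeasure_log_norm_sum hmeas hindep hident hnondeg hlog N hD
      (w := fun j k => ellipticWeight (n j) (N j) k * h j ^ k)
      (fun j => isLogConcave_ellipticWeight (hN j) (hh j))
      (x := fun s => radialCDF a (β * Real.exp s ^ 2)) ?_
      (tendsto_peak_ellipticWeight hh hN hD ha0 ha1 ha hβ0 hβ)
      (radialPotential_subgradient ha0 ha1 hβ0) hz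
    intro s s' hs
    refine radialCDF_strictMono ha0 ha1 (by positivity) ?_
    gcongr
  refine convInProb_of_tendstoInMeasure_log (d := fun j => n j - N j)
    (p := fun j ω => coeffPoly (fun k => ξ (N j + k) ω *
        ((ellipticWeight (n j) (N j) k * h j ^ k : ℝ) : ℂ)) (n j - N j))
    (fun j ω => natDegree_coeffPoly_le _ _) (fun j => ?_)
    ((measurable_radialPotential hint).comp (Real.measurable_log.comp measurable_norm)) hlim
    (fun φ hφ hc => integral_radialPotential_mul_lap (measurable_radialQuantile a β)
      (fun y hy => radialQuantile_pos ha0 hβ0 hy) hint hφ hc)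
  simp only [eval_coeffPoly]
  refine Finset.measurable_fun_sum _ fun k _ => ?_
  have := hmeas (N j + k)
  fun_prop

/-! ### Scaling of zeros -/

/-- The zeros of p(z / c) are c times those of p. -/
lemma scale_zeroMeasure {c : ℝ} (hc : c ≠ 0) (p : Polynomial ℂ) :
    scale c (zeroMeasure p) =
      zeroMeasure (p.comp (Polynomial.C ((c⁻¹ : ℝ) : ℂ) * Polynomial.X)) := by
  have hc' : (c : ℂ) ≠ 0 := by exact_mod_cast hc
  have hu : IsUnit ((c⁻¹ : ℝ) : ℂ) := by
    rw [isUnit_iff_ne_zero]; exact_mod_cast inv_ne_zero hc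
  have h := p.map_roots_comp_C_mul_X_add_C _ 0 hu
  simp only [map_zero, add_zero] at h
  unfold scale zeroMeasure
  rw [← h]
  generalize (p.comp (Polynomial.C ((c⁻¹ : ℝ) : ℂ) * Polynomial.X)).roots = s
  have hm : Measurable (fun z : ℂ => (c : ℂ) * z) := by fun_prop
  rw [← Measure.mapₗ_apply_of_measurable hm, map_multiset_sum, Multiset.map_map, Multiset.map_map]
  congr 1
  refine Multiset.map_congr rfl fun z _ => ?_
  simp only [Function.comp, Measure.mapₗ_apply_of_measurable hm, Measure.map_dirac' hm]
  congr 1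
  push_cast
  field_simp

lemma comp_C_one_mul_X (p : Polynomial ℂ) :
    p.comp (Polynomial.C ((1 : ℝ) : ℂ) * Polynomial.X) = p := by simp

lemma ConvInProb.congr {Ω : Type*} [MeasurableSpace Ω] {P : Measure Ω}
    {ν ν' : ℕ → Ω → Measure ℂ} {μ : Measure ℂ} (h : ConvInProb P ν μ)
    (he : ∀ᶠ j in atTop, ∀ ω, ν j ω = ν' j ω) : ConvInProb P ν' μ := by
  intro φ hφ hc
  refine (h φ hφ hc).congr' ?_ (ae_of_all _ fun _ => rfl)
  filter_upwards [he] with j hj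
  exact ae_of_all _ fun ω => by simp only [hj ω]

section

variable {Ω : Type*} [MeasurableSpace Ω] {P : Measure Ω}
    [IsProbabilityMeasure P] {ξ : ℕ → Ω → ℂ}

lemma tendsto_degree_div {n N : ℕ → ℕ} {a : ℝ} (hN : ∀ j, N j ≤ n j)
    (hn : Tendsto n atTop atTop) (ha : Tendsto (fun j => (N j : ℝ) / n j) atTop (𝓝 a)) :
    Tendsto (fun j => ((n j - N j : ℕ) : ℝ) / n j) atTop (𝓝 (1 - a)) := by
  refine (ha.const_sub 1).congr' ?_
  filter_upwards [hn.eventually_gt_atTop 0] with j hj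
  have hn : (0 : ℝ) < n j := by exact_mod_cast hj
  rw [Nat.cast_sub (hN j)]
  field_simp

/-- No rescaling is made, so β is the limit 1 / (1 - a) of n / D; in particular D tends to infinity.
-/
lemma convInProb_derivZeros (hmeas : ∀ k, Measurable (ξ k))
    (hindep : iIndepFun ξ P) (hident : ∀ k, IdentDistrib (ξ k) (ξ 0) P P)
    (hnondeg : ¬ ∃ c : ℂ, ∀ᵐ ω ∂P, ξ 0 ω = c)
    (hlog : Integrable (fun ω => Real.log (1 + ‖ξ 0 ω‖)) P)
    {N : ℕ → ℕ} (hN : ∀ n, N n ≤ n) {a : ℝ} (ha0 : 0 ≤ a) (ha1 : a < 1)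
    (ha : Tendsto (fun n => (N n : ℝ) / n) atTop (𝓝 a)) :
    ConvInProb P (fun n ω => ((n - N n : ℕ) : ℝ≥0∞)⁻¹ • derivZeros ξ n (N n) ω)
      (radialLaw (radialQuantile a (1 - a)⁻¹)) := by
  have h1a : 0 < 1 - a := sub_pos.2 ha1
  have hDn : Tendsto (fun n => ((n - N n : ℕ) : ℝ) / n) atTop (𝓝 (1 - a)) :=
    tendsto_degree_div hN tendsto_id ha
  have hD : Tendsto (fun n => n - N n) atTop atTop := by
    rw [← tendsto_natCast_atTop_iff (R := ℝ)]
    refine (hDn.pos_mul_atTop h1a tendsto_natCast_atTop_atTop).congr' ?_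
    filter_upwards [eventually_gt_atTop 0] with n hn
    have : (0 : ℝ) < n := by exact_mod_cast hn
    field_simp
  have h := convInProb_derivative_ellipticPoly hmeas hindep hident hnondeg hlog
    (n := fun n => n) (N := N) (h := fun _ => 1) (fun _ => one_pos) hN hD ha0 ha1.le ha
    (inv_pos.2 h1a) (by simpa using hDn.inv₀ h1a.ne')
  simpa only [comp_C_one_mul_X, derivZeros] using h

lemma convInProb_scale_derivZeros (hmeas : ∀ k, Measurable (ξ k))
    (hindep : iIndepFun ξ P) (hident : ∀ k, IdentDistrib (ξ k) (ξ 0) P P)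
    (hnondeg : ¬ ∃ c : ℂ, ∀ᵐ ω ∂P, ξ 0 ω = c)
    (hlog : Integrable (fun ω => Real.log (1 + ‖ξ 0 ω‖)) P)
    {n N : ℕ → ℕ} (hN : ∀ j, N j ≤ n j) (ha : Tendsto (fun j => (N j : ℝ) / n j) atTop (𝓝 1))
    (hD : Tendsto (fun j => n j - N j) atTop atTop) :
    ConvInProb P (fun j ω => ((n j - N j : ℕ) : ℝ≥0∞)⁻¹ •
      scale √((n j : ℝ) / ((n j - N j : ℕ) : ℝ)) (derivZeros ξ (n j) (N j) ω))
      (radialLaw (radialQuantile 1 1)) := by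
  classical
  -- With h² = D / n the parameter β is 1. The value 1 for D = 0 only keeps h positive and
  -- eventually does not occur.
  set h : ℕ → ℝ := fun j => if 0 < n j - N j then (√((n j : ℝ) / ((n j - N j : ℕ) : ℝ)))⁻¹ else 1
    with hh
  have hpos : ∀ j, 0 < n j - N j → 0 < (n j : ℝ) / ((n j - N j : ℕ) : ℝ) := by
    intro j hj
    have h1 : (0 : ℝ) < n j := by exact_mod_cast (by omega : 0 < n j)
    have h2 : (0 : ℝ) < ((n j - N j : ℕ) : ℝ) := by exact_mod_cast hj
    positivity
  have h0 : ∀ j, 0 < h j := by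
    intro j
    simp only [hh]
    split_ifs with hj
    · exact inv_pos.2 (Real.sqrt_pos.2 (hpos j hj))
    · exact one_pos
  have key := convInProb_derivative_ellipticPoly hmeas hindep hident hnondeg hlog
    (n := n) (N := N) (h := h) h0 hN hD zero_le_one le_rfl ha one_pos (by
      refine tendsto_const_nhds.congr' ?_
      filter_upwards [hD.eventually_gt_atTop 0] with j hj
      have := hpos j hj
      simp only [hh, if_pos hj]
      rw [inv_pow, Real.sq_sqrt this.le, inv_mul_cancel₀ this.ne'])
  refine key.congr ?_
  filter_upwards [hD.eventually_gt_atTop 0] with j hj ω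
  rw [derivZeros, scale_zeroMeasure (Real.sqrt_pos.2 (hpos j hj)).ne']
  simp only [hh, if_pos hj]

lemma radialCDF_one_sq {r : ℝ} (hr : 0 < r) :
    radialCDF 1 (1 * r ^ 2) = r * (√(4 + r ^ 2) - r) / 2 := by
  have h : √((1 * r ^ 2) ^ 2 + 4 * 1 * (1 * r ^ 2)) = r * √(4 + r ^ 2) := by
    rw [show (1 * r ^ 2) ^ 2 + 4 * 1 * (1 * r ^ 2) = r ^ 2 * (4 + r ^ 2) by ring,
      Real.sqrt_mul (sq_nonneg r), Real.sqrt_sq hr.le]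
  rw [radialCDF, h]
  ring

end

/-! ### Derivatives of bounded degree -/

lemma roots_coeffPoly_zero (c : ℕ → ℂ) : (coeffPoly c 0).roots = 0 := by
  rw [Polynomial.eq_C_of_natDegree_le_zero (natDegree_coeffPoly_le c 0), Polynomial.roots_C]

/-- Continuity of zeros in the coefficients, again through potentials: away from the zeros of the
limit q, log |p_j| converges to log |q|. The nonvanishing top coefficient guarantees q ≠ 0. -/
lemma tendsto_sum_roots_coeffPoly {φ : ℂ → ℝ} (hφ : ContDiff ℝ ((⊤ : ℕ∞) : WithTop ℕ∞) φ)
    (hc : HasCompactSupport φ) {m : ℕ} {x : ℕ → ℂ} (hx : x m ≠ 0) {c : ℕ → ℕ → ℝ} {b : ℕ → ℝ}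
    (hb : b m ≠ 0) (hlim : ∀ k ≤ m, Tendsto (fun j => c j k) atTop (𝓝 (b k))) :
    Tendsto (fun j => ((coeffPoly (fun k => x k * (c j k : ℂ)) m).roots.map φ).sum) atTop
      (𝓝 (((coeffPoly (fun k => x k * (b k : ℂ)) m).roots.map φ).sum)) := by
  -- The potentials are divided by m, so constants, which have no roots, are treated apart.
  rcases Nat.eq_zero_or_pos m with rfl | hm
  · simp [roots_coeffPoly_zero]
  obtain ⟨R, hR⟩ := exists_ball_of_hasCompactSupport hc
  set q := coeffPoly (fun k => x k * (b k : ℂ)) m with hq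
  have hq0 : q ≠ 0 := by
    intro h
    have := congrArg (fun p => p.coeff m) h
    simp [hq, coeff_coeffPoly, hx, hb] at this
  have hm' : (m : ℝ) ≠ 0 := by exact_mod_cast hm.ne'
  have hae : ∀ᵐ z : ℂ, q.eval z ≠ 0 := by
    have h : (volume : Measure ℂ) (q.roots.toFinset : Set ℂ) = 0 :=
      (Finset.countable_toSet _).measure_zero _
    filter_upwards [measure_eq_zero_iff_ae_notMem.1 h] with z hz
    simpa [hq0] using hz
  have h := tendsto_sum_roots hφ hc hR (p := fun j => coeffPoly (fun k => x k * (c j k : ℂ)) m)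
    (d := fun _ => m) (fun j => natDegree_coeffPoly_le _ _) (κ := fun _ => 0)
    (V := fun z => (m : ℝ)⁻¹ * Real.log ‖q.eval z‖) (by
      refine ae_restrict_of_ae ?_
      filter_upwards [hae] with z hz
      simp only [sub_zero]
      refine Tendsto.const_mul _ (Tendsto.log (Tendsto.norm ?_) (norm_ne_zero_iff.2 hz))
      simp only [hq, eval_coeffPoly]
      refine tendsto_finsetSum _ fun k hk => Tendsto.mul_const _ (Tendsto.const_mul _ ?_)
      exact (Complex.continuous_ofReal.tendsto _).comp
        (hlim k (Nat.lt_succ_iff.1 (Finset.mem_range.1 hk))))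
  have h2 := h.const_mul (m : ℝ)
  simp only [mul_assoc, integral_const_mul, ← (sum_roots_eq_integral hφ hc q).2] at h2
  have hpi := Real.pi_ne_zero
  convert! h2 using 2
  · field_simp
  · field_simp

lemma roots_coeffPoly_div (x : ℕ → ℂ) (c : ℕ → ℝ) {b : ℝ} (hb : b ≠ 0) (m : ℕ) :
    (coeffPoly (fun k => x k * ((c k / b : ℝ) : ℂ)) m).roots =
      (coeffPoly (fun k => x k * (c k : ℂ)) m).roots := by
  have hb' : (b : ℂ) ≠ 0 := by exact_mod_cast hb
  rw [← Polynomial.roots_C_mul (coeffPoly (fun k => x k * ((c k / b : ℝ) : ℂ)) m) hb']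
  congr 1
  ext k
  rw [Polynomial.coeff_C_mul, coeff_coeffPoly, coeff_coeffPoly]
  split_ifs
  · push_cast
    field_simp
  · simp

/-- Induction on k through the ratio of consecutive weights: N + k + 1 is asymptotic to n, which one
factor n^{-1/2} per step cancels. -/
lemma tendsto_ellipticWeight_div {n N : ℕ → ℕ} {m : ℕ} (hN : ∀ j, N j ≤ n j)
    (hn : Tendsto n atTop atTop) (hm : ∀ᶠ j in atTop, n j - N j = m) {k : ℕ} (hk : k ≤ m) :
    Tendsto (fun j => ellipticWeight (n j) (N j) k * (√(n j))⁻¹ ^ k / ellipticWeight (n j) (N j) 0)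
      atTop (𝓝 (√(m.factorial : ℝ) / (k.factorial * √((m - k).factorial : ℝ)))) := by
  induction k with
  | zero =>
    have h : √(m.factorial : ℝ) ≠ 0 := by positivity
    simp only [Nat.factorial_zero, Nat.cast_one, one_mul, Nat.sub_zero, div_self h]
    refine tendsto_const_nhds.congr fun j => ?_
    have := ellipticWeight_pos (hN j) (Nat.zero_le _)
    rw [pow_zero, mul_one, div_self this.ne']
  | succ k ih =>
    have hkm : (k : ℝ) < m := by exact_mod_cast hk
    have h1 : Tendsto (fun j => ((N j : ℝ) + k + 1) / n j) atTop (𝓝 1) := by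
      have hnr : Tendsto (fun j => (n j : ℝ)) atTop atTop := tendsto_natCast_atTop_atTop.comp hn
      have h2 : Tendsto (fun j => 1 + ((k : ℝ) + 1 - m) / n j) atTop (𝓝 (1 + 0)) :=
        (hnr.const_div_atTop _).const_add 1
      rw [add_zero] at h2
      refine h2.congr' ?_
      filter_upwards [hm, hn.eventually_gt_atTop 0] with j hj hj0
      have : (0 : ℝ) < n j := by exact_mod_cast hj0
      have h3 : (n j : ℝ) = N j + m := by
        have := hN j
        exact_mod_cast (by omega : n j = N j + m)
      rw [eq_div_iff this.ne', add_mul, div_mul_cancel₀ _ this.ne', h3]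
      ring
    have h2 := (ih (by omega)).mul ((h1.mul_const (((m : ℝ) - k) / (k + 1) ^ 2)).sqrt)
    have hlim : √(m.factorial : ℝ) / (k.factorial * √((m - k).factorial : ℝ)) *
        √(1 * (((m : ℝ) - k) / (k + 1) ^ 2)) =
        √(m.factorial : ℝ) / ((k + 1).factorial * √((m - (k + 1)).factorial : ℝ)) := by
      have e1 : (m - k).factorial = (m - k) * (m - (k + 1)).factorial := by
        rw [show m - k = (m - (k + 1)) + 1 by omega, Nat.factorial_succ]
      have e2 : ((m - k : ℕ) : ℝ) = m - k := Nat.cast_sub (by omega)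
      have hp : 0 < √((m : ℝ) - k) := Real.sqrt_pos.2 (by linarith)
      rw [e1, Nat.factorial_succ]
      push_cast
      rw [e2, Real.sqrt_mul (by linarith), one_mul, Real.sqrt_div (by linarith),
        Real.sqrt_sq (by positivity)]
      field_simp
    rw [hlim] at h2
    refine h2.congr' ?_
    filter_upwards [hm, hn.eventually_gt_atTop 0] with j hj hj0
    have hnj : (0 : ℝ) < n j := by exact_mod_cast hj0
    have hkj : k < n j - N j := by omega
    have hr := ellipticWeight_ratio hkj
    have hw := ellipticWeight_pos (hN j) hkj.le
    have hw0 := ellipticWeight_pos (hN j) (Nat.zero_le _)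
    rw [div_eq_iff hw.ne', hj] at hr
    have hs : √(((N j : ℝ) + k + 1) / (k + 1) * (((m : ℝ) - k) / (k + 1))) * (√(n j : ℝ))⁻¹ =
        √(((N j : ℝ) + k + 1) / n j * (((m : ℝ) - k) / (k + 1) ^ 2)) := by
      rw [← Real.sqrt_inv, ← Real.sqrt_mul']
      · congr 1
        field_simp
      · positivity
    rw [← hs, hr, pow_succ]
    ring

section

variable {Ω : Type*}

lemma derivZeros_eq_coeffPoly (ξ : ℕ → Ω → ℂ) {n N : ℕ} (hN : N ≤ n) (ω : Ω) :
    derivZeros ξ n N ω = zeroMeasure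
      (coeffPoly (fun k => ξ (N + k) ω * (ellipticWeight n N k : ℂ)) (n - N)) := by
  have h := iterate_derivative_ellipticPoly_comp ξ hN 1 ω
  rw [comp_C_one_mul_X] at h
  simp only [derivZeros, h, one_pow, mul_one]

lemma scale_derivZeros_eq_coeffPoly (ξ : ℕ → Ω → ℂ) {n N : ℕ} (hn : 0 < n) (hN : N ≤ n) (ω : Ω) :
    scale √(n : ℝ) (derivZeros ξ n N ω) = zeroMeasure (coeffPoly
      (fun k => ξ (N + k) ω * ((ellipticWeight n N k * (√(n : ℝ))⁻¹ ^ k : ℝ) : ℂ)) (n - N)) := by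
  have hs : √(n : ℝ) ≠ 0 := by positivity
  rw [derivZeros, scale_zeroMeasure hs, iterate_derivative_ellipticPoly_comp ξ hN]

variable [MeasurableSpace Ω] {P : Measure Ω} {ξ : ℕ → Ω → ℂ}

lemma measurable_sum_roots_coeffPoly (hmeas : ∀ k, Measurable (ξ k)) (c : ℕ → ℝ) (m : ℕ) {φ : ℂ → ℝ}
    (hφ : ContDiff ℝ ((⊤ : ℕ∞) : WithTop ℕ∞) φ) (hc : HasCompactSupport φ) :
    Measurable (fun ω => ((coeffPoly (fun k => ξ k ω * (c k : ℂ)) m).roots.map φ).sum) := by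
  refine measurable_sum_roots ?_ hφ hc
  simp only [eval_coeffPoly]
  refine Finset.measurable_fun_sum _ fun k _ => ?_
  have := hmeas k
  fun_prop

/-- Shifting an i.i.d. sequence preserves its law. The coefficients can therefore be taken from a
fixed window of variables, where almost sure convergence is available. -/
lemma identDistrib_sum_roots_coeffPoly (hindep : iIndepFun ξ P)
    (hident : ∀ k, IdentDistrib (ξ k) (ξ 0) P P) (N m : ℕ) (c : ℕ → ℝ) {φ : ℂ → ℝ}
    (hφ : ContDiff ℝ ((⊤ : ℕ∞) : WithTop ℕ∞) φ) (hc : HasCompactSupport φ) :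
    IdentDistrib
      (fun ω => ((coeffPoly (fun k => ξ (N + k) ω * (c k : ℂ)) m).roots.map φ).sum)
      (fun ω => ((coeffPoly (fun k => ξ k ω * (c k : ℂ)) m).roots.map φ).sum) P P := by
  have h : IdentDistrib (fun ω k => ξ (N + k) ω) (fun ω k => ξ k ω) P P :=
    IdentDistrib.pi (fun k => (hident (N + k)).trans (hident k).symm)
      (hindep.precomp (add_right_injective N)) hindep
  exact h.comp (measurable_sum_roots_coeffPoly (ξ := fun k (x : ℕ → ℂ) => x k)
    (fun k => measurable_pi_apply k) c m hφ hc)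

lemma ae_coeff_ne_zero (hident : ∀ k, IdentDistrib (ξ k) (ξ 0) P P)
    (hzero : P {ω | ξ 0 ω = 0} = 0) (k : ℕ) : ∀ᵐ ω ∂P, ξ k ω ≠ 0 := by
  have h := (hident k).measure_mem_eq (measurableSet_singleton (0 : ℂ))
  have h2 : P (ξ k ⁻¹' {0}) = 0 := h.trans hzero
  exact measure_eq_zero_iff_ae_notMem.1 h2

/-- With ξ_k in place of ξ_{N+k} the linear statistics converge almost surely, hence in
distribution; equality of laws carries this back. The weights used differ from those of `limitPoly`
by the factor √(m!), which does not move the zeros. -/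
theorem convInDistr_scale_derivZeros [IsProbabilityMeasure P] (hmeas : ∀ k, Measurable (ξ k))
    (hindep : iIndepFun ξ P) (hident : ∀ k, IdentDistrib (ξ k) (ξ 0) P P)
    (hzero : P {ω | ξ 0 ω = 0} = 0) {N : ℕ → ℕ} (hN : ∀ n, N n ≤ n) {m : ℕ}
    (hm : ∀ᶠ n in atTop, n - N n = m) :
    ConvInDistr P (fun n ω => scale √(n : ℝ) (derivZeros ξ n (N n) ω))
      (fun ω => zeroMeasure (limitPoly ξ m ω)) := by
  intro φ hφ hc
  set c : ℕ → ℕ → ℝ := fun n k =>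
    ellipticWeight n (N n) k * (√(n : ℝ))⁻¹ ^ k / ellipticWeight n (N n) 0 with hcdef
  set b : ℕ → ℝ := fun k => √(m.factorial : ℝ) / (k.factorial * √((m - k).factorial : ℝ)) with hb
  have hm0 : (√(m.factorial : ℝ))⁻¹ ≠ 0 := by positivity
  have hZ : TendstoInDistribution
      (fun n ω => ((coeffPoly (fun k => ξ k ω * (c n k : ℂ)) m).roots.map φ).sum) atTop
      (fun ω => ((coeffPoly (fun k => ξ k ω * (b k : ℂ)) m).roots.map φ).sum) (fun _ => P) P := by
    refine tendstoInDistribution_of_ae_tendsto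
      (fun n => (measurable_sum_roots_coeffPoly hmeas _ m hφ hc).aemeasurable)
      (measurable_sum_roots_coeffPoly hmeas _ m hφ hc).aemeasurable ?_
    filter_upwards [ae_coeff_ne_zero hident hzero m] with ω hω
    refine tendsto_sum_roots_coeffPoly hφ hc hω ?_ fun k hk =>
      tendsto_ellipticWeight_div (n := fun n => n) hN tendsto_id hm hk
    simp only [hb]
    positivity
  have hlimit : (fun ω => ∫ z, φ z ∂(zeroMeasure (limitPoly ξ m ω))) =
      fun ω => ((coeffPoly (fun k => ξ k ω * (b k : ℂ)) m).roots.map φ).sum := by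
    ext ω
    have : limitPoly ξ m ω = coeffPoly (fun k => ξ k ω *
        ((1 / (k.factorial * √((m - k).factorial : ℝ)) : ℝ) : ℂ)) m := by
      simp [limitPoly, coeffPoly, div_eq_mul_inv]
    rw [(integral_zeroMeasure _ φ).2, this, ← roots_coeffPoly_div (b := (√(m.factorial : ℝ))⁻¹)
      (fun k => ξ k ω) _ hm0]
    simp only [hb]
    congr 5
    ext k
    congr 2
    field_simp
  have hX : ∀ᶠ n : ℕ in atTop, (fun ω => ∫ z, φ z ∂(scale √(n : ℝ) (derivZeros ξ n (N n) ω))) =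
      fun ω => ((coeffPoly (fun k => ξ (N n + k) ω * (c n k : ℂ)) m).roots.map φ).sum := by
    filter_upwards [hm, eventually_gt_atTop 0] with n hn hn0
    ext ω
    have hw := ellipticWeight_pos (hN n) (Nat.zero_le _)
    rw [scale_derivZeros_eq_coeffPoly ξ hn0 (hN n), (integral_zeroMeasure _ φ).2, hn]
    simp only [hcdef]
    rw [roots_coeffPoly_div (fun k => ξ (N n + k) ω) _ hw.ne']
  have hXm : ∀ n : ℕ, AEMeasurable
      (fun ω => ∫ z, φ z ∂(scale √(n : ℝ) (derivZeros ξ n (N n) ω))) P := by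
    intro n
    -- At n = 0 the scaling factor is 0 and not invertible, but there are no zeros to scale.
    rcases Nat.eq_zero_or_pos n with rfl | hn0
    · have h0 : ∀ ω, derivZeros ξ 0 (N 0) ω = 0 := by
        intro ω
        have : N 0 = 0 := Nat.le_zero.1 (hN 0)
        rw [this, derivZeros_eq_coeffPoly ξ le_rfl]
        simp [zeroMeasure, roots_coeffPoly_zero]
      simp only [h0, scale, Measure.map_zero, integral_zero_measure]
      exact aemeasurable_const
    · simp only [scale_derivZeros_eq_coeffPoly ξ hn0 (hN n), (integral_zeroMeasure _ φ).2]
      exact (measurable_sum_roots_coeffPoly (ξ := fun k => ξ (N n + k))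
        (fun k => hmeas _) _ _ hφ hc).aemeasurable
  rw [hlimit]
  refine ⟨hXm, hZ.aemeasurable_limit, hZ.tendsto.congr' ?_⟩
  filter_upwards [hX] with n hn
  refine Subtype.ext ?_
  simp only [hn]
  exact (identDistrib_sum_roots_coeffPoly hindep hident (N n) m (c n) hφ hc).map_eq.symm

end

/-! ### Concentration of the zeros at the origin -/

lemma abs_multiset_sum_map_le {α : Type*} (s : Multiset α) {f g : α → ℝ} (h : ∀ x, |f x| ≤ g x) :
    |(s.map f).sum| ≤ (s.map g).sum := by
  induction s using Multiset.induction with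
  | empty => simp
  | cons a s ih =>
    simp only [Multiset.map_cons, Multiset.sum_cons]
    exact (abs_add_le _ _).trans (add_le_add (h a) ih)

lemma exists_contDiffBump_integral_gt (μ : Measure ℂ) [IsProbabilityMeasure μ] {δ : ℝ}
    (hδ : 0 < δ) : ∃ χ : ContDiffBump (0 : ℂ), 1 - δ < ∫ z, χ z ∂μ := by
  have h : Tendsto (fun n : ℕ => μ.real (Metric.closedBall (0 : ℂ) n)) atTop (𝓝 1) := by
    have h1 := tendsto_measure_iUnion_atTop (μ := μ)
      (s := fun n : ℕ => Metric.closedBall (0 : ℂ) n)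
      (fun i j hij => Metric.closedBall_subset_closedBall (by exact_mod_cast hij))
    rw [Metric.iUnion_closedBall_nat, measure_univ] at h1
    exact (ENNReal.tendsto_toReal ENNReal.one_ne_top).comp h1
  obtain ⟨n, hn, hn0⟩ := ((h.eventually_const_lt (show 1 - δ < 1 by linarith)).and
    (eventually_gt_atTop 0)).exists
  have hn' : (0 : ℝ) < n := by exact_mod_cast hn0
  let χ : ContDiffBump (0 : ℂ) := ⟨n, n + 1, hn', by linarith⟩
  refine ⟨χ, hn.trans_le ?_⟩
  rw [← integral_indicator_one Metric.isClosed_closedBall.measurableSet]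
  refine integral_mono ((integrable_const (1 : ℝ)).indicator
    Metric.isClosed_closedBall.measurableSet)
    (χ.continuous.integrable_of_hasCompactSupport χ.hasCompactSupport) fun z => ?_
  by_cases hz : z ∈ Metric.closedBall (0 : ℂ) n
  · simp [Set.indicator_of_mem hz, χ.one_of_mem_closedBall hz]
  · simp [Set.indicator_of_notMem hz, χ.nonneg]

lemma integral_smul_scale_zeroMeasure (p : Polynomial ℂ) {φ : ℂ → ℝ} (hφ : Continuous φ) (c : ℝ)
    (d : ℕ) : ∫ z, φ z ∂((d : ℝ≥0∞)⁻¹ • scale c (zeroMeasure p)) =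
      (d : ℝ)⁻¹ * (p.roots.map fun z => φ (c * z)).sum := by
  have hm : Measurable (fun z : ℂ => (c : ℂ) * z) := by fun_prop
  rw [integral_smul_measure, scale, integral_map hm.aemeasurable hφ.aestronglyMeasurable,
    (integral_zeroMeasure p _).2]
  simp

/-- If zeros magnified by a factor tending to infinity have a limiting probability distribution,
then the zeros concentrate at the origin. -/
theorem convInProb_dirac_of_scale {Ω : Type*} [MeasurableSpace Ω] {P : Measure Ω}
    [IsProbabilityMeasure P] {p : ℕ → Ω → Polynomial ℂ} {d : ℕ → ℕ} {s : ℕ → ℝ}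
    (hs : Tendsto s atTop atTop) (hd : ∀ᶠ j in atTop, 0 < d j)
    (hcard : ∀ j, ∀ᵐ ω ∂P, (p j ω).roots.card = d j) {μ : Measure ℂ} [IsProbabilityMeasure μ]
    (h : ConvInProb P (fun j ω => (d j : ℝ≥0∞)⁻¹ • scale (s j) (zeroMeasure (p j ω))) μ) :
    ConvInProb P (fun j ω => (d j : ℝ≥0∞)⁻¹ • zeroMeasure (p j ω)) (Measure.dirac 0) := by
  intro φ hφ hc
  simp only [integral_smul_zeroMeasure, integral_dirac]
  rw [tendstoInMeasure_iff_norm]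
  intro ε hε
  obtain ⟨M, hM⟩ := hφ.continuous.bounded_above_of_compact_support hc
  have hM0 : 0 ≤ M := (norm_nonneg _).trans (hM 0)
  -- Small enough for 4Mδ < ε/2: at most 2δ of the mass of the magnified zeros will be missed, each
  -- at cost at most 2M.
  set δ := ε / (8 * (M + 1)) with hδdef
  have hδ : 0 < δ := by positivity
  have hMδ : 4 * M * δ < ε / 2 := by
    rw [hδdef, mul_div_assoc', div_lt_div_iff₀ (by positivity) (by positivity)]
    nlinarith
  obtain ⟨χ, hχ⟩ := exists_contDiffBump_integral_gt μ hδ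
  have hχc : Tendsto _ _ _ := tendstoInMeasure_iff_norm.1 (h χ χ.contDiff χ.hasCompactSupport) δ hδ
  simp only [integral_smul_scale_zeroMeasure _ χ.continuous] at hχc
  obtain ⟨ρ, hρ, hφρ⟩ := Metric.continuousAt_iff.1 hφ.continuous.continuousAt (ε / 2) (half_pos hε)
  refine tendsto_of_tendsto_of_tendsto_of_le_of_le' tendsto_const_nhds hχc
    (Eventually.of_forall fun _ => bot_le) ?_
  filter_upwards [hd, hs.eventually_gt_atTop (χ.rOut / ρ), hs.eventually_gt_atTop 0]
    with j hdj hsj hsj0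
  have hdr : (0 : ℝ) < d j := by exact_mod_cast hdj
  refine measure_mono_ae ?_
  filter_upwards [hcard j] with ω hω hmem
  have hmem' : ε ≤ ‖(d j : ℝ)⁻¹ * ((p j ω).roots.map φ).sum - φ 0‖ := hmem
  -- The bad event for φ is contained in the bad event for the cutoff χ: otherwise the average of χ
  -- over the magnified zeros exceeds 1 - 2δ, so nearly all zeros lie close to 0.
  show δ ≤ ‖(d j : ℝ)⁻¹ * ((p j ω).roots.map fun z => χ (s j * z)).sum - ∫ z, χ z ∂μ‖
  by_contra hlt
  rw [not_le, Real.norm_eq_abs] at hlt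
  have hlow := (abs_lt.1 hlt).1
  -- Near 0 continuity of φ is used; at distance at least ρ the magnified point is outside the
  -- support of χ, and the trivial bound 2M applies.
  have hpt : ∀ z, |φ z - φ 0| ≤ ε / 2 + 2 * M * (1 - χ (s j * z)) := by
    intro z
    by_cases hz : ‖z‖ < ρ
    · have h1 := hφρ (show dist z 0 < ρ by simpa using hz)
      rw [Real.dist_eq] at h1
      have h2 : 0 ≤ 2 * M * (1 - χ (s j * z)) :=
        mul_nonneg (by positivity) (sub_nonneg.2 χ.le_one)
      linarith
    · have h1 : χ (s j * z) = 0 := by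
        refine χ.zero_of_le_dist ?_
        rw [div_lt_iff₀ hρ] at hsj
        rw [dist_zero_right, norm_mul, Complex.norm_real, Real.norm_of_nonneg hsj0.le]
        nlinarith [not_lt.1 hz]
      have h2 := hM z
      have h3 := hM 0
      rw [Real.norm_eq_abs] at h2 h3
      rw [h1]
      linarith [abs_sub (φ z) (φ 0)]
  have hsum := abs_multiset_sum_map_le (p j ω).roots hpt
  simp only [Multiset.sum_map_sub, Multiset.sum_map_add, Multiset.sum_map_mul_left,
    Multiset.map_const', Multiset.sum_replicate, hω, nsmul_eq_mul, mul_one] at hsum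
  have h1 : (d j : ℝ)⁻¹ * ((p j ω).roots.map φ).sum - φ 0 =
      (d j : ℝ)⁻¹ * (((p j ω).roots.map φ).sum - d j * φ 0) := by field_simp
  rw [h1, Real.norm_eq_abs, abs_mul, abs_of_pos (inv_pos.2 hdr)] at hmem'
  have h2 := hmem'.trans (mul_le_mul_of_nonneg_left hsum (inv_pos.2 hdr).le)
  have h3 : (d j : ℝ)⁻¹ * (d j * (ε / 2) + 2 * M *
      (d j - ((p j ω).roots.map fun z => χ (s j * z)).sum)) = ε / 2 + 2 * M *
      (1 - (d j : ℝ)⁻¹ * ((p j ω).roots.map fun z => χ (s j * z)).sum) := by field_simp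
  rw [h3] at h2
  nlinarith

section

variable {Ω : Type*} [MeasurableSpace Ω] {P : Measure Ω} {ξ : ℕ → Ω → ℂ}

/-- The top coefficient is a positive multiple of ξ_n, which is almost surely nonzero. With the full
number of zeros, none can be missing from the mass balance at the origin. -/
lemma card_roots_derivative_ellipticPoly (hident : ∀ k, IdentDistrib (ξ k) (ξ 0) P P)
    (hzero : P {ω | ξ 0 ω = 0} = 0) {n N : ℕ} (hN : N ≤ n) :
    ∀ᵐ ω ∂P, (Polynomial.derivative^[N] (ellipticPoly ξ n ω)).roots.card = n - N := by
  filter_upwards [ae_coeff_ne_zero hident hzero n] with ω hω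
  have h := iterate_derivative_ellipticPoly_comp ξ hN 1 ω
  rw [comp_C_one_mul_X] at h
  rw [← (IsAlgClosed.splits _).natDegree_eq_card_roots, h]
  refine Polynomial.natDegree_eq_of_le_of_coeff_ne_zero (natDegree_coeffPoly_le _ _) ?_
  have := (ellipticWeight_pos hN le_rfl).ne'
  rw [coeff_coeffPoly, if_pos le_rfl, Nat.add_sub_cancel' hN]
  simpa [hω] using this

variable [IsProbabilityMeasure P]

lemma convInProb_dirac_of_tendsto_degree (hmeas : ∀ k, Measurable (ξ k))
    (hindep : iIndepFun ξ P) (hident : ∀ k, IdentDistrib (ξ k) (ξ 0) P P)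
    (hnondeg : ¬ ∃ c : ℂ, ∀ᵐ ω ∂P, ξ 0 ω = c) (hzero : P {ω | ξ 0 ω = 0} = 0)
    (hlog : Integrable (fun ω => Real.log (1 + ‖ξ 0 ω‖)) P)
    {n N : ℕ → ℕ} (hN : ∀ j, N j ≤ n j) (hn : Tendsto n atTop atTop)
    (ha : Tendsto (fun j => (N j : ℝ) / n j) atTop (𝓝 1))
    (hD : Tendsto (fun j => n j - N j) atTop atTop) :
    ConvInProb P (fun j ω => ((n j - N j : ℕ) : ℝ≥0∞)⁻¹ • derivZeros ξ (n j) (N j) ω)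
      (Measure.dirac 0) := by
  have := isProbabilityMeasure_radialLaw (measurable_radialQuantile 1 1)
  refine convInProb_dirac_of_scale (d := fun j => n j - N j) ?_ (hD.eventually_gt_atTop 0)
    (fun j => card_roots_derivative_ellipticPoly hident hzero (hN j))
    (convInProb_scale_derivZeros hmeas hindep hident hnondeg hlog hN ha hD)
  refine Real.tendsto_sqrt_atTop.comp ?_
  have h := tendsto_degree_div hN hn ha
  rw [sub_self] at h
  have h2 : Tendsto (fun j => ((n j - N j : ℕ) : ℝ) / n j) atTop (𝓝[>] 0) := by
    refine tendsto_nhdsWithin_iff.2 ⟨h, ?_⟩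
    filter_upwards [hn.eventually_gt_atTop 0, hD.eventually_gt_atTop 0] with j hj hj'
    have h1 : (0 : ℝ) < n j := by exact_mod_cast hj
    have h2 : (0 : ℝ) < ((n j - N j : ℕ) : ℝ) := by exact_mod_cast hj'
    exact div_pos h2 h1
  refine (tendsto_inv_nhdsGT_zero.comp h2).congr fun j => ?_
  simp

/-- Undoing the scaling costs n^{-(m-k)/2} relative to the top term, so only the monomial z^m
survives in the limit. -/
lemma tendsto_ellipticWeight_div_last {n N : ℕ → ℕ} {m : ℕ} (hN : ∀ j, N j ≤ n j)
    (hn : Tendsto n atTop atTop) (hm : ∀ j, n j - N j = m) {k : ℕ} (hk : k ≤ m) :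
    Tendsto (fun j => ellipticWeight (n j) (N j) k / ellipticWeight (n j) (N j) m) atTop
      (𝓝 (if k = m then 1 else 0)) := by
  split_ifs with hkm
  · subst hkm
    refine tendsto_const_nhds.congr fun j => ?_
    rw [div_self (ellipticWeight_pos (hN j) (hm j).ge).ne']
  · have h1 := (tendsto_ellipticWeight_div hN hn (Eventually.of_forall hm) hk).div
      (tendsto_ellipticWeight_div hN hn (Eventually.of_forall hm) le_rfl) (by positivity)
    have hs : Tendsto (fun j => (√(n j : ℝ))⁻¹ ^ (m - k)) atTop (𝓝 0) := by
      have h2 : Tendsto (fun j => (√(n j : ℝ))⁻¹) atTop (𝓝 0) :=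
        tendsto_inv_atTop_zero.comp (Real.tendsto_sqrt_atTop.comp
          (tendsto_natCast_atTop_atTop.comp hn))
      simpa [show m - k ≠ 0 by omega] using h2.pow (m - k)
    have h3 := h1.mul hs
    rw [mul_zero] at h3
    refine h3.congr' ?_
    filter_upwards [hn.eventually_gt_atTop 0] with j hj
    have hnj : (0 : ℝ) < (√(n j : ℝ))⁻¹ := by positivity
    have hw := ellipticWeight_pos (hN j) (hm j).ge
    have hw0 := ellipticWeight_pos (hN j) (Nat.zero_le _)
    have hp : (√(n j : ℝ))⁻¹ ^ m = (√(n j : ℝ))⁻¹ ^ k * (√(n j : ℝ))⁻¹ ^ (m - k) := by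
      rw [← pow_add, Nat.add_sub_cancel' hk]
    simp only [Pi.div_apply, hp]
    generalize (√(n j : ℝ))⁻¹ = t at hnj
    field_simp

lemma convInProb_dirac_of_const_degree (hmeas : ∀ k, Measurable (ξ k))
    (hindep : iIndepFun ξ P) (hident : ∀ k, IdentDistrib (ξ k) (ξ 0) P P)
    (hzero : P {ω | ξ 0 ω = 0} = 0) {n N : ℕ → ℕ} {m : ℕ} (hm0 : 0 < m) (hN : ∀ j, N j ≤ n j)
    (hn : Tendsto n atTop atTop) (hm : ∀ j, n j - N j = m) :
    ConvInProb P (fun j ω => ((n j - N j : ℕ) : ℝ≥0∞)⁻¹ • derivZeros ξ (n j) (N j) ω)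
      (Measure.dirac 0) := by
  intro φ hφ hc
  have hm' : (m : ℝ) ≠ 0 := by exact_mod_cast hm0.ne'
  set c : ℕ → ℕ → ℝ := fun j k => ellipticWeight (n j) (N j) k / ellipticWeight (n j) (N j) m
    with hcdef
  have hX : ∀ j ω, ∫ z, φ z ∂(((n j - N j : ℕ) : ℝ≥0∞)⁻¹ • derivZeros ξ (n j) (N j) ω) =
      (m : ℝ)⁻¹ * ((coeffPoly (fun k => ξ (N j + k) ω * (c j k : ℂ)) m).roots.map φ).sum := by
    intro j ω
    have hw := ellipticWeight_pos (hN j) (hm j).ge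
    rw [derivZeros_eq_coeffPoly ξ (hN j), hm j, integral_smul_zeroMeasure]
    simp only [hcdef]
    rw [roots_coeffPoly_div (fun k => ξ (N j + k) ω) _ hw.ne']
  simp only [hX, integral_dirac]
  have hZ : TendstoInMeasure P (fun j ω => (m : ℝ)⁻¹ *
      ((coeffPoly (fun k => ξ k ω * (c j k : ℂ)) m).roots.map φ).sum) atTop (fun _ => φ 0) := by
    refine tendstoInMeasure_of_tendsto_ae (fun j =>
      ((measurable_sum_roots_coeffPoly hmeas _ m hφ hc).const_mul _).aestronglyMeasurable) ?_
    filter_upwards [ae_coeff_ne_zero hident hzero m] with ω hω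
    have h := (tendsto_sum_roots_coeffPoly hφ hc (x := fun k => ξ k ω) hω (c := c)
      (b := fun k => if k = m then 1 else 0) (by simp)
      (fun k hk => tendsto_ellipticWeight_div_last hN hn hm hk)).const_mul (m : ℝ)⁻¹
    have hq : coeffPoly (fun k => ξ k ω * (((if k = m then 1 else 0 : ℝ)) : ℂ)) m =
        Polynomial.C (ξ m ω) * Polynomial.X ^ m := by
      ext k
      rw [coeff_coeffPoly, Polynomial.coeff_C_mul, Polynomial.coeff_X_pow]
      rcases lt_trichotomy k m with hk | rfl | hk
      · simp [hk.ne, hk.le]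
      · simp
      · simp [hk.ne', hk.not_ge]
    rw [hq, Polynomial.roots_C_mul _ hω, Polynomial.roots_pow, Polynomial.roots_X] at h
    simpa [Multiset.map_nsmul, Multiset.sum_nsmul, inv_mul_cancel_left₀ hm'] using h
  -- Convergence in probability to a constant depends only on the individual laws, so the shifted
  -- coefficients can be restored.
  intro ε hε
  refine (hZ ε hε).congr fun j => ?_
  exact (((identDistrib_sum_roots_coeffPoly hindep hident (N j) m (c j) hφ hc).comp
    (measurable_const_mul (m : ℝ)⁻¹)).measure_mem_eq
    (s := {x | ε ≤ edist x (φ 0)}) (measurableSet_le measurable_const (by fun_prop))).symm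

theorem convInProb_dirac_derivZeros (hmeas : ∀ k, Measurable (ξ k))
    (hindep : iIndepFun ξ P) (hident : ∀ k, IdentDistrib (ξ k) (ξ 0) P P)
    (hnondeg : ¬ ∃ c : ℂ, ∀ᵐ ω ∂P, ξ 0 ω = c) (hzero : P {ω | ξ 0 ω = 0} = 0)
    (hlog : Integrable (fun ω => Real.log (1 + ‖ξ 0 ω‖)) P)
    {N : ℕ → ℕ} (hN : ∀ n, N n ≤ n) (ha : Tendsto (fun n => (N n : ℝ) / n) atTop (𝓝 1))
    (hpos : ∀ᶠ n in atTop, N n < n) :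
    ConvInProb P (fun n ω => ((n - N n : ℕ) : ℝ≥0∞)⁻¹ • derivZeros ξ n (N n) ω)
      (Measure.dirac 0) := by
  intro φ hφ hc ε hε
  refine tendsto_of_subseq_tendsto fun ns hns => ?_
  -- Either some value m of the degree recurs infinitely often, giving a subsequence of constant
  -- degree, or the degree tends to infinity. The hypothesis N < n excludes m = 0.
  by_cases hbdd : ∃ m, ∃ᶠ j in atTop, ns j - N (ns j) = m
  · obtain ⟨m, hm⟩ := hbdd
    obtain ⟨ms, hms, hmsm⟩ := extraction_of_frequently_atTop hm
    have hn := hns.comp hms.tendsto_atTop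
    have hm0 : 0 < m := by
      obtain ⟨j, hj⟩ := (hn.eventually hpos).exists
      have := hmsm j
      simp only [Function.comp] at hj
      omega
    exact ⟨ms, convInProb_dirac_of_const_degree hmeas hindep hident hzero hm0 (fun j => hN _) hn
      hmsm φ hφ hc ε hε⟩
  · have hD : Tendsto (fun j => ns j - N (ns j)) atTop atTop := by
      refine tendsto_atTop.2 fun b => ?_
      simp only [not_exists, not_frequently] at hbdd
      have : ∀ᶠ j in atTop, ∀ m ∈ Finset.range b, ns j - N (ns j) ≠ m :=
        (eventually_all_finset _).2 fun m _ => hbdd m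
      filter_upwards [this] with j hj
      by_contra hlt
      exact hj _ (Finset.mem_range.2 (not_le.1 hlt)) rfl
    exact ⟨id, convInProb_dirac_of_tendsto_degree hmeas hindep hident hnondeg hzero hlog
      (fun j => hN _) hns (ha.comp hns) hD φ hφ hc ε hε⟩

end

end

end RandomZeros

/-! ### Assembly of the regimes a = 0, 0 < a < 1 and a = 1. -/

theorem theorem6 {Ω : Type*} [MeasurableSpace Ω] (P : Measure Ω) [IsProbabilityMeasure P]
    (ξ : ℕ → Ω → ℂ) (hmeas : ∀ k, Measurable (ξ k)) (hindep : iIndepFun ξ P)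
    (hident : ∀ k, IdentDistrib (ξ k) (ξ 0) P P)
    (hnondeg : ¬ ∃ c : ℂ, ∀ᵐ ω ∂P, ξ 0 ω = c)
    (hzero : P {ω | ξ 0 ω = 0} = 0)
    (hlog : Integrable (fun ω => Real.log (1 + ‖ξ 0 ω‖)) P)
    (N : ℕ → ℕ) (hN : ∀ n, N n ≤ n) :
    (Tendsto (fun n => (N n : ℝ) / n) atTop (𝓝 0) →
      ∃ μ : Measure ℂ, IsProbabilityMeasure μ ∧ RandomZeros.RotInvariant μ ∧
        (∀ r : ℝ, 0 < r → RandomZeros.HasLeftDerivAt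
          (RandomZeros.legendreFenchel (fun t => -RandomZeros.logPE t))
          (μ.real (Metric.ball 0 r)) (Real.log r)) ∧
        RandomZeros.ConvInProb P
          (fun n ω => ((n - N n : ℕ) : ℝ≥0∞)⁻¹ • RandomZeros.derivZeros ξ n (N n) ω) μ ∧
        RandomZeros.ConvInProb P
          (fun n ω => (n : ℝ≥0∞)⁻¹ •
            RandomZeros.zeroMeasure (RandomZeros.ellipticPoly ξ n ω)) μ) ∧
    (∀ a ∈ Ioo (0 : ℝ) 1, Tendsto (fun n => (N n : ℝ) / n) atTop (𝓝 a) →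
      ∃ μ : Measure ℂ, IsProbabilityMeasure μ ∧ RandomZeros.RotInvariant μ ∧
        (∀ r : ℝ, 0 < r → ∃ d : ℝ, RandomZeros.HasLeftDerivAt
            (RandomZeros.legendreFenchel (fun t => -RandomZeros.logUE a t)) d (Real.log r) ∧
          μ.real (Metric.ball 0 r) = 1 / (1 - a) * d) ∧
        RandomZeros.ConvInProb P
          (fun n ω => ((n - N n : ℕ) : ℝ≥0∞)⁻¹ • RandomZeros.derivZeros ξ n (N n) ω) μ) ∧
    (Tendsto (fun n => (N n : ℝ) / n) atTop (𝓝 1) →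
      ((∀ᶠ n in atTop, N n < n) →
        RandomZeros.ConvInProb P
          (fun n ω => ((n - N n : ℕ) : ℝ≥0∞)⁻¹ • RandomZeros.derivZeros ξ n (N n) ω)
          (Measure.dirac 0)) ∧
      (Tendsto (fun n => n - N n) atTop atTop →
        ∃ μ : Measure ℂ, IsProbabilityMeasure μ ∧ RandomZeros.RotInvariant μ ∧
          (∀ r : ℝ, 0 < r →
            μ.real (Metric.ball 0 r) = r * (Real.sqrt (4 + r ^ 2) - r) / 2) ∧
          RandomZeros.ConvInProb P
            (fun n ω => ((n - N n : ℕ) : ℝ≥0∞)⁻¹ •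
              RandomZeros.scale (Real.sqrt ((n : ℝ) / ((n - N n : ℕ) : ℝ)))
                (RandomZeros.derivZeros ξ n (N n) ω)) μ) ∧
      (∀ m : ℕ, (∀ᶠ n in atTop, n - N n = m) →
        RandomZeros.ConvInDistr P
          (fun n ω => RandomZeros.scale (Real.sqrt (n : ℝ))
            (RandomZeros.derivZeros ξ n (N n) ω))
          (fun ω => RandomZeros.zeroMeasure (RandomZeros.limitPoly ξ m ω)))) := by
  refine ⟨fun ha => ?_, fun a ha hlim => ?_, fun ha => ⟨fun hpos => ?_, fun hD => ?_, fun m hm => ?_⟩⟩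
  · refine ⟨RandomZeros.radialLaw (RandomZeros.radialQuantile 0 (1 - 0)⁻¹),
      RandomZeros.isProbabilityMeasure_radialLaw (RandomZeros.measurable_radialQuantile _ _),
      RandomZeros.rotInvariant_radialLaw (RandomZeros.measurable_radialQuantile _ _),
      fun r hr => ?_, RandomZeros.convInProb_derivZeros hmeas hindep hident hnondeg hlog hN le_rfl
        one_pos ha, ?_⟩
    · have h := RandomZeros.hasLeftDerivAt_legendreFenchel_neg_logUE le_rfl one_pos (Real.log r)
      rw [RandomZeros.logUE_zero, RandomZeros.legendrePoint, Real.exp_log hr] at h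
      rw [RandomZeros.radialLaw_real_ball le_rfl zero_le_one (by norm_num) hr]
      simpa using h
    -- The undifferentiated polynomials are the case of constant N = 0, with the same limit law
    -- since again a = 0.
    · have h := RandomZeros.convInProb_derivZeros hmeas hindep hident hnondeg hlog
        (N := fun _ => 0) (fun n => Nat.zero_le n) le_rfl one_pos (by simp)
      simpa [RandomZeros.derivZeros] using h
  · have h1a : 0 < 1 - a := sub_pos.2 ha.2
    refine ⟨RandomZeros.radialLaw (RandomZeros.radialQuantile a (1 - a)⁻¹),
      RandomZeros.isProbabilityMeasure_radialLaw (RandomZeros.measurable_radialQuantile _ _),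
      RandomZeros.rotInvariant_radialLaw (RandomZeros.measurable_radialQuantile _ _),
      fun r hr => ⟨_, RandomZeros.hasLeftDerivAt_legendreFenchel_neg_logUE ha.1.le ha.2 _, ?_⟩,
      RandomZeros.convInProb_derivZeros hmeas hindep hident hnondeg hlog hN ha.1.le ha.2 hlim⟩
    rw [RandomZeros.radialLaw_real_ball ha.1.le ha.2.le (inv_pos.2 h1a) hr,
      RandomZeros.legendrePoint, Real.exp_log hr, one_div, inv_mul_cancel_left₀ h1a.ne']
  · exact RandomZeros.convInProb_dirac_derivZeros hmeas hindep hident hnondeg hzero hlog hN ha hpos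
  · refine ⟨RandomZeros.radialLaw (RandomZeros.radialQuantile 1 1),
      RandomZeros.isProbabilityMeasure_radialLaw (RandomZeros.measurable_radialQuantile _ _),
      RandomZeros.rotInvariant_radialLaw (RandomZeros.measurable_radialQuantile _ _),
      fun r hr => ?_,
      RandomZeros.convInProb_scale_derivZeros hmeas hindep hident hnondeg hlog hN ha hD⟩
    rw [RandomZeros.radialLaw_real_ball zero_le_one le_rfl one_pos hr,
      RandomZeros.radialCDF_one_sq hr]
  · exact RandomZeros.convInDistr_scale_derivZeros hmeas hindep hident hzero hN hm
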